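/- **Setting.** Let $d\in\{2,3\}$, $\Omega=B_1(0)\subset\mathbb R^d$, $Q=\Omega\times(0,\infty)$. Suppose that there are constants $k_0,K_0>0$, $p\ge 3$, $\tilde\rho_1,\tilde\rho_2\in\mathbb R$ such that: - $f\in C^3(\mathbb R)$, $f\ge 0$, $f(s)=0$ if and only if $s=\pm1$, and $f''(s)\ge k_0|s|^{p-2}$ whenever $|s|\ge 1-k_0$; - $\rho,a,\nu\in C^1(\mathbb R)$ with $k_0\le\rho,a,\nu\le K_0$, and $\rho(s)=\frac{\tilde\rho_2+\tilde\rho_1}2+\frac{\tilde\rho_2-\tilde\rho_1}2 s$ for $s\in[-1,1]$; - $m_\varepsilon,m_0\in C^1(\mathbb R)$ for $\varepsilon\in(0,1]$, $0\le m_\varepsilon,m_0\le K_0$, $m_\varepsilon\to m_0$ in $C^1(\mathbb R)$ (uniformly together with the first derivatives) as $\varepsilon\searrow0$, and either $m_0\ge k_0$ or $m_0\equiv0$; if $m_0\equiv 0$, then $m_\varepsilon\ge\overline m_\varepsilon$ for constants $\overline m_\varepsilon>0$ with $\overline m_\varepsilon\to0$ as $\varepsilon\searrow0$. Let $A(s)=\int_0^s\sqrt{a(\tau)}\,d\tau$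 and, for $\varepsilon>0$, $$\mathcal E_\varepsilon(c)=\int_\Omega\Big(\varepsilon\frac{|\nabla A(c)|^2}2+\frac{f(c)}\varepsilon\Big)dx,\qquad \xi^\varepsilon(c)=\frac\varepsilon2|\nabla A(c)|^2-\frac1\varepsilon f(c).$$ **Weak solutions.** Let $C^\infty_{0,\sigma}(\Omega)$ be the space of smooth, compactly supported, divergence free vector fields on $\Omega$, let $L^2_\sigma(\Omega)$ be its closure in $L^2(\Omega)^d$, let $BC_\omega$ denote bounded weakly continuous functions, and let $D\mathbf v=\frac12(\nabla\mathbf v+\nabla\mathbf v^T)$. A weak solution (with parameter $\varepsilon$) for initial data $(\mathbf v_{0,\varepsilon},c_{0,\varepsilon})\in L^2_\sigma(\Omega)\times H^1(\Omega)$ is a triple $(\mathbf v_\varepsilon,c_\varepsilon,\mu_\varepsilon)$ with $\mathbf v_\varepsilon\in BC_\omega([0,\infty);L^2_\sigma(\Omega))\cap L^2(0,\infty;H^1_0(\Omega)^d)$, $c_\varepsilon\in BC_\omega([0,\infty);H^1(\Omega))\cap L^2_{loc}([0,\infty);H^2(\Omega))$, $f(c_\varepsilon),\mu_\varepsilon\in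 L^2_{loc}([0,\infty);L^2(\Omega))$, $\nabla\mu_\varepsilon\in L^2(0,\infty;L^2(\Omega)^d)$, $(\mathbf v_\varepsilon,c_\varepsilon)|_{t=0}=(\mathbf v_{0,\varepsilon},c_{0,\varepsilon})$, such that, with $\tilde{\mathbf J}_\varepsilon=-\rho'(c_\varepsilon)m_\varepsilon(c_\varepsilon)\nabla\mu_\varepsilon$ (all integrands below being integrable): 1. for all $\boldsymbol\varphi\in C_0^\infty([0,\infty);C^\infty_{0,\sigma}(\Omega))$, $$\int_Q\Big(-\rho(c_\varepsilon)\mathbf v_\varepsilon\cdot\partial_t\boldsymbol\varphi-\mathbf v_\varepsilon\otimes(\rho(c_\varepsilon)\mathbf v_\varepsilon+\tilde{\mathbf J}_\varepsilon):\nabla\boldsymbol\varphi+\nu(c_\varepsilon)D\mathbf v_\varepsilon:D\boldsymbol\varphi\Big)d(x,t)-\int_\Omega\rho(c_{0,\varepsilon})\mathbf v_{0,\varepsilon}\cdot\boldsymbol\varphi|_{t=0}\,dx=\int_Q\varepsilon a(c_\varepsilon)\nabla c_\varepsilon\otimes\nabla c_\varepsilon:\nabla\boldsymbol\varphi\,d(x,t);$$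 2. for all $\psi\in C^\infty_0([0,\infty)\times\overline\Omega)$, $$\int_Q c_\varepsilon(\partial_t\psi+\operatorname{div}(\psi\mathbf v_\varepsilon))\,d(x,t)+\int_\Omega c_{0,\varepsilon}\psi|_{t=0}\,dx=\int_Q m_\varepsilon(c_\varepsilon)\nabla\mu_\varepsilon\cdot\nabla\psi\,d(x,t);$$ 3. $\mu_\varepsilon=\varepsilon^{-1}f'(c_\varepsilon)+\varepsilon a'(c_\varepsilon)\frac{|\nabla c_\varepsilon|^2}2-\varepsilon\operatorname{div}(a(c_\varepsilon)\nabla c_\varepsilon)$ a.e. in $Q$, and $\mathbf n_{\partial\Omega}\cdot\nabla c_\varepsilon=0$ on $\partial\Omega$ for a.e. $t>0$; 4. for almost every $s\ge0$, including $s=0$, and all $t\ge s$, $$\int_\Omega\tfrac12\rho(c_\varepsilon(t))|\mathbf v_\varepsilon(t)|^2dx+\mathcal E_\varepsilon(c_\varepsilon(t))+\int_s^t\!\int_\Omega\big(\nu(c_\varepsilon)|D\mathbf v_\varepsilon|^2+m_\varepsilon(c_\varepsilon)|\nabla\mu_\varepsilon|^2\big)dx\,d\tau\le\int_\Omega\tfrac12\rho(c_\varepsilon(s))|\mathbf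 v_\varepsilon(s)|^2dx+\mathcal E_\varepsilon(c_\varepsilon(s)).$$ **Theorem.** Let $R>0$ and $\bar c\in(-1,1)$, and for every $\varepsilon\in(0,1]$ let $(\mathbf v_\varepsilon,c_\varepsilon,\mu_\varepsilon)$ be a weak solution whose initial data satisfy $\frac1{|\Omega|}\int_\Omega c_{0,\varepsilon}\,dx=\bar c$ and $\int_\Omega\frac12|\mathbf v_{0,\varepsilon}|^2dx+\mathcal E_\varepsilon(c_{0,\varepsilon})\le R$. Assume that these solutions are radially symmetric: $c_\varepsilon$ and $\mu_\varepsilon$ depend only on $(|x|,t)$, and $\mathbf v_\varepsilon(Ox,t)=O\mathbf v_\varepsilon(x,t)$ for all rotations $O\in SO(d)$ (as is the case for $\mathbf v_\varepsilon=u(|x|,t)\frac{x}{|x|}$). Assume moreover that $A(s)=s$ for all $s\in\mathbb R$ and, in the case $m_0\equiv0$, that $\varepsilon^{\frac1{d-1}}/\overline m_\varepsilon\to0$ as $\varepsilon\searrow0$. Then, for every $T>0$, $\xi^\varepsilon(c_\varepsilon)\in L^1(\Omega\times(0,T))$ for all $\varepsilon\in(0,1]$ and $$\lim_{\varepsilon\searrow0}\int_0^T\int_\Omega|\xi^\varepsilon(c_\varepsilon)|\,d(x,t)=0.$$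 -/

import Mathlib

open Set Filter Topology MeasureTheory
open scoped ENNReal ContDiff

noncomputable section

namespace NSCH

/-- Euclidean space of dimension `d`. -/
abbrev E (d : ℕ) : Type := EuclideanSpace ℝ (Fin d)

/-! ### Pointwise linear algebra -/

/-- The product `A : B = ∑ i j, A i j * B i j` of two matrices. -/
def frob {d : ℕ} (A B : Matrix (Fin d) (Fin d) ℝ) : ℝ := ∑ i, ∑ j, A i j * B i j

/-- The symmetric part of a matrix; applied to `∇v` it gives `Dv = (∇v + ∇vᵀ) / 2`. -/
def symPart {d : ℕ} (A : Matrix (Fin d) (Fin d) ℝ) : Matrix (Fin d) (Fin d) ℝ :=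
  Matrix.of fun i j => (A i j + A j i) / 2

/-- The matrix `a ⊗ b` with entries `a i * b j`. -/
def tensor {d : ℕ} (a b : E d) : Matrix (Fin d) (Fin d) ℝ := Matrix.of fun i j => a i * b j

/-- The classical gradient matrix `(∇w) i j = ∂_j w_i` of a differentiable vector field; its trace
is the divergence of `w`. -/
def jac {d : ℕ} (w : E d → E d) (x : E d) : Matrix (Fin d) (Fin d) ℝ :=
  Matrix.of fun i j => fderiv ℝ w x (EuclideanSpace.single j 1) i

/-! ### Function spaces -/

/-- `g` is the weak partial derivative `∂_i u` in the open set `Ω`. -/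
def HasWeakPartial {d : ℕ} (Ω : Set (E d)) (i : Fin d) (u g : E d → ℝ) : Prop :=
  LocallyIntegrableOn u Ω ∧ LocallyIntegrableOn g Ω ∧
    ∀ φ : E d → ℝ, ContDiff ℝ ∞ φ → HasCompactSupport φ → tsupport φ ⊆ Ω →
      ∫ x in Ω, u x * fderiv ℝ φ x (EuclideanSpace.single i 1) = - ∫ x in Ω, g x * φ x

/-- `G` is the weak gradient of the scalar function `u` in `Ω`. -/
def HasWeakGrad {d : ℕ} (Ω : Set (E d)) (u : E d → ℝ) (G : E d → E d) : Prop :=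
  ∀ i, HasWeakPartial Ω i u fun x => G x i

/-- `G` (with `G i j = ∂_j w_i`) is the weak gradient of the vector field `w` in `Ω`. -/
def HasWeakJac {d : ℕ} (Ω : Set (E d)) (w : E d → E d)
    (G : E d → Matrix (Fin d) (Fin d) ℝ) : Prop :=
  ∀ i j, HasWeakPartial Ω j (fun x => w x i) fun x => G x i j

/-- `w` has weak gradient `G` in `Ω` and zero trace on `∂Ω`: the extension of `w` by zero is weakly
differentiable in the whole space, and its gradient is the extension of `G` by zero. -/
def HasWeakJacZeroTrace {d : ℕ} (Ω : Set (E d)) (w : E d → E d)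
    (G : E d → Matrix (Fin d) (Fin d) ℝ) : Prop :=
  HasWeakJac Ω w G ∧
    ∀ i j, HasWeakPartial univ j (Ω.indicator fun x => w x i) (Ω.indicator fun x => G x i j)

/-- `u` lies in `H¹(Ω)` and has weak gradient `G`. -/
def MemH1 {d : ℕ} (Ω : Set (E d)) (u : E d → ℝ) (G : E d → E d) : Prop :=
  MemLp u 2 (volume.restrict Ω) ∧ MemLp G 2 (volume.restrict Ω) ∧ HasWeakGrad Ω u G

/-- `C^∞_{0,σ}(Ω)`: smooth divergence free vector fields with compact support in `Ω`. -/
def IsSolenoidalTest {d : ℕ} (Ω : Set (E d)) (φ : E d → E d) : Prop :=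
  ContDiff ℝ ∞ φ ∧ HasCompactSupport φ ∧ tsupport φ ⊆ Ω ∧ ∀ x, (jac φ x).trace = 0

/-- `L²_σ(Ω)`: the closure of `C^∞_{0,σ}(Ω)` in `L²(Ω)^d`. -/
def MemL2sigma {d : ℕ} (Ω : Set (E d)) (w : E d → E d) : Prop :=
  MemLp w 2 (volume.restrict Ω) ∧
    ∀ δ : ℝ, 0 < δ → ∃ φ, IsSolenoidalTest Ω φ ∧
      eLpNorm (fun x => w x - φ x) 2 (volume.restrict Ω) < ENNReal.ofReal δ

/-- `BC_ω([0,∞); L²(Ω; F))`: bounded, weakly continuous functions of time with values in `L²`. -/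
def MemBCw {d : ℕ} {F : Type*} [NormedAddCommGroup F] [InnerProductSpace ℝ F]
    (Ω : Set (E d)) (u : ℝ → E d → F) : Prop :=
  (∀ t, 0 ≤ t → MemLp (u t) 2 (volume.restrict Ω)) ∧
  (∃ C : ℝ, ∀ t, 0 ≤ t → eLpNorm (u t) 2 (volume.restrict Ω) ≤ ENNReal.ofReal C) ∧
  ∀ φ : E d → F, MemLp φ 2 (volume.restrict Ω) →
    ContinuousOn (fun t => ∫ x in Ω, inner ℝ (u t x) (φ x)) (Ici 0)

/-- The space-time cylinder `I × Ω`, time being the first coordinate. -/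
def cyl {d : ℕ} (I : Set ℝ) (Ω : Set (E d)) : Set (ℝ × E d) := I ×ˢ Ω

/-! ### Data of the model -/

/-- The standing assumptions on the potential `f`, the density `ρ`, the coefficient `a`, the
viscosity `ν`, the mobilities `m ε` for `0 < ε ≤ 1`, their limit `m0` and the lower bounds
`mbar ε`, with constants `k0, K0 > 0`, the exponent `p ≥ 3` and specific densities `ρ₁, ρ₂`. -/
structure Assumptions (f ρ a ν : ℝ → ℝ) (m : ℝ → ℝ → ℝ) (m0 mbar : ℝ → ℝ)
    (k0 K0 p ρ₁ ρ₂ : ℝ) : Prop where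
  k0_pos : 0 < k0
  K0_pos : 0 < K0
  p_ge : 3 ≤ p
  f_smooth : ContDiff ℝ 3 f
  f_nonneg : ∀ s, 0 ≤ f s
  f_zero : ∀ s, f s = 0 ↔ s = -1 ∨ s = 1
  f_convex : ∀ s, 1 - k0 ≤ |s| → k0 * |s| ^ (p - 2) ≤ iteratedDeriv 2 f s
  ρ_smooth : ContDiff ℝ 1 ρ
  a_smooth : ContDiff ℝ 1 a
  ν_smooth : ContDiff ℝ 1 ν
  ρ_bounds : ∀ s, k0 ≤ ρ s ∧ ρ s ≤ K0
  a_bounds : ∀ s, k0 ≤ a s ∧ a s ≤ K0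
  ν_bounds : ∀ s, k0 ≤ ν s ∧ ν s ≤ K0
  ρ_affine : ∀ s ∈ Icc (-1 : ℝ) 1, ρ s = (ρ₂ + ρ₁) / 2 + (ρ₂ - ρ₁) / 2 * s
  m_smooth : ∀ ε ∈ Ioc (0 : ℝ) 1, ContDiff ℝ 1 (m ε)
  m0_smooth : ContDiff ℝ 1 m0
  m_bounds : ∀ ε ∈ Ioc (0 : ℝ) 1, ∀ s, 0 ≤ m ε s ∧ m ε s ≤ K0
  m0_bounds : ∀ s, 0 ≤ m0 s ∧ m0 s ≤ K0
  m_tendsto : TendstoUniformly m m0 (𝓝[>] 0)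
  m_deriv_tendsto : TendstoUniformly (fun ε => deriv (m ε)) (deriv m0) (𝓝[>] 0)
  m0_cases : (∀ s, k0 ≤ m0 s) ∨ (∀ s, m0 s = 0)
  mbar_bounds : (∀ s, m0 s = 0) → ∀ ε ∈ Ioc (0 : ℝ) 1, 0 < mbar ε ∧ ∀ s, mbar ε ≤ m ε s
  mbar_tendsto : (∀ s, m0 s = 0) → Tendsto mbar (𝓝[>] 0) (𝓝 0)

/-- `A(s) = ∫₀ˢ √a`. -/
def primA (a : ℝ → ℝ) (s : ℝ) : ℝ := ∫ τ in (0 : ℝ)..s, Real.sqrt (a τ)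

/-- `∇A(c) = √a(c) ∇c`, for `c = s` and `∇c = g` at a point. -/
def gradA {d : ℕ} (a : ℝ → ℝ) (s : ℝ) (g : E d) : E d := Real.sqrt (a s) • g

/-- Free energy density `e_ε(c) = ε |∇A(c)|² / 2 + f(c) / ε`, for `c = s`, `∇c = g`. -/
def energyDensity {d : ℕ} (ε : ℝ) (f a : ℝ → ℝ) (s : ℝ) (g : E d) : ℝ :=
  ε * (‖gradA a s g‖ ^ 2 / 2) + f s / ε

/-- Discrepancy `ξ^ε(c) = ε |∇A(c)|² / 2 - f(c) / ε`, for `c = s`, `∇c = g`. -/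
def discrepancy {d : ℕ} (ε : ℝ) (f a : ℝ → ℝ) (s : ℝ) (g : E d) : ℝ :=
  ε / 2 * ‖gradA a s g‖ ^ 2 - 1 / ε * f s

/-- The free energy `𝓔_ε(c)` of a function `u` with gradient `G`, as an extended real. -/
def freeEnergy {d : ℕ} (Ω : Set (E d)) (ε : ℝ) (f a : ℝ → ℝ) (u : E d → ℝ) (G : E d → E d) :
    ℝ≥0∞ :=
  ∫⁻ x in Ω, ENNReal.ofReal (energyDensity ε f a (u x) (G x))

/-- The kinetic energy `∫ ρ(c) |v|² / 2`, as an extended real. -/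
def kineticEnergy {d : ℕ} (Ω : Set (E d)) (ρ : ℝ → ℝ) (u : E d → ℝ) (w : E d → E d) : ℝ≥0∞ :=
  ∫⁻ x in Ω, ENNReal.ofReal (ρ (u x) * ‖w x‖ ^ 2 / 2)

/-- Velocity `v`, order parameter `c`, chemical potential `μ` and initial values `v0`, `c0`,
together with the weak spatial derivatives `∇v`, `∇c`, `∇²c`, `∇μ`, `∇c0`
(that they are these derivatives is part of `IsWeakSolution`). Time is the first argument. -/
structure Fields (d : ℕ) where
  v : ℝ → E d → E d
  gradv : ℝ → E d → Matrix (Fin d) (Fin d) ℝ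
  c : ℝ → E d → ℝ
  gradc : ℝ → E d → E d
  hessc : ℝ → E d → Matrix (Fin d) (Fin d) ℝ
  μ : ℝ → E d → ℝ
  gradμ : ℝ → E d → E d
  v0 : E d → E d
  c0 : E d → ℝ
  gradc0 : E d → E d

variable {d : ℕ}

/-- The flux `J̃ = ρ'(c) J` with `J = - m_ε(c) ∇μ`. -/
def Fields.fluxJ (S : Fields d) (ρ mε : ℝ → ℝ) (t : ℝ) (x : E d) : E d :=
  (deriv ρ (S.c t x) * -(mε (S.c t x))) • S.gradμ t x

/-- The integrand
`-ρ(c) v·∂ₜφ - (v ⊗ (ρ(c) v + J̃)) : ∇φ + ν(c) Dv : Dφ` of the momentum equation. -/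
def Fields.momentumLHS (S : Fields d) (ρ ν mε : ℝ → ℝ) (φ : ℝ → E d → E d) (t : ℝ) (x : E d) :
    ℝ :=
  -(ρ (S.c t x) * inner ℝ (S.v t x) (deriv (fun s => φ s x) t))
    - frob (tensor (S.v t x) (ρ (S.c t x) • S.v t x + S.fluxJ ρ mε t x)) (jac (φ t) x)
    + ν (S.c t x) * frob (symPart (S.gradv t x)) (symPart (jac (φ t) x))

/-- The integrand `ε a(c) (∇c ⊗ ∇c) : ∇φ` of the capillary term. -/
def Fields.capillary (S : Fields d) (ε : ℝ) (a : ℝ → ℝ) (φ : ℝ → E d → E d) (t : ℝ) (x : E d) :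
    ℝ :=
  ε * a (S.c t x) * frob (tensor (S.gradc t x) (S.gradc t x)) (jac (φ t) x)

/-- The integrand `c (∂ₜψ + div (ψ v))`, where `div (ψ v) = ψ div v + ∇ψ · v`. -/
def Fields.transport (S : Fields d) (ψ : ℝ → E d → ℝ) (t : ℝ) (x : E d) : ℝ :=
  S.c t x * (deriv (fun s => ψ s x) t
    + (ψ t x * (S.gradv t x).trace + fderiv ℝ (ψ t) x (S.v t x)))

/-- The integrand `m_ε(c) ∇μ · ∇ψ`. -/
def Fields.diffusion (S : Fields d) (mε : ℝ → ℝ) (ψ : ℝ → E d → ℝ) (t : ℝ) (x : E d) : ℝ :=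
  mε (S.c t x) * fderiv ℝ (ψ t) x (S.gradμ t x)

/-- `div (a(c) ∇c) = a'(c) |∇c|² + a(c) Δc`. -/
def Fields.divAGrad (S : Fields d) (a : ℝ → ℝ) (t : ℝ) (x : E d) : ℝ :=
  deriv a (S.c t x) * ‖S.gradc t x‖ ^ 2 + a (S.c t x) * (S.hessc t x).trace

/-- The energy inequality between the times `s ≤ t`; all terms are nonnegative. -/
def Fields.EnergyIneq (S : Fields d) (Ω : Set (E d)) (ε : ℝ) (f ρ a ν mε : ℝ → ℝ) (s t : ℝ) :
    Prop :=
  kineticEnergy Ω ρ (S.c t) (S.v t) + freeEnergy Ω ε f a (S.c t) (S.gradc t)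
    + (∫⁻ z in cyl (Ioo s t) Ω, ENNReal.ofReal
        (ν (S.c z.1 z.2) * frob (symPart (S.gradv z.1 z.2)) (symPart (S.gradv z.1 z.2))))
    + (∫⁻ z in cyl (Ioo s t) Ω, ENNReal.ofReal (mε (S.c z.1 z.2) * ‖S.gradμ z.1 z.2‖ ^ 2))
  ≤ kineticEnergy Ω ρ (S.c s) (S.v s) + freeEnergy Ω ε f a (S.c s) (S.gradc s)

/-- Weak solutions on `[0,∞)`, with parameter `ε` and mobility `mε`, of the diffuse interface system
```
ρ ∂ₜv + (ρ v + ρ'(c) J)·∇v - div (ν(c) Dv) + ∇p = -ε div (a(c) ∇c ⊗ ∇c),   div v = 0,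
∂ₜc + v·∇c = div (mε(c) ∇μ),   μ = f'(c)/ε + ε a'(c) |∇c|²/2 - ε div (a(c) ∇c),
```
`J = -mε(c) ∇μ`, with `v = 0`, `n·∇c = 0`, `n·∇μ = 0` on `∂Ω` and `(v, c) = (v0, c0)` at `t = 0`. -/
structure IsWeakSolution (Ω : Set (E d)) (ε : ℝ) (f ρ a ν mε : ℝ → ℝ) (S : Fields d) : Prop where
  -- initial data
  v0_mem : MemL2sigma Ω S.v0
  c0_mem : MemH1 Ω S.c0 S.gradc0
  v_init : S.v 0 =ᵐ[volume.restrict Ω] S.v0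
  c_init : S.c 0 =ᵐ[volume.restrict Ω] S.c0
  -- `v ∈ BC_ω([0,∞); L²_σ) ∩ L²(0,∞; H¹)`, `v = 0` on `∂Ω`
  v_bcw : MemBCw Ω S.v
  v_sigma : ∀ t, 0 ≤ t → MemL2sigma Ω (S.v t)
  v_L2 : MemLp (fun z : ℝ × E d => S.v z.1 z.2) 2 (volume.restrict (cyl (Ioi 0) Ω))
  gradv_L2 : ∀ i j, MemLp (fun z : ℝ × E d => S.gradv z.1 z.2 i j) 2
    (volume.restrict (cyl (Ioi 0) Ω))
  gradv_weak : ∀ᵐ t ∂volume.restrict (Ioi (0 : ℝ)), HasWeakJacZeroTrace Ω (S.v t) (S.gradv t)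
  -- `c ∈ BC_ω([0,∞); H¹) ∩ L²_loc([0,∞); H²)`, `f(c) ∈ L²_loc([0,∞); L²)`
  c_bcw : MemBCw Ω S.c
  gradc_bcw : MemBCw Ω S.gradc
  gradc_weak : ∀ t, 0 ≤ t → HasWeakGrad Ω (S.c t) (S.gradc t)
  c_L2 : ∀ T : ℝ, 0 < T →
    MemLp (fun z : ℝ × E d => S.c z.1 z.2) 2 (volume.restrict (cyl (Ioo 0 T) Ω))
  gradc_L2 : ∀ T : ℝ, 0 < T →
    MemLp (fun z : ℝ × E d => S.gradc z.1 z.2) 2 (volume.restrict (cyl (Ioo 0 T) Ω))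
  hessc_L2 : ∀ T : ℝ, 0 < T → ∀ i j,
    MemLp (fun z : ℝ × E d => S.hessc z.1 z.2 i j) 2 (volume.restrict (cyl (Ioo 0 T) Ω))
  hessc_weak : ∀ᵐ t ∂volume.restrict (Ioi (0 : ℝ)), HasWeakJac Ω (S.gradc t) (S.hessc t)
  fc_L2 : ∀ T : ℝ, 0 < T →
    MemLp (fun z : ℝ × E d => f (S.c z.1 z.2)) 2 (volume.restrict (cyl (Ioo 0 T) Ω))
  -- `μ ∈ L²_loc([0,∞); L²)`, `∇μ ∈ L²(0,∞; L²)`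
  μ_L2 : ∀ T : ℝ, 0 < T →
    MemLp (fun z : ℝ × E d => S.μ z.1 z.2) 2 (volume.restrict (cyl (Ioo 0 T) Ω))
  gradμ_L2 : MemLp (fun z : ℝ × E d => S.gradμ z.1 z.2) 2 (volume.restrict (cyl (Ioi 0) Ω))
  gradμ_weak : ∀ᵐ t ∂volume.restrict (Ioi (0 : ℝ)), HasWeakGrad Ω (S.μ t) (S.gradμ t)
  -- momentum equation, tested with `C^∞_0([0,∞); C^∞_{0,σ}(Ω))`
  momentum : ∀ φ : ℝ → E d → E d, ContDiff ℝ ∞ (Function.uncurry φ) →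
    HasCompactSupport (Function.uncurry φ) → tsupport (Function.uncurry φ) ⊆ cyl univ Ω →
    (∀ t x, (jac (φ t) x).trace = 0) →
      IntegrableOn (fun z => S.momentumLHS ρ ν mε φ z.1 z.2) (cyl (Ioi 0) Ω) ∧
      IntegrableOn (fun z => S.capillary ε a φ z.1 z.2) (cyl (Ioi 0) Ω) ∧
      (∫ z in cyl (Ioi 0) Ω, S.momentumLHS ρ ν mε φ z.1 z.2)
          - (∫ x in Ω, ρ (S.c0 x) * inner ℝ (S.v0 x) (φ 0 x))
        = ∫ z in cyl (Ioi 0) Ω, S.capillary ε a φ z.1 z.2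
  -- convective Cahn-Hilliard equation, tested with `C^∞_0([0,∞) × closure Ω)`
  phase : ∀ ψ : ℝ → E d → ℝ, ContDiff ℝ ∞ (Function.uncurry ψ) →
    HasCompactSupport (Function.uncurry ψ) →
      IntegrableOn (fun z => S.transport ψ z.1 z.2) (cyl (Ioi 0) Ω) ∧
      IntegrableOn (fun z => S.diffusion mε ψ z.1 z.2) (cyl (Ioi 0) Ω) ∧
      (∫ z in cyl (Ioi 0) Ω, S.transport ψ z.1 z.2) + (∫ x in Ω, S.c0 x * ψ 0 x)
        = ∫ z in cyl (Ioi 0) Ω, S.diffusion mε ψ z.1 z.2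
  -- chemical potential
  potential : ∀ᵐ z ∂volume.restrict (cyl (Ioi 0) Ω),
    S.μ z.1 z.2 = deriv f (S.c z.1 z.2) / ε
      + ε * deriv a (S.c z.1 z.2) * (‖S.gradc z.1 z.2‖ ^ 2 / 2) - ε * S.divAGrad a z.1 z.2
  -- `n · ∇c = 0` on `∂Ω`: the normal trace of `∇c`, defined by Green's formula, vanishes
  neumann : ∀ᵐ t ∂volume.restrict (Ioi (0 : ℝ)), ∀ ψ : E d → ℝ, ContDiff ℝ ∞ ψ →
    HasCompactSupport ψ →
      ∫ x in Ω, (fderiv ℝ ψ x (S.gradc t x) + (S.hessc t x).trace * ψ x) = 0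
  -- energy inequality for all `t ≥ s` and almost all `s ≥ 0`, including `s = 0`
  energy : ∀ᵐ s ∂volume.restrict (Ioi (0 : ℝ)), ∀ t, s ≤ t → S.EnergyIneq Ω ε f ρ a ν mε s t
  energy_zero : ∀ t, 0 ≤ t → S.EnergyIneq Ω ε f ρ a ν mε 0 t

/-- A scalar function on `(0,∞) × Ω` that depends on `t` and `|x|` only. -/
def IsRadialScalar (Ω : Set (E d)) (u : ℝ → E d → ℝ) : Prop :=
  ∃ U : ℝ → ℝ → ℝ, ∀ᵐ z ∂volume.restrict (cyl (Ioi 0) Ω), u z.1 z.2 = U z.1 ‖z.2‖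

/-- A vector field on `(0,∞) × Ω` (`Ω` rotationally invariant) that commutes with all rotations of
the space variable. All fields of the form `w(t,|x|) x/|x|` do. -/
def IsRadialVector (Ω : Set (E d)) (v : ℝ → E d → E d) : Prop :=
  ∀ R : E d ≃ₗᵢ[ℝ] E d, LinearMap.det (R.toLinearEquiv : E d →ₗ[ℝ] E d) = 1 →
    ∀ᵐ z ∂volume.restrict (cyl (Ioi 0) Ω), v z.1 (R z.2) = R (v z.1 z.2)

/-- Radial symmetry of velocity, order parameter and chemical potential. -/
def Fields.IsRadial (S : Fields d) (Ω : Set (E d)) : Prop :=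
  IsRadialVector Ω S.v ∧ IsRadialScalar Ω S.c ∧ IsRadialScalar Ω S.μ

end NSCH

end

namespace NSCH

/-! The condition `A(s) = s` forces `a = 1`, so each time slice of a radial solution is a function
`U(r)` with `ε (U'' + (d-1) U'/r) = f'(U)/ε - m`, where `m` is the radial chemical potential.
Throughout `d = j + 2` and the polar weight is `r^(j+1)`. Write `e = ε U'²/2 + f(U)/ε`, `ξ = ε U'²/2
- f(U)/ε`, and let `N` measure the weighted `L²` norm of `m'`, with `N ≥ 1`. The whole argument is
an ODE estimate on one slice, uniform in `ε` and at most quadratic in `N`, followed by integration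
in time against the dissipation.

The equation gives `(r^(d-1) ξ)' = -m U' r^(d-1) - (d-1) r^(d-2) e` (`Profile.disc_identity`). In `∫
m U' r^(d-1)` the derivative is moved from `U` to `m`, so that only sup bounds of `U` and `m` and
the norm of `m'` enter and no negative power of `ε` appears (`Profile.integral_m_g_le`). Hence both
`∫ r^(d-2) e` and `r^(d-1) |ξ|` are bounded by a constant `G` (`Profile.density_le`,
`Profile.disc_le`). The value `m(1)` inside `G` is `O(N)`: a test function built from the truncation
of `U` minus its mean isolates `m(1)` times a variance, and the variance is bounded below because
`U` is close to `±1` while its mean `c̄` lies strictly between (`Profile.variance_ge`,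
`Profile.m_one_le`).

To show that `ξ` is small in `L¹`, fix a small `η` (`Profile.integral_disc_le_aux`). Where `|U| ≥ 1
- η`, testing the equation with a function of `U` that equals `U ∓ 1` near the wells and has size
`η` between them shows that the energy is `O(η)` up to a term of order `ε N²/η`. Where `|U| < 1 -
η`, one has `f(U) ≥ η²/C`. With `δ = ε^(1/(d-1))`, the bound of `r^(d-1) |ξ|` by `G` gives `r^(d-1)
|ξ| ≤ K δ r^(d-2) e` for `r ≥ δ`, and for `r ≤ δ` the weight alone gives it. So this region
contributes `O(δ G²) = O(δ N²)`.

In time, `∫ N²` is at most a constant plus a multiple of `1/κ`, with `κ` a lower bound of the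
mobility. The total is `θ T + K (δ T + δ E0/κ)` with `θ` arbitrary, and `δ/κ → 0` is the assumption
on the mobility. The rest of the file passes from weak solutions to profiles: polar coordinates,
weak radial derivatives, the Neumann condition as a flux identity (`radial_flux`, `exists_profile`)
and conservation of mass. -/

/-! ### The double well potential -/

/-- The properties of the double well potential that enter the estimates. -/
structure DoubleWell (f : ℝ → ℝ) (k C : ℝ) : Prop where
  diff : ∀ s, HasDerivAt f (deriv f s) s
  cont_deriv : Continuous (deriv f)
  nonneg : ∀ s, 0 ≤ f s
  k_pos : 0 < k
  one_le : 1 ≤ C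
  dist_sq_le : ∀ s, (|s| - 1) ^ 2 ≤ C * f s
  right : ∀ s, 1 - k ≤ s → f s ≤ deriv f s * (s - 1)
  left : ∀ s, s ≤ -(1 - k) → f s ≤ deriv f s * (s + 1)
  deriv_le : ∀ s, |s| ≤ 1 → |deriv f s| ≤ C

/-- The sign condition makes `h` decrease up to `1` and increase afterwards, so its minimum is the
value at `1`. -/
theorem nonneg_of_deriv_mul_sub_nonneg {h h' : ℝ → ℝ} {a : ℝ} (ha : a < 1)
    (hd : ∀ s, HasDerivAt h (h' s) s) (h1 : h 1 = 0)
    (hs : ∀ s, a ≤ s → 0 ≤ h' s * (s - 1)) : ∀ s, a ≤ s → 0 ≤ h s := by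
  have hc : Continuous h := continuous_iff_continuousAt.2 fun s => (hd s).continuousAt
  intro s has
  rcases le_total 1 s with h1s | h1s
  · have : MonotoneOn h (Ici 1) := by
      refine monotoneOn_of_deriv_nonneg (convex_Ici 1) hc.continuousOn
        (fun x _ => (hd x).differentiableAt.differentiableWithinAt) fun x hx => ?_
      rw [interior_Ici, mem_Ioi] at hx
      rw [(hd x).deriv]
      have := hs x (by linarith)
      by_contra hn
      nlinarith
    rw [← h1]
    exact this (by simp) h1s h1s
  · have : AntitoneOn h (Icc a 1) := by
      refine antitoneOn_of_deriv_nonpos (convex_Icc a 1) hc.continuousOn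
        (fun x _ => (hd x).differentiableAt.differentiableWithinAt) fun x hx => ?_
      rw [interior_Icc, mem_Ioo] at hx
      rw [(hd x).deriv]
      have := hs x (by linarith)
      by_contra hn
      nlinarith
    rw [← h1]
    exact this ⟨has, h1s⟩ ⟨ha.le, le_rfl⟩ h1s

/-- Quantitative convexity near the minimum at `1`. -/
theorem convex_well {f f1 f2 : ℝ → ℝ} {a κ : ℝ} (ha : a < 1) (hκ : 0 ≤ κ)
    (h1 : ∀ s, HasDerivAt f (f1 s) s) (h2 : ∀ s, HasDerivAt f1 (f2 s) s)
    (hf1 : f 1 = 0) (hf11 : f1 1 = 0) (hc : ∀ s, a ≤ s → κ ≤ f2 s) :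
    ∀ s, a ≤ s → f s ≤ f1 s * (s - 1) ∧ κ / 2 * (s - 1) ^ 2 ≤ f s := by
  intro s hs
  constructor
  · have := nonneg_of_deriv_mul_sub_nonneg (h := fun s => f1 s * (s - 1) - f s)
      (h' := fun s => f2 s * (s - 1)) ha ?_ (by simp [hf1]) ?_ s hs
    · linarith
    · intro s
      have := ((h2 s).mul ((hasDerivAt_id s).sub_const 1)).sub (h1 s)
      refine this.congr_deriv ?_
      simp
    · intro s hs
      have := hc s hs
      nlinarith [mul_nonneg (hκ.trans this) (sq_nonneg (s - 1))]
  · have key : ∀ s, a ≤ s → 0 ≤ (f1 s - κ * (s - 1)) * (s - 1) := by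
      intro s hs
      have hd : ∀ s, HasDerivAt (fun s => f1 s - κ * (s - 1)) (f2 s - κ) s := fun s => by
        refine ((h2 s).sub (((hasDerivAt_id s).sub_const 1).const_mul κ)).congr_deriv ?_
        simp
      have hmono : MonotoneOn (fun s => f1 s - κ * (s - 1)) (Ici a) := by
        refine monotoneOn_of_deriv_nonneg (convex_Ici a)
          (fun x _ => (hd x).continuousAt.continuousWithinAt)
          (fun x _ => (hd x).differentiableAt.differentiableWithinAt) fun x hx => ?_
        rw [interior_Ici, mem_Ioi] at hx
        rw [(hd x).deriv]
        linarith [hc x hx.le]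
      rcases le_total 1 s with h1s | h1s
      · have := hmono (mem_Ici.2 ha.le) (mem_Ici.2 hs) h1s
        simp only [hf11] at this
        exact mul_nonneg (by linarith) (by linarith)
      · have := hmono (mem_Ici.2 hs) (mem_Ici.2 ha.le) h1s
        simp only [hf11] at this
        exact mul_nonneg_of_nonpos_of_nonpos (by linarith) (by linarith)
    have := nonneg_of_deriv_mul_sub_nonneg (h := fun s => f s - κ / 2 * (s - 1) ^ 2)
      (h' := fun s => f1 s - κ * (s - 1)) ha ?_ (by simp [hf1]) key s hs
    · linarith
    · intro s
      refine ((h1 s).sub ((((hasDerivAt_id s).sub_const 1).pow 2).const_mul (κ / 2))).congr_deriv ?_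
      simp
      ring

/-- The lower bound for `f''` gives uniform convexity for `|s| ≥ 1 - k`, hence all estimates at the
right well; the left well follows by reflection. On the compact middle part `f` has a positive
minimum. -/
theorem exists_doubleWell {f : ℝ → ℝ} {k0 p : ℝ} (hk0 : 0 < k0) (hp : 3 ≤ p)
    (hf : ContDiff ℝ 3 f) (hnn : ∀ s, 0 ≤ f s) (hz : ∀ s, f s = 0 ↔ s = -1 ∨ s = 1)
    (hc : ∀ s, 1 - k0 ≤ |s| → k0 * |s| ^ (p - 2) ≤ iteratedDeriv 2 f s) :
    ∃ k C, DoubleWell f k C := by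
  have hf1 : ContDiff ℝ 2 (deriv f) := hf.deriv' (n := 2)
  have hd1 : ∀ s, HasDerivAt f (deriv f s) s := fun s =>
    ((hf.differentiable (by norm_num)) s).hasDerivAt
  have hd2 : ∀ s, HasDerivAt (deriv f) (iteratedDeriv 2 f s) s := fun s => by
    rw [iteratedDeriv_succ, iteratedDeriv_one]
    exact ((hf1.differentiable (by norm_num)) s).hasDerivAt
  have hz1 : f 1 = 0 := (hz 1).2 (Or.inr rfl)
  have hzm1 : f (-1) = 0 := (hz (-1)).2 (Or.inl rfl)
  have hdz : ∀ s, f s = 0 → deriv f s = 0 := fun s hs =>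
    IsLocalMin.deriv_eq_zero (Filter.Eventually.of_forall fun x => by rw [hs]; exact hnn x)
  -- The cap `1/2` keeps `|s| ≥ 1/2` in the convex region, so the power `|s|^(p-2)` is at least
  -- `(1/2)^(p-2)`.
  set k := min k0 (1 / 2) with hk
  have hkpos : 0 < k := lt_min hk0 (by norm_num)
  have hkle : k ≤ 1 / 2 := min_le_right _ _
  set κ := k0 * (1 / 2 : ℝ) ^ (p - 2) with hκ
  have hκpos : 0 < κ := mul_pos hk0 (Real.rpow_pos_of_pos (by norm_num) _)
  have hconv : ∀ s, 1 - k ≤ |s| → κ ≤ iteratedDeriv 2 f s := fun s hs => by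
    refine le_trans ?_ (hc s (by linarith [min_le_left k0 (1 / 2)]))
    exact mul_le_mul_of_nonneg_left
      (Real.rpow_le_rpow (by norm_num) (by linarith) (by linarith)) hk0.le
  have hR := convex_well (a := 1 - k) (by linarith) hκpos.le hd1 hd2 hz1 (hdz 1 hz1)
    fun s hs => hconv s (hs.trans (le_abs_self s))
  have hL := convex_well (f := fun s => f (-s)) (f1 := fun s => -deriv f (-s))
    (f2 := fun s => iteratedDeriv 2 f (-s)) (a := 1 - k) (by linarith) hκpos.le
    (fun s => ((hd1 (-s)).comp s (hasDerivAt_neg s)).congr_deriv (by simp))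
    (fun s => ((hd2 (-s)).comp s (hasDerivAt_neg s)).neg.congr_deriv (by simp)) hzm1
    (by simp [hdz (-1) hzm1])
    fun s hs => hconv (-s) (by rw [abs_neg]; exact hs.trans (le_abs_self s))
  obtain ⟨s0, hs0, hmin⟩ := (isCompact_Icc (a := -(1 - k)) (b := 1 - k)).exists_isMinOn
    ⟨0, by constructor <;> linarith⟩ hf.continuous.continuousOn
  have hs0pos : 0 < f s0 := by
    refine lt_of_le_of_ne (hnn s0) fun h => ?_
    rcases (hz s0).1 h.symm with h | h <;> rw [h] at hs0 <;>
      linarith [hs0.1, hs0.2]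
  obtain ⟨D, hD⟩ := (isCompact_Icc (a := (-1 : ℝ)) (b := 1)).exists_bound_of_continuousOn
    hf1.continuous.continuousOn
  -- Each summand of the constant serves one requirement: `C ≥ 1`, quadratic growth near the wells,
  -- positivity of `f` between them, and the bound of `f'` on `[-1, 1]`.
  refine ⟨k, 1 + 2 / κ + 1 / f s0 + |D|, hd1, hf1.continuous, hnn, hkpos, ?_, ?_,
    fun s hs => (hR s hs).1, fun s hs => ?_, fun s hs => ?_⟩
  · have : 0 < 2 / κ := by positivity
    have : 0 < 1 / f s0 := by positivity
    linarith [abs_nonneg D]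
  · intro s
    have e1 : 0 ≤ 1 / f s0 * f s := mul_nonneg (by positivity) (hnn s)
    have e2 : 0 ≤ 2 / κ * f s := mul_nonneg (by positivity) (hnn s)
    have e3 : 0 ≤ |D| * f s := mul_nonneg (abs_nonneg _) (hnn s)
    have e4 := hnn s
    suffices h : (|s| - 1) ^ 2 ≤ 1 / f s0 * f s ∨ (|s| - 1) ^ 2 ≤ 2 / κ * f s by
      rcases h with h | h <;> nlinarith
    by_cases hs : |s| ≤ 1 - k
    · left
      have : f s0 ≤ f s := hmin (abs_le.1 hs)
      calc (|s| - 1) ^ 2 ≤ 1 := by nlinarith [abs_nonneg s]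
        _ ≤ 1 / f s0 * f s := by rw [one_div, ← div_eq_inv_mul, le_div_iff₀ hs0pos]; linarith
    · right
      push Not at hs
      rw [div_mul_eq_mul_div, le_div_iff₀ hκpos]
      rcases le_total 0 s with h0 | h0
      · rw [abs_of_nonneg h0] at hs ⊢
        linarith [(hR s hs.le).2]
      · rw [abs_of_nonpos h0] at hs ⊢
        have := (hL (-s) hs.le).2
        simp only [neg_neg] at this
        linarith
  · have := (hL (-s) (by linarith)).1
    simp only [neg_neg] at this
    linarith
  · have h1 := hD s (abs_le.1 hs)
    rw [Real.norm_eq_abs] at h1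
    have : 0 < 2 / κ := by positivity
    have : 0 < 1 / f s0 := by positivity
    linarith [le_abs_self D]

/-! ### A truncated linear test function -/

/-- The square of the positive part is `C¹` with remainder at most `(y - x)²`. It is the building
block for the test function below and for the excess of `|U|` over `1`. -/
theorem hasDerivAt_sq_max (x : ℝ) :
    HasDerivAt (fun y : ℝ => max y 0 ^ 2) (2 * max x 0) x := by
  rw [hasDerivAt_iff_isLittleO]
  have hb : ∀ y, ‖max y 0 ^ 2 - max x 0 ^ 2 - (y - x) • (2 * max x 0)‖ ≤ 1 * ‖(y - x) ^ 2‖ := by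
    intro y
    rw [Real.norm_eq_abs, Real.norm_eq_abs, abs_of_nonneg (sq_nonneg (y - x)), smul_eq_mul, abs_le]
    rcases le_total y 0 with hy | hy <;> rcases le_total x 0 with hx | hx <;>
      simp only [hx, hy, max_eq_left, max_eq_right] <;> constructor <;> nlinarith
  refine (Asymptotics.IsBigO.of_bound 1 (Eventually.of_forall hb)).trans_isLittleO ?_
  have := (Asymptotics.isLittleO_pow_id (𝕜 := ℝ) (n := 2) (by norm_num)).comp_tendsto
    (show Tendsto (fun y : ℝ => y - x) (𝓝 x) (𝓝 0) by
      simpa using (continuous_sub_right x).tendsto x)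
  exact this

/-- The slope of `wellTest` near the origin. -/
noncomputable def wellSlope (η : ℝ) : ℝ := 3 / 2 * η / (1 - 3 / 2 * η)

/-- An odd `C¹` function that equals `s - 1` for `s ≥ 1 - η`, `s + 1` for `s ≤ -1 + η`, and is of
size `η` in between. -/
noncomputable def wellTest (η s : ℝ) : ℝ :=
  -(wellSlope η * s) + (1 + wellSlope η) / η / 2 *
    (max (s - (1 - 2 * η)) 0 ^ 2 - max (s - (1 - η)) 0 ^ 2
      - max (-s - (1 - 2 * η)) 0 ^ 2 + max (-s - (1 - η)) 0 ^ 2)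

/-- The derivative of `wellTest`. -/
noncomputable def wellTest' (η s : ℝ) : ℝ :=
  -wellSlope η + (1 + wellSlope η) / η *
    (max (s - (1 - 2 * η)) 0 - max (s - (1 - η)) 0
      + max (-s - (1 - 2 * η)) 0 - max (-s - (1 - η)) 0)

theorem hasDerivAt_wellTest (η s : ℝ) : HasDerivAt (wellTest η) (wellTest' η s) s := by
  have hp : ∀ c, HasDerivAt (fun s : ℝ => max (s - c) 0 ^ 2) (2 * max (s - c) 0) s := fun c =>
    (HasDerivAt.comp (h₂ := fun y : ℝ => max y 0 ^ 2) s (hasDerivAt_sq_max (s - c))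
      ((hasDerivAt_id' s).sub_const c)).congr_deriv (by simp)
  have hm : ∀ c, HasDerivAt (fun s : ℝ => max (-s - c) 0 ^ 2) (-(2 * max (-s - c) 0)) s :=
    fun c =>
      (HasDerivAt.comp (h₂ := fun y : ℝ => max y 0 ^ 2) s (hasDerivAt_sq_max (-s - c))
        ((hasDerivAt_neg s).sub_const c)).congr_deriv (by simp)
  have := ((hasDerivAt_id s).const_mul (wellSlope η)).neg.add
    (((((hp (1 - 2 * η)).sub (hp (1 - η))).sub (hm (1 - 2 * η))).add (hm (1 - η))).const_mul
      ((1 + wellSlope η) / η / 2))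
  refine this.congr_deriv ?_
  simp only [wellTest']
  ring

theorem continuous_wellTest (η : ℝ) : Continuous (wellTest η) := by
  unfold wellTest; fun_prop

theorem continuous_wellTest' (η : ℝ) : Continuous (wellTest' η) := by
  unfold wellTest'; fun_prop

theorem wellTest_neg (η s : ℝ) : wellTest η (-s) = -wellTest η s := by
  simp only [wellTest, neg_neg]; ring

theorem wellTest'_neg (η s : ℝ) : wellTest' η (-s) = wellTest' η s := by
  simp only [wellTest', neg_neg]; ring

section
variable {η : ℝ} (h0 : 0 < η) (h1 : η ≤ 1 / 3)
include h0 h1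

/-- This fixed-point relation is what makes the pieces match: the function falls with slope
`-wellSlope η` up to `1 - 2η`, its slope rises linearly to `1` on an interval of length `η`, and it
must then have the value `-η` at `1 - η`. -/
theorem wellSlope_eq : wellSlope η = 3 / 2 * η * (1 + wellSlope η) := by
  have h : 1 - 3 / 2 * η ≠ 0 := by nlinarith
  have : wellSlope η * (1 - 3 / 2 * η) = 3 / 2 * η := div_mul_cancel₀ _ h
  linear_combination this

theorem wellSlope_pos : 0 < wellSlope η := by
  unfold wellSlope
  exact div_pos (by linarith) (by linarith)

theorem wellSlope_le : wellSlope η ≤ 3 * η := by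
  unfold wellSlope
  rw [div_le_iff₀ (by linarith)]
  nlinarith

theorem wellTest_of_ge {s : ℝ} (hs : 1 - η ≤ s) : wellTest η s = s - 1 := by
  have hb := wellSlope_eq h0 h1
  unfold wellTest
  rw [max_eq_left (by linarith), max_eq_left (by linarith), max_eq_right (by linarith),
    max_eq_right (by linarith)]
  have : (1 + wellSlope η) / η / 2 * ((s - (1 - 2 * η)) ^ 2 - (s - (1 - η)) ^ 2 - 0 ^ 2 + 0 ^ 2)
      = (1 + wellSlope η) / 2 * (2 * s - 2 + 3 * η) := by field_simp; ring
  rw [this]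
  linear_combination -hb

theorem wellTest'_of_ge {s : ℝ} (hs : 1 - η ≤ s) : wellTest' η s = 1 := by
  unfold wellTest'
  rw [max_eq_left (by linarith), max_eq_left (by linarith), max_eq_right (by linarith),
    max_eq_right (by linarith)]
  field_simp
  ring

/-- The slope is nowhere below `-wellSlope η`, so the gradient term of the tested equation is
negative only by `O(η)` times the energy. -/
theorem wellTest'_ge (s : ℝ) : -(3 * η) ≤ wellTest' η s := by
  wlog hs : 0 ≤ s generalizing s
  · rw [← wellTest'_neg]; exact this (-s) (by linarith)
  have hb := wellSlope_le h0 h1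
  have hb0 := wellSlope_pos h0 h1
  have hA : 0 ≤ (1 + wellSlope η) / η := by positivity
  have hm : max (s - (1 - η)) 0 ≤ max (s - (1 - 2 * η)) 0 := max_le_max (by linarith) le_rfl
  unfold wellTest'
  rw [max_eq_right (show -s - (1 - 2 * η) ≤ 0 by linarith),
    max_eq_right (show -s - (1 - η) ≤ 0 by linarith)]
  nlinarith [mul_nonneg hA (sub_nonneg.2 hm)]

theorem wellTest_mem {s : ℝ} (hs : 0 ≤ s) (hs1 : s ≤ 1) :
    -(3 * η) ≤ wellTest η s ∧ wellTest η s ≤ 0 := by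
  have hb := wellSlope_le h0 h1
  have hb0 := wellSlope_pos h0 h1
  have hbe := wellSlope_eq h0 h1
  rcases le_total (1 - η) s with h | h
  · rw [wellTest_of_ge h0 h1 h]; constructor <;> linarith
  unfold wellTest
  rw [max_eq_right (show -s - (1 - 2 * η) ≤ 0 by linarith),
    max_eq_right (show -s - (1 - η) ≤ 0 by linarith), max_eq_right (show s - (1 - η) ≤ 0 by linarith)]
  rcases le_total s (1 - 2 * η) with h' | h'
  · rw [max_eq_right (by linarith)]
    constructor <;> nlinarith
  · rw [max_eq_left (by linarith)]
    have hA : 0 ≤ (1 + wellSlope η) / η / 2 := by positivity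
    have e : (1 + wellSlope η) / η / 2 * (η * (s - (1 - 2 * η)))
        = (1 + wellSlope η) * (s - (1 - 2 * η)) / 2 := by field_simp
    have e2 : (s - (1 - 2 * η)) ^ 2 ≤ η * (s - (1 - 2 * η)) := by nlinarith
    have e3 := mul_le_mul_of_nonneg_left e2 hA
    have e4 := mul_nonneg hA (sq_nonneg (s - (1 - 2 * η)))
    constructor
    · nlinarith
    · have : -(wellSlope η * s) + (1 + wellSlope η) * (s - (1 - 2 * η)) / 2 ≤ 0 := by
        nlinarith
      nlinarith

end

section
variable {f : ℝ → ℝ} {k C η : ℝ} (hw : DoubleWell f k C) (h0 : 0 < η) (h1 : η ≤ 1 / 3)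
  (hk : η ≤ k)
include hw h0 h1 hk

/-- Near the wells the test function is the signed distance to the well, and convexity of `f` makes
the tested integrand dominate the energy density. -/
theorem wellTest_near {s : ℝ} (hs : 1 - η ≤ |s|) :
    1 ≤ wellTest' η s ∧ f s ≤ deriv f s * wellTest η s := by
  rcases le_total 0 s with h | h
  · rw [abs_of_nonneg h] at hs
    rw [wellTest'_of_ge h0 h1 hs, wellTest_of_ge h0 h1 hs]
    exact ⟨le_rfl, hw.right s (by linarith)⟩
  · rw [abs_of_nonpos h] at hs
    have e1 := wellTest'_of_ge h0 h1 hs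
    have e2 := wellTest_of_ge h0 h1 hs
    rw [wellTest'_neg] at e1
    rw [wellTest_neg] at e2
    rw [e1, show wellTest η s = s + 1 by linarith]
    exact ⟨le_rfl, hw.left s (by linarith)⟩

/-- Three regions: next to a well convexity applies; further in, but still within `k` of it, `f'`
and the test function have the same sign; in the middle the product is `O(η)` while `f` is bounded
below by `k²/C`. -/
theorem wellTest_mul_ge (s : ℝ) :
    -(3 * C ^ 2 / k ^ 2 * η * f s) ≤ deriv f s * wellTest η s := by
  have hC := hw.one_le
  have hkp := hw.k_pos
  have hneg : 0 ≤ 3 * C ^ 2 / k ^ 2 * η * f s :=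
    mul_nonneg (by positivity) (hw.nonneg s)
  by_cases hs : 1 - η ≤ |s|
  · linarith [(wellTest_near hw h0 h1 hk hs).2, hw.nonneg s]
  push Not at hs
  by_cases hsk : 1 - k ≤ |s|
  · refine le_trans (by linarith : _ ≤ (0 : ℝ)) ?_
    rcases le_total 0 s with h | h
    · rw [abs_of_nonneg h] at hs hsk
      have e1 := hw.right s hsk
      have e2 := (wellTest_mem h0 h1 h (by linarith)).2
      have : deriv f s ≤ 0 := by
        by_contra hn
        nlinarith [hw.nonneg s]
      exact mul_nonneg_of_nonpos_of_nonpos this e2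
    · rw [abs_of_nonpos h] at hs hsk
      have e1 := hw.left s (by linarith)
      have e2 := (wellTest_mem (s := -s) h0 h1 (by linarith) (by linarith)).2
      rw [wellTest_neg] at e2
      have : 0 ≤ deriv f s := by
        by_contra hn
        nlinarith [hw.nonneg s]
      exact mul_nonneg this (by linarith)
  · push Not at hsk
    have hf : k ^ 2 ≤ C * f s := by
      refine le_trans ?_ (hw.dist_sq_le s)
      nlinarith
    have hg : |wellTest η s| ≤ 3 * η := by
      rcases le_total 0 s with h | h
      · rw [abs_of_nonneg h] at hs
        have := wellTest_mem h0 h1 h (by linarith)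
        rw [abs_le]; constructor <;> linarith
      · rw [abs_of_nonpos h] at hs
        have := wellTest_mem (s := -s) h0 h1 (by linarith) (by linarith)
        rw [wellTest_neg] at this
        rw [abs_le]; constructor <;> linarith
    have hfd := hw.deriv_le s (by linarith)
    have h3 : |deriv f s * wellTest η s| ≤ C * (3 * η) := by
      rw [abs_mul]; gcongr
    have h4 : C * (3 * η) ≤ 3 * C ^ 2 / k ^ 2 * η * f s := by
      rw [div_mul_eq_mul_div, div_mul_eq_mul_div, le_div_iff₀ (by positivity)]
      have : 0 ≤ 3 * C * η := by positivity
      nlinarith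
    linarith [neg_abs_le (deriv f s * wellTest η s)]

omit hk in
-- The test function is at most three times the distance of `|s|` to `1`, also in the middle, where
-- it has size `3η` and that distance is at least `η`. Its square is therefore paid for by the
-- potential.
theorem wellTest_sq_le (s : ℝ) : wellTest η s ^ 2 ≤ 9 * C * f s := by
  have hd := hw.dist_sq_le s
  refine le_trans ?_ (by linarith : 9 * (|s| - 1) ^ 2 ≤ 9 * C * f s)
  have key : ∀ s, 0 ≤ s → wellTest η s ^ 2 ≤ 9 * (|s| - 1) ^ 2 := fun s h => by
    rw [abs_of_nonneg h]
    by_cases hs : 1 - η ≤ s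
    · rw [wellTest_of_ge h0 h1 hs]; nlinarith [sq_nonneg (s - 1)]
    · push Not at hs
      have := wellTest_mem h0 h1 h (by linarith)
      nlinarith
  rcases le_total 0 s with h | h
  · exact key s h
  · have := key (-s) (by linarith)
    rwa [wellTest_neg, abs_neg, neg_sq] at this

end

/-! ### Radial profiles -/

/-- Integration by parts for `m` a primitive of an integrable function `q`. -/
theorem integral_mul_deriv_of_primitive {a b : ℝ} (hab : a ≤ b) {m q K K' : ℝ → ℝ}
    (hq : IntervalIntegrable q volume a b)
    (hm : ∀ r ∈ Icc a b, m r = m a + ∫ s in a..r, q s)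
    (hK : ContinuousOn K (Icc a b)) (hK' : ∀ r ∈ Ioo a b, HasDerivAt K (K' r) r)
    (hKi : IntervalIntegrable K' volume a b) :
    ∫ s in a..b, m s * K' s = m b * K b - m a * K a - ∫ s in a..b, q s * K s := by
  have hacQ := hq.absolutelyContinuousOnInterval_intervalIntegral (c := a) (by simp)
  have hacG := hKi.absolutelyContinuousOnInterval_intervalIntegral (c := a) (by simp)
  have hKp : ∀ r ∈ Icc a b, K r = K a + ∫ s in a..r, K' s := fun r hr => by
    rw [intervalIntegral.integral_eq_sub_of_hasDerivAt_of_le hr.1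
      (hK.mono (Icc_subset_Icc_right hr.2)) (fun x hx => hK' x ⟨hx.1, hx.2.trans_le hr.2⟩)
      (hKi.mono_set (by rw [uIcc_of_le hr.1, uIcc_of_le hab]; exact Icc_subset_Icc_right hr.2))]
    ring
  have hcQ : ContinuousOn (fun r => ∫ s in a..r, q s) (uIcc a b) := hacQ.continuousOn
  have hcG : ContinuousOn (fun r => ∫ s in a..r, K' s) (uIcc a b) := hacG.continuousOn
  have hparts := hacQ.integral_mul_deriv_eq_deriv_mul hacG
  have e1 : ∫ s in a..b, (∫ t in a..s, q t) * deriv (fun r => ∫ t in a..r, K' t) s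
      = ∫ s in a..b, (∫ t in a..s, q t) * K' s := by
    apply intervalIntegral.integral_congr_ae
    filter_upwards [hKi.ae_hasDerivAt_integral] with x hx hxm
    rw [(hx (uIoc_subset_uIcc hxm) a (by simp)).deriv]
  have e2 : ∫ s in a..b, deriv (fun r => ∫ t in a..r, q t) s * (∫ t in a..s, K' t)
      = ∫ s in a..b, q s * (∫ t in a..s, K' t) := by
    apply intervalIntegral.integral_congr_ae
    filter_upwards [hq.ae_hasDerivAt_integral] with x hx hxm
    rw [(hx (uIoc_subset_uIcc hxm) a (by simp)).deriv]
  rw [e1, e2] at hparts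
  have e3 : ∫ s in a..b, m s * K' s
      = m a * (∫ s in a..b, K' s) + ∫ s in a..b, (∫ t in a..s, q t) * K' s := by
    rw [← intervalIntegral.integral_const_mul, ← intervalIntegral.integral_add
      (hKi.const_mul _) (hKi.continuousOn_mul hcQ)]
    refine intervalIntegral.integral_congr fun s hs => ?_
    rw [uIcc_of_le hab] at hs
    simp only [hm s hs]; ring
  have e4 : ∫ s in a..b, q s * K s
      = K a * (∫ s in a..b, q s) + ∫ s in a..b, q s * (∫ t in a..s, K' t) := by
    rw [← intervalIntegral.integral_const_mul, ← intervalIntegral.integral_add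
      (hq.const_mul _) (hq.mul_continuousOn hcG)]
    refine intervalIntegral.integral_congr fun s hs => ?_
    rw [uIcc_of_le hab] at hs
    simp only [hKp s hs]; ring
  rw [e3, e4, hparts, hm b ⟨hab, le_rfl⟩, hKp b ⟨hab, le_rfl⟩]
  simp only [intervalIntegral.integral_same]
  ring

/-- Energy density in terms of the value `u` and the radial derivative `p`. -/
noncomputable def radEnergy (f : ℝ → ℝ) (ε u p : ℝ) : ℝ := ε * p ^ 2 / 2 + f u / ε

/-- Discrepancy in terms of the value `u` and the radial derivative `p`. -/
noncomputable def radDisc (f : ℝ → ℝ) (ε u p : ℝ) : ℝ := ε * p ^ 2 / 2 - f u / ε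

/-- A radial solution `U` on the unit ball of dimension `j + 2` of `ε U'' + … = f'(U)/ε - m`, with
derivative `g`, Neumann boundary condition, energy at most `E`, and right hand side `m` with weak
derivative `q` whose weighted `L²` norm is at most `N`. -/
structure Profile (j : ℕ) (f : ℝ → ℝ) (ε E N : ℝ) (U g m q : ℝ → ℝ) : Prop where
  j_le : j ≤ 1
  eps_pos : 0 < ε
  eps_le : ε ≤ 1
  N_ge : 1 ≤ N
  U_cont : ContinuousOn U (Ioc 0 1)
  U_deriv : ∀ r ∈ Ioo (0 : ℝ) 1, HasDerivAt U (g r) r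
  g_cont : ContinuousOn g (Ioc 0 1)
  flux_deriv : ∀ r ∈ Ioo (0 : ℝ) 1, HasDerivAt (fun s => s ^ (j + 1) * g s)
    (r ^ (j + 1) * ((deriv f (U r) / ε - m r) / ε)) r
  g_one : g 1 = 0
  q_int : ∀ a ∈ Ioc (0 : ℝ) 1, IntervalIntegrable q volume a 1
  m_prim : ∀ a ∈ Ioc (0 : ℝ) 1, m a = m 1 - ∫ s in a..1, q s
  g_small : ∃ B, ∀ r ∈ Ioc (0 : ℝ) 1, r ^ (j + 1) * g r ^ 2 ≤ B * r
  energy_le : ∀ a ∈ Ioc (0 : ℝ) 1, ∫ s in a..1, s ^ (j + 1) * radEnergy f ε (U s) (g s) ≤ E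
  q_sq_int : ∀ a ∈ Ioc (0 : ℝ) 1, IntervalIntegrable (fun s => s ^ (j + 1) * q s ^ 2) volume a 1
  q_sq_le : ∀ a ∈ Ioc (0 : ℝ) 1, ∫ s in a..1, s ^ (j + 1) * q s ^ 2 ≤ N ^ 2

theorem intervalIntegrable_of_continuousOn_Ioc {F : ℝ → ℝ} (h : ContinuousOn F (Ioc 0 1))
    {a b : ℝ} (ha : 0 < a) (hab : a ≤ b) (hb : b ≤ 1) : IntervalIntegrable F volume a b := by
  refine ContinuousOn.intervalIntegrable (h.mono ?_)
  rw [uIcc_of_le hab]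
  exact fun x hx => ⟨ha.trans_le hx.1, hx.2.trans hb⟩

theorem intervalIntegral_mono_left {F : ℝ → ℝ} {a b c : ℝ} (hab : a ≤ b)
    (hi : IntervalIntegrable F volume a c) (hb : b ≤ c) (h0 : ∀ s ∈ Ioc a b, 0 ≤ F s) :
    ∫ s in b..c, F s ≤ ∫ s in a..c, F s := by
  have h1 : IntervalIntegrable F volume a b := hi.mono_set (by
    rw [uIcc_of_le hab, uIcc_of_le (hab.trans hb)]; exact Icc_subset_Icc_right hb)
  have h2 : IntervalIntegrable F volume b c := hi.mono_set (by
    rw [uIcc_of_le hb, uIcc_of_le (hab.trans hb)]; exact Icc_subset_Icc_left hab)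
  rw [← intervalIntegral.integral_add_adjacent_intervals h1 h2]
  have : 0 ≤ ∫ s in a..b, F s := by
    rw [intervalIntegral.integral_of_le hab]
    exact setIntegral_nonneg measurableSet_Ioc h0
  linarith

theorem intervalIntegral_mono_right {F : ℝ → ℝ} {a b c : ℝ} (hab : a ≤ b)
    (hi : IntervalIntegrable F volume a c) (hb : b ≤ c) (h0 : ∀ s ∈ Ioc b c, 0 ≤ F s) :
    ∫ s in a..b, F s ≤ ∫ s in a..c, F s := by
  have h1 : IntervalIntegrable F volume a b := hi.mono_set (by
    rw [uIcc_of_le hab, uIcc_of_le (hab.trans hb)]; exact Icc_subset_Icc_right hb)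
  have h2 : IntervalIntegrable F volume b c := hi.mono_set (by
    rw [uIcc_of_le hb, uIcc_of_le (hab.trans hb)]; exact Icc_subset_Icc_left hab)
  rw [← intervalIntegral.integral_add_adjacent_intervals h1 h2]
  have : 0 ≤ ∫ s in b..c, F s := by
    rw [intervalIntegral.integral_of_le hb]
    exact setIntegral_nonneg measurableSet_Ioc h0
  linarith

theorem abs_intervalIntegral_le {F G : ℝ → ℝ} {a b : ℝ} (hab : a ≤ b)
    (hG : IntervalIntegrable G volume a b) (h : ∀ s ∈ Ioc a b, |F s| ≤ G s) :
    |∫ s in a..b, F s| ≤ ∫ s in a..b, G s := by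
  have := intervalIntegral.norm_integral_le_of_norm_le hab (f := F) (g := G) (μ := volume)
    (Eventually.of_forall fun s hs => by rw [Real.norm_eq_abs]; exact h s hs) hG
  rwa [Real.norm_eq_abs] at this

theorem radDisc_abs_le {f : ℝ → ℝ} (hf : ∀ s, 0 ≤ f s) {ε : ℝ} (hε : 0 < ε) (u p : ℝ) :
    |radDisc f ε u p| ≤ radEnergy f ε u p := by
  have h1 : 0 ≤ f u / ε := div_nonneg (hf u) hε.le
  have h2 : 0 ≤ ε * p ^ 2 / 2 := by positivity
  unfold radDisc radEnergy
  rw [abs_le]; constructor <;> linarith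

theorem radEnergy_nonneg {f : ℝ → ℝ} (hf : ∀ s, 0 ≤ f s) {ε : ℝ} (hε : 0 < ε) (u p : ℝ) :
    0 ≤ radEnergy f ε u p := (abs_nonneg _).trans (radDisc_abs_le hf hε u p)

/-! ### Regularity of profiles and a weighted supremum bound for `U` -/

namespace Profile

variable {j : ℕ} {f : ℝ → ℝ} {k C ε E N : ℝ} {U g m q : ℝ → ℝ}

theorem cont_energy (hP : Profile j f ε E N U g m q) (hw : DoubleWell f k C) :
    ContinuousOn (fun s => radEnergy f ε (U s) (g s)) (Ioc 0 1) := by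
  have hfc : Continuous f := continuous_iff_continuousAt.2 fun s => (hw.diff s).continuousAt
  have := hfc.comp_continuousOn hP.U_cont
  have hg := hP.g_cont
  unfold radEnergy
  exact ((continuousOn_const.mul (hg.pow 2)).div_const 2).add (this.div_const ε)

theorem cont_disc (hP : Profile j f ε E N U g m q) (hw : DoubleWell f k C) :
    ContinuousOn (fun s => radDisc f ε (U s) (g s)) (Ioc 0 1) := by
  have hfc : Continuous f := continuous_iff_continuousAt.2 fun s => (hw.diff s).continuousAt
  have := hfc.comp_continuousOn hP.U_cont
  have hg := hP.g_cont
  unfold radDisc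
  exact ((continuousOn_const.mul (hg.pow 2)).div_const 2).sub (this.div_const ε)

theorem q_int' (hP : Profile j f ε E N U g m q) {a b : ℝ} (ha : 0 < a) (hab : a ≤ b)
    (hb : b ≤ 1) : IntervalIntegrable q volume a b :=
  (hP.q_int a ⟨ha, hab.trans hb⟩).mono_set (by
    rw [uIcc_of_le hab, uIcc_of_le (hab.trans hb)]; exact Icc_subset_Icc_right hb)

theorem m_prim' (hP : Profile j f ε E N U g m q) {a r : ℝ} (ha : 0 < a) (har : a ≤ r)
    (hr : r ≤ 1) : m r = m a + ∫ s in a..r, q s := by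
  rw [hP.m_prim r ⟨ha.trans_le har, hr⟩, hP.m_prim a ⟨ha, har.trans hr⟩,
    ← intervalIntegral.integral_add_adjacent_intervals (hP.q_int' ha har hr)
      (hP.q_int' (ha.trans_le har) hr le_rfl)]
  ring

theorem m_cont (hP : Profile j f ε E N U g m q) : ContinuousOn m (Ioc 0 1) := by
  intro r hr
  have h2 : 0 < r / 2 := by linarith [hr.1]
  have hc : ContinuousOn m (Icc (r / 2) 1) := by
    have h := intervalIntegral.continuousOn_primitive_interval (f := q) (μ := volume)
      (a := r / 2) (b := 1) (by
        have := hP.q_int' h2 (by linarith [hr.2]) le_rfl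
        rw [intervalIntegrable_iff_integrableOn_Icc_of_le (by linarith [hr.2])] at this
        rwa [uIcc_of_le (by linarith [hr.2])])
    rw [uIcc_of_le (by linarith [hr.2])] at h
    refine ((continuousOn_const (c := m (r / 2))).add h).congr fun x hx => ?_
    exact hP.m_prim' h2 hx.1 hx.2
  refine (hc r ⟨by linarith [hr.1], hr.2⟩).mono_of_mem_nhdsWithin ?_
  rw [mem_nhdsWithin]
  exact ⟨Ioi (r / 2), isOpen_Ioi, by simp; linarith [hr.1], fun x hx => ⟨le_of_lt hx.1, hx.2.2⟩⟩

theorem ii_energy (hP : Profile j f ε E N U g m q) (hw : DoubleWell f k C) (i : ℕ) {a b : ℝ}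
    (ha : 0 < a) (hab : a ≤ b) (hb : b ≤ 1) :
    IntervalIntegrable (fun s => s ^ i * radEnergy f ε (U s) (g s)) volume a b :=
  intervalIntegrable_of_continuousOn_Ioc (((continuous_pow i).continuousOn).mul
    (hP.cont_energy hw)) ha hab hb

theorem energy_le' (hP : Profile j f ε E N U g m q) (hw : DoubleWell f k C) {a b : ℝ}
    (ha : 0 < a) (hab : a ≤ b) (hb : b ≤ 1) :
    ∫ s in a..b, s ^ (j + 1) * radEnergy f ε (U s) (g s) ≤ E := by
  refine (intervalIntegral_mono_right hab (hP.ii_energy hw _ ha (hab.trans hb) le_rfl) hb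
    fun s hs => ?_).trans (hP.energy_le a ⟨ha, hab.trans hb⟩)
  exact mul_nonneg (pow_nonneg (by linarith [hs.1]) _) (radEnergy_nonneg hw.nonneg hP.eps_pos _ _)

theorem E_nonneg (hP : Profile j f ε E N U g m q) : 0 ≤ E := by
  simpa using hP.energy_le 1 (by simp)

/-- A minimum of the weighted density on `[1/2, 1]` is at most its average there; the interval has
length `1/2` and the weight is at least `1/4`. This radius is the anchor for the integrations
towards the origin. -/
theorem exists_energy_le (hP : Profile j f ε E N U g m q) (hw : DoubleWell f k C) :
    ∃ r ∈ Icc (1 / 2 : ℝ) 1, radEnergy f ε (U r) (g r) ≤ 8 * E := by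
  have hc : ContinuousOn (fun s => s ^ (j + 1) * radEnergy f ε (U s) (g s)) (Icc (1 / 2) 1) :=
    (((continuous_pow _).continuousOn).mul (hP.cont_energy hw)).mono
      fun x hx => ⟨by linarith [hx.1], hx.2⟩
  obtain ⟨r, hr, hmin⟩ := isCompact_Icc.exists_isMinOn ⟨1, by norm_num⟩ hc
  refine ⟨r, hr, ?_⟩
  have h1 : ∫ _ in (1 / 2 : ℝ)..1, r ^ (j + 1) * radEnergy f ε (U r) (g r) ≤ E := by
    refine le_trans ?_ (hP.energy_le' hw (a := 1 / 2) (b := 1) (by norm_num) (by norm_num) le_rfl)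
    refine intervalIntegral.integral_mono_on (by norm_num) (by simp)
      (hP.ii_energy hw _ (by norm_num) (by norm_num) le_rfl) fun s hs => hmin hs
  rw [intervalIntegral.integral_const, smul_eq_mul] at h1
  have h2 : (1 / 4 : ℝ) ≤ r ^ (j + 1) := by
    have h3 : (1 / 2 : ℝ) ^ (j + 1) ≤ r ^ (j + 1) := pow_le_pow_left₀ (by norm_num) hr.1 _
    refine le_trans ?_ h3
    have hj := hP.j_le
    interval_cases j <;> norm_num
  have h4 := radEnergy_nonneg hw.nonneg hP.eps_pos (U r) (g r)
  nlinarith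

theorem hasDerivAt_sq_excess {r : ℝ} (hP : Profile j f ε E N U g m q) (hr : r ∈ Ioo (0 : ℝ) 1) :
    HasDerivAt (fun s => max (U s - 1) 0 ^ 2 + max (-U s - 1) 0 ^ 2)
      (2 * (max (U r - 1) 0 - max (-U r - 1) 0) * g r) r := by
  have hU := hP.U_deriv r hr
  have h1 := HasDerivAt.comp (h₂ := fun y : ℝ => max y 0 ^ 2) r (hasDerivAt_sq_max (U r - 1))
    (hU.sub_const 1)
  have h2 := HasDerivAt.comp (h₂ := fun y : ℝ => max y 0 ^ 2) r (hasDerivAt_sq_max (-U r - 1))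
    (hU.neg.sub_const 1)
  refine (h1.add h2).congr_deriv ?_
  simp
  ring

/-- The argument of Modica and Mortola: the squared excess of `|U|` over `1` has derivative bounded
by `2 C e`, because the excess squared is at most `C f(U)`. So its variation on `(a, b)`, multiplied
by `a^(j+1)`, is controlled by the energy with no power of `ε`, starting from a radius of bounded
energy. -/
theorem U_sq_le (hP : Profile j f ε E N U g m q) (hw : DoubleWell f k C) {r : ℝ}
    (hr : r ∈ Ioc (0 : ℝ) 1) : U r ^ 2 * r ^ (j + 1) ≤ 2 + 32 * C * E := by
  obtain ⟨r0, hr0, he0⟩ := hP.exists_energy_le hw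
  have hE := hP.E_nonneg
  have hC := hw.one_le
  have hε := hP.eps_pos
  have hε1 := hP.eps_le
  set Φ : ℝ → ℝ := fun s => max (U s - 1) 0 ^ 2 + max (-U s - 1) 0 ^ 2 with hΦ
  have hΦle : ∀ s, Φ s ≤ (|U s| - 1) ^ 2 := fun s => by
    simp only [hΦ]
    rcases le_total 0 (U s) with h | h
    · rw [abs_of_nonneg h, max_eq_right (by linarith : -U s - 1 ≤ 0)]
      rcases le_total (U s - 1) 0 with h' | h'
      · rw [max_eq_right h']; nlinarith [sq_nonneg (U s - 1)]
      · rw [max_eq_left h']; nlinarith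
    · rw [abs_of_nonpos h, max_eq_right (by linarith : U s - 1 ≤ 0)]
      rcases le_total (-U s - 1) 0 with h' | h'
      · rw [max_eq_right h']; nlinarith [sq_nonneg (-U s - 1)]
      · rw [max_eq_left h']; nlinarith
  have hΦge : ∀ s, U s ^ 2 ≤ 2 + 2 * Φ s := fun s => by
    simp only [hΦ]
    have h1 := le_max_left (U s - 1) 0
    have h2 := le_max_left (-U s - 1) 0
    have h3 := le_max_right (U s - 1) 0
    have h4 := le_max_right (-U s - 1) 0
    rcases le_total 0 (U s) with h | h
    · nlinarith [sq_nonneg (max (U s - 1) 0 - 1), sq_nonneg (max (-U s - 1) 0)]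
    · nlinarith [sq_nonneg (max (-U s - 1) 0 - 1), sq_nonneg (max (U s - 1) 0)]
  have hΦ0 : Φ r0 ≤ 8 * C * E := by
    refine (hΦle r0).trans ((hw.dist_sq_le _).trans ?_)
    have h1 : f (U r0) ≤ 8 * E := by
      refine le_trans ?_ he0
      unfold radEnergy
      have h2 : f (U r0) ≤ f (U r0) / ε := by
        rw [le_div_iff₀ hε]; nlinarith [hw.nonneg (U r0)]
      have : 0 ≤ ε * g r0 ^ 2 / 2 := by positivity
      linarith
    nlinarith
  have hΦd : ∀ s ∈ Ioo (0 : ℝ) 1, |2 * (max (U s - 1) 0 - max (-U s - 1) 0) * g s|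
      ≤ 2 * C * radEnergy f ε (U s) (g s) := fun s hs => by
    have h1 : (max (U s - 1) 0 - max (-U s - 1) 0) ^ 2 ≤ C * f (U s) := by
      refine le_trans ?_ (hw.dist_sq_le (U s))
      refine le_trans ?_ (hΦle s)
      simp only [hΦ]
      have h3 := le_max_right (U s - 1) 0
      have h4 := le_max_right (-U s - 1) 0
      nlinarith [mul_nonneg h3 h4]
    set y := max (U s - 1) 0 - max (-U s - 1) 0
    -- Young's inequality, balanced so that the powers of `ε` are those of the energy density.
    have h2 : |2 * y * g s| ≤ y ^ 2 / ε + ε * g s ^ 2 := by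
      have e : y ^ 2 / ε + ε * g s ^ 2 - 2 * y * g s = (y - ε * g s) ^ 2 / ε := by
        field_simp; ring
      have e' : y ^ 2 / ε + ε * g s ^ 2 + 2 * y * g s = (y + ε * g s) ^ 2 / ε := by
        field_simp; ring
      have p1 : 0 ≤ (y - ε * g s) ^ 2 / ε := by positivity
      have p2 : 0 ≤ (y + ε * g s) ^ 2 / ε := by positivity
      rw [abs_le]; constructor <;> linarith
    refine h2.trans ?_
    unfold radEnergy
    have h3 : y ^ 2 / ε ≤ C * (f (U s) / ε) := by
      rw [← mul_div_assoc]; exact div_le_div_of_nonneg_right h1 hε.le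
    have h4 : 0 ≤ f (U s) / ε := div_nonneg (hw.nonneg _) hε.le
    have h5 : 0 ≤ ε * g s ^ 2 := by positivity
    nlinarith
  have hrp : 0 < r ^ (j + 1) := pow_pos hr.1 _
  have hr0p : 0 < r0 := by linarith [hr0.1]
  have hΦcont : ContinuousOn Φ (Ioc 0 1) := by
    have := hP.U_cont
    simp only [hΦ]
    fun_prop
  have hΦ'cont : ContinuousOn (fun s => 2 * (max (U s - 1) 0 - max (-U s - 1) 0) * g s)
      (Ioc 0 1) := by
    have := hP.U_cont
    have := hP.g_cont
    fun_prop
  have key : ∀ a b, 0 < a → a ≤ b → b ≤ 1 → |Φ b - Φ a| * a ^ (j + 1) ≤ 2 * C * E := by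
    intro a b ha hab hb
    have hap : 0 < a ^ (j + 1) := pow_pos ha _
    have h1 := intervalIntegral.integral_eq_sub_of_hasDerivAt_of_le hab
      (hΦcont.mono fun x hx => ⟨ha.trans_le hx.1, hx.2.trans hb⟩)
      (fun s hs => hP.hasDerivAt_sq_excess ⟨ha.trans hs.1, hs.2.trans_le hb⟩)
      (intervalIntegrable_of_continuousOn_Ioc hΦ'cont ha hab hb)
    rw [← h1, ← abs_of_pos hap, ← abs_mul, mul_comm, ← intervalIntegral.integral_const_mul]
    have hint := (hP.ii_energy hw (j + 1) ha hab hb).const_mul (2 * C)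
    refine (abs_intervalIntegral_le hab (G := fun s => 2 * C * (s ^ (j + 1) *
      radEnergy f ε (U s) (g s))) hint fun s hs => ?_).trans ?_
    · have hpow : a ^ (j + 1) ≤ s ^ (j + 1) := pow_le_pow_left₀ ha.le hs.1.le _
      rw [abs_mul, abs_of_pos hap]
      have hb' : |2 * (max (U s - 1) 0 - max (-U s - 1) 0) * g s|
          ≤ 2 * C * radEnergy f ε (U s) (g s) := by
        rcases eq_or_lt_of_le (hs.2.trans hb) with h | h
        · have := hP.g_one
          rw [h, this, mul_zero, abs_zero]
          exact mul_nonneg (by linarith) (radEnergy_nonneg hw.nonneg hε _ _)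
        · exact hΦd s ⟨ha.trans hs.1, h⟩
      calc _ ≤ s ^ (j + 1) * (2 * C * radEnergy f ε (U s) (g s)) :=
            mul_le_mul hpow hb' (abs_nonneg _) (hap.le.trans hpow)
        _ = _ := by ring
    · rw [intervalIntegral.integral_const_mul]
      exact mul_le_mul_of_nonneg_left (hP.energy_le' hw ha hab hb) (by linarith)
  have hpow1 : r ^ (j + 1) ≤ 1 := pow_le_one₀ hr.1.le hr.2
  have hΦr0 : 0 ≤ Φ r0 := by simp only [hΦ]; positivity
  have hCE : 0 ≤ C * E := mul_nonneg (by linarith) hE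
  have hΦr : Φ r * r ^ (j + 1) ≤ 16 * C * E := by
    rcases le_total r r0 with h | h
    · have h1 := key r r0 hr.1 h hr0.2
      have h2 : Φ r ≤ Φ r0 + |Φ r0 - Φ r| := by linarith [neg_abs_le (Φ r0 - Φ r)]
      nlinarith [mul_le_mul_of_nonneg_right h2 hrp.le]
    · have h1 := key r0 r hr0p h hr.2
      have h2 : Φ r ≤ Φ r0 + |Φ r - Φ r0| := by linarith [le_abs_self (Φ r - Φ r0)]
      have h3 : (1 / 4 : ℝ) ≤ r0 ^ (j + 1) := by
        refine le_trans ?_ (pow_le_pow_left₀ (by norm_num) hr0.1 (j + 1))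
        have hj := hP.j_le
        interval_cases j <;> norm_num
      have h4 : |Φ r - Φ r0| ≤ 8 * C * E := by nlinarith [abs_nonneg (Φ r - Φ r0)]
      have h5 : Φ r ≤ 16 * C * E := by linarith
      have h6 : 0 ≤ Φ r := by simp only [hΦ]; positivity
      nlinarith
  have := hΦge r
  nlinarith [mul_le_mul_of_nonneg_right this hrp.le]

end Profile

/-! ### Bounds for the chemical potential and for its product with `U'` -/

theorem integral_inv_sqrt {a b : ℝ} (ha : 0 < a) (hab : a ≤ b) :
    IntervalIntegrable (fun s => 1 / √s) volume a b ∧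
      ∫ s in a..b, 1 / √s = 2 * √b - 2 * √a := by
  have hi : IntervalIntegrable (fun s => 1 / √s) volume a b := by
    refine ContinuousOn.intervalIntegrable ?_
    rw [uIcc_of_le hab]
    exact continuousOn_const.div Real.continuous_sqrt.continuousOn
      fun x hx => (Real.sqrt_pos.2 (ha.trans_le hx.1)).ne'
  refine ⟨hi, ?_⟩
  refine intervalIntegral.integral_eq_sub_of_hasDerivAt (f := fun s => 2 * √s) (fun s hs => ?_) hi
  rw [uIcc_of_le hab] at hs
  have hs0 : 0 < s := ha.trans_le hs.1
  refine ((Real.hasDerivAt_sqrt hs0.ne').const_mul 2).congr_deriv ?_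
  have := (Real.sqrt_pos.2 hs0).ne'
  field_simp

theorem integral_fourth_root_div {a b : ℝ} (ha : 0 < a) (hab : a ≤ b) (hb : b ≤ 1) :
    IntervalIntegrable (fun s => √(√s) / s) volume a b ∧
      ∫ s in a..b, √(√s) / s ≤ 4 := by
  have hi : IntervalIntegrable (fun s => √(√s) / s) volume a b := by
    refine ContinuousOn.intervalIntegrable ?_
    rw [uIcc_of_le hab]
    exact (Real.continuous_sqrt.comp Real.continuous_sqrt).continuousOn.div continuousOn_id
      fun x hx => (ha.trans_le hx.1).ne'
  refine ⟨hi, ?_⟩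
  have : ∫ s in a..b, √(√s) / s = 4 * √(√b) - 4 * √(√a) := by
    refine intervalIntegral.integral_eq_sub_of_hasDerivAt (f := fun s => 4 * √(√s))
      (fun s hs => ?_) hi
    rw [uIcc_of_le hab] at hs
    have hs0 : 0 < s := ha.trans_le hs.1
    have h1 := Real.sqrt_pos.2 hs0
    have h2 := Real.sqrt_pos.2 h1
    refine (((Real.hasDerivAt_sqrt hs0.ne').sqrt h1.ne').const_mul 4).congr_deriv ?_
    have e1 : √(√s) * √(√s) = √s := Real.mul_self_sqrt h1.le
    have e2 : √s * √s = s := Real.mul_self_sqrt hs0.le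
    field_simp
    rw [show √(√s) ^ 2 = √s by rw [sq, e1], ← sq] at *
    nlinarith
  rw [this]
  have h1 : √(√b) ≤ 1 := by
    rw [Real.sqrt_le_one, Real.sqrt_le_one]; exact hb
  linarith [Real.sqrt_nonneg (√a)]

theorem fourth_root_le_one {s : ℝ} (hs : s ≤ 1) : √(√s) ≤ 1 := by
  rw [Real.sqrt_le_one, Real.sqrt_le_one]; exact hs

/-- A bound for the weighted supremum of a profile of energy `E`. -/
noncomputable def supBound (C E : ℝ) : ℝ := √(2 + 32 * C * E)

theorem supBound_nonneg (C E : ℝ) : 0 ≤ supBound C E := Real.sqrt_nonneg _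

namespace Profile

variable {j : ℕ} {f : ℝ → ℝ} {k C ε E N : ℝ} {U g m q : ℝ → ℝ}

theorem U_le (hP : Profile j f ε E N U g m q) (hw : DoubleWell f k C) {r : ℝ}
    (hr : r ∈ Ioc (0 : ℝ) 1) : |U r| * √(r ^ (j + 1)) ≤ supBound C E := by
  have h := hP.U_sq_le hw hr
  have hp : 0 ≤ r ^ (j + 1) := pow_nonneg hr.1.le _
  refine Real.le_sqrt_of_sq_le ?_
  rw [mul_pow, Real.sq_sqrt hp, sq_abs]
  exact h

/-- Weighted Cauchy–Schwarz for `∫ q` from `r` to `1`. The gain `r^(1/4)` is not optimal, but it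
holds in both dimensions, and any positive power suffices to integrate against `1/r` later. -/
theorem m_sub_le (hP : Profile j f ε E N U g m q) {r : ℝ}
    (hr : r ∈ Ioc (0 : ℝ) 1) : |m r - m 1| * √(r ^ (j + 1)) ≤ 2 * N * √(√r) := by
  have hN := hP.N_ge
  have hrp : 0 < r ^ (j + 1) := pow_pos hr.1 _
  have hsr : 0 < √r := Real.sqrt_pos.2 hr.1
  have hρ : 0 < √(√r) := Real.sqrt_pos.2 hsr
  have hρ2 : √(√r) * √(√r) = √r := Real.mul_self_sqrt hsr.le
  have hw2 : √(r ^ (j + 1)) ^ 2 = r ^ (j + 1) := Real.sq_sqrt hrp.le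
  set ρ := √(√r)
  set w := √(r ^ (j + 1))
  have hw0 : 0 ≤ w := Real.sqrt_nonneg _
  obtain ⟨hi, hv⟩ := integral_inv_sqrt hr.1 hr.2
  rw [hP.m_prim r hr, show m 1 - (∫ s in r..1, q s) - m 1 = -∫ s in r..1, q s by ring, abs_neg,
    ← abs_of_nonneg hw0, ← abs_mul, mul_comm, ← intervalIntegral.integral_const_mul]
  have hG : IntervalIntegrable (fun s => ρ / N / 2 * (s ^ (j + 1) * q s ^ 2)
      + N / ρ / 2 * √r * (1 / √s)) volume r 1 :=
    ((hP.q_sq_int r hr).const_mul _).add (hi.const_mul _)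
  refine (abs_intervalIntegral_le hr.2 hG fun s hs => ?_).trans ?_
  · have hs0 : 0 < s := hr.1.trans hs.1
    have hsp : 0 < s ^ (j + 1) := pow_pos hs0 _
    have hss : 0 < √s := Real.sqrt_pos.2 hs0
    -- As `r/s ≤ 1`, every power may be lowered to `1/2`; this avoids the logarithm that appears in
    -- dimension two.
    have h1 : r ^ (j + 1) / s ^ (j + 1) ≤ √r / √s := by
      rw [← div_pow, ← Real.sqrt_div hr.1.le]
      have hq1 : r / s ≤ 1 := (div_le_one hs0).2 hs.1.le
      have hq0 : 0 ≤ r / s := div_nonneg hr.1.le hs0.le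
      calc (r / s) ^ (j + 1) ≤ (r / s) ^ 1 := pow_le_pow_of_le_one hq0 hq1 (by omega)
        _ = √(r / s) * √(r / s) := by rw [pow_one, Real.mul_self_sqrt hq0]
        _ ≤ √(r / s) * 1 := by gcongr; exact Real.sqrt_le_one.2 hq1
        _ = _ := mul_one _
    -- The Young weight `ρ/N` makes both integrated terms of order `N ρ`, where `ρ = r^(1/4)`.
    have h2 : |w * q s| ≤ ρ / N / 2 * (s ^ (j + 1) * q s ^ 2)
        + N / ρ / 2 * (r ^ (j + 1) / s ^ (j + 1)) := by
      rw [← hw2]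
      have e1 : ρ / N / 2 * (s ^ (j + 1) * q s ^ 2) + N / ρ / 2 * (w ^ 2 / s ^ (j + 1))
          - w * q s = (ρ * s ^ (j + 1) * q s - N * w) ^ 2 / (2 * N * ρ * s ^ (j + 1)) := by
        have : N ≠ 0 := by linarith
        field_simp; ring
      have e2 : ρ / N / 2 * (s ^ (j + 1) * q s ^ 2) + N / ρ / 2 * (w ^ 2 / s ^ (j + 1))
          + w * q s = (ρ * s ^ (j + 1) * q s + N * w) ^ 2 / (2 * N * ρ * s ^ (j + 1)) := by
        have : N ≠ 0 := by linarith
        field_simp; ring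
      have hd : 0 ≤ 2 * N * ρ * s ^ (j + 1) := by positivity
      have p1 := div_nonneg (sq_nonneg (ρ * s ^ (j + 1) * q s - N * w)) hd
      have p2 := div_nonneg (sq_nonneg (ρ * s ^ (j + 1) * q s + N * w)) hd
      rw [abs_le]; constructor <;> linarith
    refine h2.trans ?_
    have : N / ρ / 2 * (r ^ (j + 1) / s ^ (j + 1)) ≤ N / ρ / 2 * (√r / √s) := by gcongr
    calc _ ≤ _ := add_le_add_right this _
      _ = _ := by ring
  · rw [intervalIntegral.integral_add ((hP.q_sq_int r hr).const_mul _) (hi.const_mul _),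
      intervalIntegral.integral_const_mul, intervalIntegral.integral_const_mul, hv]
    have h1 : ρ / N / 2 * (∫ s in r..1, s ^ (j + 1) * q s ^ 2) ≤ ρ / N / 2 * N ^ 2 := by
      have := hP.q_sq_le r hr
      gcongr
    have e1 : ρ / N / 2 * N ^ 2 = ρ * N / 2 := by
      have : N ≠ 0 := by linarith
      field_simp
    have e2 : N / ρ / 2 * √r * (2 * √1 - 2 * √r) ≤ N * ρ := by
      rw [Real.sqrt_one, ← hρ2]
      have : N / ρ / 2 * (ρ * ρ) * (2 * 1 - 2 * (ρ * ρ)) = N * ρ * (1 - ρ * ρ) := by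
        field_simp
      rw [this]
      have : 0 ≤ N * ρ := by positivity
      nlinarith [mul_nonneg this (mul_self_nonneg ρ)]
    have : 0 ≤ N * ρ := by positivity
    linarith

theorem m_le (hP : Profile j f ε E N U g m q) {r : ℝ} (hr : r ∈ Ioc (0 : ℝ) 1) :
    |m r| * √(r ^ (j + 1)) ≤ (|m 1| + 2 * N) * √(√r) := by
  have h1 := hP.m_sub_le hr
  have h2 : √(r ^ (j + 1)) ≤ √(√r) := by
    apply Real.sqrt_le_sqrt
    calc r ^ (j + 1) ≤ r ^ 1 := pow_le_pow_of_le_one hr.1.le hr.2 (by omega)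
      _ = √r * √r := by rw [pow_one, Real.mul_self_sqrt hr.1.le]
      _ ≤ √r * 1 := by gcongr; exact Real.sqrt_le_one.2 hr.2
      _ = √r := mul_one _
  have h3 : |m r| ≤ |m 1| + |m r - m 1| := by
    have := abs_add_le (m 1) (m r - m 1)
    simpa using this
  have h4 := Real.sqrt_nonneg (r ^ (j + 1))
  nlinarith [mul_le_mul_of_nonneg_right h3 h4, mul_le_mul_of_nonneg_left h2 (abs_nonneg (m 1))]

/-- Each factor takes half of the weight `r^(j+1)`. The remaining `r^(1/4)` makes `m U r^j`
integrable at the origin. -/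
theorem abs_mul_U_mul_m_le (hP : Profile j f ε E N U g m q) (hw : DoubleWell f k C) {r : ℝ}
    (hr : r ∈ Ioc (0 : ℝ) 1) :
    |m r * U r| * r ^ (j + 1) ≤ supBound C E * (|m 1| + 2 * N) * √(√r) := by
  have h1 := hP.U_le hw hr
  have h2 := hP.m_le hr
  have hp : 0 ≤ r ^ (j + 1) := pow_nonneg hr.1.le _
  calc |m r * U r| * r ^ (j + 1)
      = (|U r| * √(r ^ (j + 1))) * (|m r| * √(r ^ (j + 1))) := by
        rw [abs_mul]; nth_rewrite 1 [← Real.mul_self_sqrt hp]; ring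
    _ ≤ supBound C E * ((|m 1| + 2 * N) * √(√r)) :=
        mul_le_mul h1 h2 (by positivity) (supBound_nonneg _ _)
    _ = _ := by ring

/-- Integration by parts for `∫ m U' Z`. -/
theorem integral_m_g_mul (hP : Profile j f ε E N U g m q) {a b : ℝ} (ha : 0 < a) (hab : a ≤ b)
    (hb : b ≤ 1) {Z Z' : ℝ → ℝ} (hZ : ContinuousOn Z (Ioc 0 1))
    (hZd : ∀ r ∈ Ioo (0 : ℝ) 1, HasDerivAt Z (Z' r) r) (hZ' : ContinuousOn Z' (Ioc 0 1)) :
    ∫ s in a..b, m s * g s * Z s = m b * U b * Z b - m a * U a * Z a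
      - (∫ s in a..b, q s * (U s * Z s)) - ∫ s in a..b, m s * U s * Z' s := by
  have hsub : Icc a b ⊆ Ioc 0 1 := fun x hx => ⟨ha.trans_le hx.1, hx.2.trans hb⟩
  have h := integral_mul_deriv_of_primitive hab (K := fun s => U s * Z s)
    (K' := fun s => g s * Z s + U s * Z' s) (hP.q_int' ha hab hb)
    (fun r hr => hP.m_prim' ha hr.1 (hr.2.trans hb)) ((hP.U_cont.mul hZ).mono hsub)
    (fun r hr => (hP.U_deriv r ⟨ha.trans hr.1, hr.2.trans_le hb⟩).mul
      (hZd r ⟨ha.trans hr.1, hr.2.trans_le hb⟩))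
    (intervalIntegrable_of_continuousOn_Ioc ((hP.g_cont.mul hZ).add (hP.U_cont.mul hZ')) ha hab hb)
  have e : ∫ s in a..b, m s * (g s * Z s + U s * Z' s)
      = (∫ s in a..b, m s * g s * Z s) + ∫ s in a..b, m s * U s * Z' s := by
    rw [← intervalIntegral.integral_add (f := fun s => m s * g s * Z s)
      (g := fun s => m s * U s * Z' s)
      (intervalIntegrable_of_continuousOn_Ioc ((hP.m_cont.mul hP.g_cont).mul hZ) ha hab hb)
      (intervalIntegrable_of_continuousOn_Ioc ((hP.m_cont.mul hP.U_cont).mul hZ') ha hab hb)]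
    congr 1; ext s; ring
  rw [e] at h
  linarith

/-- `∫ |q U| r^(j+1)` is bounded by `N` times the supremum bound. -/
theorem integral_q_U_le (hP : Profile j f ε E N U g m q) (hw : DoubleWell f k C) {a b : ℝ}
    (ha : 0 < a) (hab : a ≤ b) (hb : b ≤ 1) {Z : ℝ → ℝ}
    (hZ : ∀ s ∈ Ioc (0 : ℝ) 1, |Z s| ≤ s ^ (j + 1)) :
    |∫ s in a..b, q s * (U s * Z s)| ≤ supBound C E * N := by
  have hN := hP.N_ge
  have hcU := supBound_nonneg C E
  have hqi : IntervalIntegrable (fun s => s ^ (j + 1) * q s ^ 2) volume a b :=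
    (hP.q_sq_int a ⟨ha, hab.trans hb⟩).mono_set (by
      rw [uIcc_of_le hab, uIcc_of_le (hab.trans hb)]; exact Icc_subset_Icc_right hb)
  have hq2 : ∫ s in a..b, s ^ (j + 1) * q s ^ 2 ≤ N ^ 2 :=
    (intervalIntegral_mono_right hab (hP.q_sq_int a ⟨ha, hab.trans hb⟩) hb fun s hs =>
      mul_nonneg (pow_nonneg (by linarith [hs.1]) _) (sq_nonneg _)).trans
      (hP.q_sq_le a ⟨ha, hab.trans hb⟩)
  have hG : IntervalIntegrable (fun s => supBound C E * (1 / (2 * N) * (s ^ (j + 1) * q s ^ 2)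
      + N / 2)) volume a b := ((hqi.const_mul _).add (by simp)).const_mul _
  refine (abs_intervalIntegral_le hab hG fun s hs => ?_).trans ?_
  · have hs' : s ∈ Ioc (0 : ℝ) 1 := ⟨ha.trans hs.1, hs.2.trans hb⟩
    have hp : 0 ≤ s ^ (j + 1) := pow_nonneg hs'.1.le _
    have h1 := hP.U_le hw hs'
    have h2 : |q s| * √(s ^ (j + 1)) ≤ 1 / (2 * N) * (s ^ (j + 1) * q s ^ 2) + N / 2 := by
      have e : s ^ (j + 1) * q s ^ 2 = (|q s| * √(s ^ (j + 1))) ^ 2 := by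
        rw [mul_pow, sq_abs, Real.sq_sqrt hp]; ring
      rw [e]
      set y := |q s| * √(s ^ (j + 1))
      have : 1 / (2 * N) * y ^ 2 + N / 2 - y = (y - N) ^ 2 / (2 * N) := by
        have : N ≠ 0 := by linarith
        field_simp; ring
      have : 0 ≤ (y - N) ^ 2 / (2 * N) := by positivity
      linarith
    calc |q s * (U s * Z s)| = |q s| * (|U s| * |Z s|) := by rw [abs_mul, abs_mul]
      _ ≤ |q s| * (|U s| * s ^ (j + 1)) := by gcongr; exact hZ s hs'
      _ = (|U s| * √(s ^ (j + 1))) * (|q s| * √(s ^ (j + 1))) := by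
          nth_rewrite 1 [← Real.mul_self_sqrt hp]; ring
      _ ≤ _ := mul_le_mul h1 h2 (by positivity) hcU
  · rw [intervalIntegral.integral_const_mul, intervalIntegral.integral_add (hqi.const_mul _)
      (by simp), intervalIntegral.integral_const_mul, intervalIntegral.integral_const]
    gcongr
    have h1 : 1 / (2 * N) * (∫ s in a..b, s ^ (j + 1) * q s ^ 2) ≤ 1 / (2 * N) * N ^ 2 := by
      gcongr
    have h2 : 1 / (2 * N) * N ^ 2 = N / 2 := by
      have : N ≠ 0 := by linarith
      field_simp
    have h3 : (b - a) • (N / 2) ≤ N / 2 := by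
      rw [smul_eq_mul]; nlinarith
    linarith

/-- Estimating `m U'` through the energy of `U'` would cost `ε^(-1/2)`. Integration by parts leaves
two boundary terms, `∫ q U r^(j+1)` and `∫ m U r^j`, all bounded by the weighted sup bounds. The
last integral contributes 8 of the factor 11 and the other terms 1 each. -/
theorem integral_m_g_le (hP : Profile j f ε E N U g m q) (hw : DoubleWell f k C) {a b : ℝ}
    (ha : 0 < a) (hab : a ≤ b) (hb : b ≤ 1) :
    |∫ s in a..b, m s * g s * s ^ (j + 1)| ≤ 11 * supBound C E * (|m 1| + 2 * N) := by
  have hN := hP.N_ge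
  have hcU := supBound_nonneg C E
  have hM : 0 ≤ |m 1| + 2 * N := by positivity
  have hcM : 0 ≤ supBound C E * (|m 1| + 2 * N) := mul_nonneg hcU hM
  rw [hP.integral_m_g_mul ha hab hb (Z := fun s => s ^ (j + 1))
    (Z' := fun s => ((j + 1 : ℕ) : ℝ) * s ^ j) (continuous_pow _).continuousOn
    (fun r _ => by simpa using hasDerivAt_pow (j + 1) r) (by fun_prop)]
  have hbd : ∀ r ∈ Ioc (0 : ℝ) 1, |m r * U r * r ^ (j + 1)| ≤ supBound C E * (|m 1| + 2 * N) := by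
    intro r hr
    rw [abs_mul, abs_of_nonneg (pow_nonneg hr.1.le _)]
    refine (hP.abs_mul_U_mul_m_le hw hr).trans ?_
    exact mul_le_of_le_one_right hcM (fourth_root_le_one hr.2)
  have h1 := hbd a ⟨ha, hab.trans hb⟩
  have h2 := hbd b ⟨ha.trans_le hab, hb⟩
  have h3 := hP.integral_q_U_le hw ha hab hb (Z := fun s => s ^ (j + 1))
    fun s hs => (abs_of_nonneg (pow_nonneg hs.1.le _)).le
  obtain ⟨hi4, hv4⟩ := integral_fourth_root_div ha hab hb
  have h4 : |∫ s in a..b, m s * U s * (((j + 1 : ℕ) : ℝ) * s ^ j)|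
      ≤ 8 * (supBound C E * (|m 1| + 2 * N)) := by
    refine (abs_intervalIntegral_le hab (hi4.const_mul (2 * (supBound C E * (|m 1| + 2 * N))))
      fun s hs => ?_).trans ?_
    · have hs' : s ∈ Ioc (0 : ℝ) 1 := ⟨ha.trans hs.1, hs.2.trans hb⟩
      have hj : ((j + 1 : ℕ) : ℝ) ≤ 2 := by exact_mod_cast Nat.succ_le_succ hP.j_le
      have h5 := hP.abs_mul_U_mul_m_le hw hs'
      have hpj : 0 ≤ s ^ j := pow_nonneg hs'.1.le _
      rw [abs_mul, abs_of_nonneg (by positivity : (0 : ℝ) ≤ ((j + 1 : ℕ) : ℝ) * s ^ j),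
        ← mul_div_assoc, le_div_iff₀ hs'.1]
      calc |m s * U s| * (((j + 1 : ℕ) : ℝ) * s ^ j) * s
          = ((j + 1 : ℕ) : ℝ) * (|m s * U s| * s ^ (j + 1)) := by ring
        _ ≤ 2 * (supBound C E * (|m 1| + 2 * N) * √(√s)) :=
            mul_le_mul hj h5 (mul_nonneg (abs_nonneg _) (pow_nonneg hs'.1.le _)) (by norm_num)
        _ = _ := by ring
    · rw [intervalIntegral.integral_const_mul]
      nlinarith
  have h5 : supBound C E * N ≤ supBound C E * (|m 1| + 2 * N) := by
    gcongr
    linarith [abs_nonneg (m 1)]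
  rw [abs_le] at *
  constructor <;> linarith [h1.1, h1.2, h2.1, h2.2, h3.1, h3.2, h4.1, h4.2]

/-- A qualitative bound: `g_small` gives `|g| ≤ √(B/s)`, which is integrable at the origin. The
constant is not uniform in `ε`. -/
theorem exists_abs_U_le (hP : Profile j f ε E N U g m q) :
    ∃ B, ∀ r ∈ Ioc (0 : ℝ) 1, |U r| ≤ B := by
  obtain ⟨B, hB⟩ := hP.g_small
  refine ⟨|U 1| + 2 * √|B|, fun r hr => ?_⟩
  have h1 := intervalIntegral.integral_eq_sub_of_hasDerivAt_of_le hr.2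
    (hP.U_cont.mono fun x hx => ⟨hr.1.trans_le hx.1, hx.2⟩)
    (fun s hs => hP.U_deriv s ⟨hr.1.trans hs.1, hs.2⟩)
    (intervalIntegrable_of_continuousOn_Ioc hP.g_cont hr.1 hr.2 le_rfl)
  obtain ⟨hi, hv⟩ := integral_inv_sqrt hr.1 hr.2
  have h2 := abs_intervalIntegral_le (F := g) hr.2 (hi.const_mul √|B|) fun s hs => by
    have hs0 : 0 < s := hr.1.trans hs.1
    have h3 := hB s ⟨hs0, hs.2⟩
    rw [mul_one_div, ← Real.sqrt_div (abs_nonneg B)]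
    refine Real.abs_le_sqrt ?_
    rw [le_div_iff₀ hs0]
    have h4 : s ^ (j + 1) * g s ^ 2 ≤ |B| * s := h3.trans (by gcongr; exact le_abs_self B)
    rw [pow_succ] at h4
    have h5 : s ^ j * g s ^ 2 ≤ |B| := by
      by_contra hn
      push Not at hn
      nlinarith [mul_lt_mul_of_pos_right hn hs0]
    refine le_trans ?_ h5
    rw [mul_comm]
    gcongr
    calc s = s ^ 1 := (pow_one s).symm
      _ ≤ s ^ j := pow_le_pow_of_le_one hs0.le hs.2 hP.j_le
  rw [h1, intervalIntegral.integral_const_mul, hv, Real.sqrt_one] at h2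
  have h3 : |U r| ≤ |U 1| + |U 1 - U r| := by
    have := abs_sub_abs_le_abs_sub (U r) (U 1)
    rw [abs_sub_comm] at this
    linarith
  nlinarith [Real.sqrt_nonneg |B|, Real.sqrt_nonneg r,
    mul_nonneg (Real.sqrt_nonneg |B|) (Real.sqrt_nonneg r)]

/-- Used only to discard boundary terms at the origin, so the dependence of `B` on `ε` and on the
profile is harmless. -/
theorem exists_energy_le_mul (hP : Profile j f ε E N U g m q) (hw : DoubleWell f k C) :
    ∃ B, 0 ≤ B ∧ ∀ r ∈ Ioc (0 : ℝ) 1, r ^ (j + 1) * radEnergy f ε (U r) (g r) ≤ B * r := by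
  obtain ⟨B, hB⟩ := hP.g_small
  obtain ⟨BU, hBU⟩ := hP.exists_abs_U_le
  have hfc : Continuous f := continuous_iff_continuousAt.2 fun s => (hw.diff s).continuousAt
  have hε := hP.eps_pos
  obtain ⟨D, hD⟩ := (isCompact_Icc (a := -BU) (b := BU)).exists_bound_of_continuousOn
    hfc.continuousOn
  refine ⟨ε * |B| + |D| / ε, by positivity, fun r hr => ?_⟩
  have h1 := hD (U r) (abs_le.1 (hBU r hr))
  rw [Real.norm_eq_abs] at h1
  have h2 : f (U r) / ε ≤ |D| / ε := by
    gcongr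
    exact (le_abs_self _).trans (h1.trans (le_abs_self D))
  have h3 := hB r hr
  have h4 : r ^ (j + 1) ≤ r := by
    calc r ^ (j + 1) ≤ r ^ 1 := pow_le_pow_of_le_one hr.1.le hr.2 (by omega)
      _ = r := pow_one r
  have hp : 0 ≤ r ^ (j + 1) := pow_nonneg hr.1.le _
  have hr0 := hr.1.le
  have h5 : r ^ (j + 1) * (f (U r) / ε) ≤ r * (|D| / ε) :=
    mul_le_mul h4 h2 (div_nonneg (hw.nonneg _) hε.le) hr0
  have h6 : r ^ (j + 1) * g r ^ 2 ≤ |B| * r := h3.trans (by gcongr; exact le_abs_self B)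
  have h7 : 0 ≤ |B| * r := by positivity
  unfold radEnergy
  nlinarith [mul_le_mul_of_nonneg_left h6 hε.le, mul_nonneg hε.le h7]

/-! ### The discrepancy identity and its consequences -/

theorem hasDerivAt_g (hP : Profile j f ε E N U g m q) {r : ℝ} (hr : r ∈ Ioo (0 : ℝ) 1) :
    HasDerivAt g ((deriv f (U r) / ε - m r) / ε - ((j + 1 : ℕ) : ℝ) * g r / r) r := by
  have hr0 := hr.1.ne'
  have h := (hP.flux_deriv r hr).div (hasDerivAt_pow (j + 1) r) (pow_ne_zero _ hr0)
  have he : g =ᶠ[𝓝 r] (fun s => s ^ (j + 1) * g s) / fun s => s ^ (j + 1) := by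
    filter_upwards [lt_mem_nhds hr.1] with s hs
    have : s ^ (j + 1) ≠ 0 := pow_ne_zero _ hs.ne'
    simp only [Pi.div_apply]
    field_simp
  refine (h.congr_of_eventuallyEq he).congr_deriv ?_
  have hε := hP.eps_pos.ne'
  simp only [Nat.add_sub_cancel]
  field_simp
  ring

/-- In `ε g g' - f'(U) g / ε` the potential terms cancel; only the chemical potential and the
curvature term survive. -/
theorem hasDerivAt_disc (hP : Profile j f ε E N U g m q) (hw : DoubleWell f k C) {r : ℝ}
    (hr : r ∈ Ioo (0 : ℝ) 1) :
    HasDerivAt (fun s => radDisc f ε (U s) (g s))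
      (-(m r * g r) - ((j + 1 : ℕ) : ℝ) * (ε * g r ^ 2) / r) r := by
  have hε := hP.eps_pos.ne'
  have h := ((((hP.hasDerivAt_g hr).pow 2).const_mul ε).div_const 2).sub
    (((hw.diff (U r)).comp r (hP.U_deriv r hr)).div_const ε)
  refine h.congr_deriv ?_
  simp only [Nat.add_one_sub_one, pow_one, Nat.cast_ofNat]
  have hr0 := hr.1.ne'
  field_simp
  ring

/-- Differentiating the weight turns the curvature term `-ε g²` into `ξ - ε g² = -e`, so the full
energy density appears with a sign. -/
theorem disc_identity (hP : Profile j f ε E N U g m q) (hw : DoubleWell f k C) {a b : ℝ}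
    (ha : 0 < a) (hab : a ≤ b) (hb : b ≤ 1) :
    b ^ (j + 1) * radDisc f ε (U b) (g b) - a ^ (j + 1) * radDisc f ε (U a) (g a)
      = -(∫ s in a..b, m s * g s * s ^ (j + 1))
        - ((j + 1 : ℕ) : ℝ) * ∫ s in a..b, s ^ j * radEnergy f ε (U s) (g s) := by
  have hi1 := intervalIntegrable_of_continuousOn_Ioc ((hP.m_cont.mul hP.g_cont).mul
    ((continuous_pow (j + 1)).continuousOn)) ha hab hb
  have hi2 := hP.ii_energy hw j ha hab hb
  have h := intervalIntegral.integral_eq_sub_of_hasDerivAt_of_le hab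
    (f := fun s => s ^ (j + 1) * radDisc f ε (U s) (g s))
    (f' := fun s => -(m s * g s * s ^ (j + 1))
      - ((j + 1 : ℕ) : ℝ) * (s ^ j * radEnergy f ε (U s) (g s)))
    (((continuous_pow (j + 1)).continuousOn.mul (hP.cont_disc hw)).mono
      fun x hx => ⟨ha.trans_le hx.1, hx.2.trans hb⟩)
    (fun r hr => ?_) (hi1.neg.sub (hi2.const_mul _))
  · rw [← h, intervalIntegral.integral_sub (f := fun s => -(m s * g s * s ^ (j + 1))) hi1.neg
      (hi2.const_mul _), intervalIntegral.integral_neg, intervalIntegral.integral_const_mul]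
  · have hr' : r ∈ Ioo (0 : ℝ) 1 := ⟨ha.trans hr.1, hr.2.trans_le hb⟩
    refine ((hasDerivAt_pow (j + 1) r).mul (hP.hasDerivAt_disc hw hr')).congr_deriv ?_
    have hr0 := hr'.1.ne'
    have hε := hP.eps_pos.ne'
    simp only [Nat.add_sub_cancel, radDisc, radEnergy]
    rw [pow_succ]
    field_simp
    ring

/-- The bound for the `(d-2)`-density of the energy. -/
noncomputable def densityBound (C E N m1 : ℝ) : ℝ := 12 * E + 11 * supBound C E * (|m1| + 2 * N)

/-- The identity is used up to a radius `r0 ≥ 1/2` of bounded energy. The boundary term at `r0`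
costs `8 E`, the one at the origin vanishes in the limit, and beyond `1/2` the lost factor `s` costs
at most `2`, for another `4 E`. -/
theorem density_le (hP : Profile j f ε E N U g m q) (hw : DoubleWell f k C) {r : ℝ}
    (hr : r ∈ Ioc (0 : ℝ) 1) :
    ((j + 1 : ℕ) : ℝ) * ∫ s in r..1, s ^ j * radEnergy f ε (U s) (g s)
      ≤ densityBound C E N (m 1) := by
  obtain ⟨r0, hr0, he0⟩ := hP.exists_energy_le hw
  obtain ⟨B, hB0, hB⟩ := hP.exists_energy_le_mul hw
  have hE := hP.E_nonneg
  have hN := hP.N_ge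
  have hr0p : 0 < r0 := by linarith [hr0.1]
  have hj : ((j + 1 : ℕ) : ℝ) ≤ 2 := by exact_mod_cast Nat.succ_le_succ hP.j_le
  have hj0 : (0 : ℝ) ≤ ((j + 1 : ℕ) : ℝ) := by positivity
  have hen : ∀ s, 0 ≤ radEnergy f ε (U s) (g s) := fun s =>
    radEnergy_nonneg hw.nonneg hP.eps_pos _ _
  have hI : ∀ a b, 0 < a → a ≤ b → b ≤ 1 → 0 ≤ ∫ s in a..b, s ^ j * radEnergy f ε (U s) (g s) :=
    fun a b ha hab hb => intervalIntegral.integral_nonneg hab fun s hs =>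
      mul_nonneg (pow_nonneg (ha.le.trans hs.1) _) (hen s)
  -- the part away from the origin
  have hout : ∀ a, 1 / 2 ≤ a → a ≤ 1 →
      ((j + 1 : ℕ) : ℝ) * ∫ s in a..1, s ^ j * radEnergy f ε (U s) (g s) ≤ 4 * E := by
    intro a ha ha1
    have ha0 : 0 < a := by linarith
    have : ∫ s in a..1, s ^ j * radEnergy f ε (U s) (g s) ≤ 2 * E := by
      refine le_trans ?_ (mul_le_mul_of_nonneg_left (hP.energy_le a ⟨ha0, ha1⟩)
        (by norm_num : (0 : ℝ) ≤ 2))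
      rw [← intervalIntegral.integral_const_mul]
      refine intervalIntegral.integral_mono_on ha1 (hP.ii_energy hw j ha0 ha1 le_rfl)
        ((hP.ii_energy hw (j + 1) ha0 ha1 le_rfl).const_mul 2) fun s hs => ?_
      have hs1 : 1 ≤ 2 * s := by linarith [hs.1]
      have : 0 ≤ s ^ j * radEnergy f ε (U s) (g s) :=
        mul_nonneg (pow_nonneg (by linarith) _) (hen s)
      calc s ^ j * radEnergy f ε (U s) (g s)
          ≤ (2 * s) * (s ^ j * radEnergy f ε (U s) (g s)) := le_mul_of_one_le_left this hs1
        _ = _ := by ring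
    have h0 := hI a 1 ha0 ha1 le_rfl
    nlinarith
  have hM : 0 ≤ 11 * supBound C E * (|m 1| + 2 * N) :=
    mul_nonneg (mul_nonneg (by norm_num) (supBound_nonneg _ _)) (by positivity)
  unfold densityBound
  rcases le_total (1 / 2) r with h | h
  · linarith [hout r h hr.2]
  · have hrr0 : r ≤ r0 := h.trans hr0.1
    have hin : ∀ a, 0 < a → a ≤ r →
        ((j + 1 : ℕ) : ℝ) * ∫ s in r..r0, s ^ j * radEnergy f ε (U s) (g s)
          ≤ B * a + (8 * E + 11 * supBound C E * (|m 1| + 2 * N)) := by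
      intro a ha har
      have hid := hP.disc_identity hw ha (har.trans hrr0) hr0.2
      have hmg := hP.integral_m_g_le hw ha (har.trans hrr0) hr0.2
      have h1 : ∫ s in r..r0, s ^ j * radEnergy f ε (U s) (g s)
          ≤ ∫ s in a..r0, s ^ j * radEnergy f ε (U s) (g s) :=
        intervalIntegral_mono_left har (hP.ii_energy hw j ha (har.trans hrr0) hr0.2) hrr0
          fun s hs => mul_nonneg (pow_nonneg (ha.le.trans hs.1.le) _) (hen s)
      have h2 : a ^ (j + 1) * radDisc f ε (U a) (g a) ≤ B * a := by
        refine le_trans ?_ (hB a ⟨ha, har.trans hr.2⟩)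
        exact mul_le_mul_of_nonneg_left ((le_abs_self _).trans
          (radDisc_abs_le hw.nonneg hP.eps_pos _ _)) (pow_nonneg ha.le _)
      have h3 : -(r0 ^ (j + 1) * radDisc f ε (U r0) (g r0)) ≤ 8 * E := by
        have h4 : -radDisc f ε (U r0) (g r0) ≤ 8 * E :=
          (neg_le_abs _).trans ((radDisc_abs_le hw.nonneg hP.eps_pos _ _).trans he0)
        have h5 : r0 ^ (j + 1) ≤ 1 := pow_le_one₀ hr0p.le hr0.2
        have h6 : 0 ≤ r0 ^ (j + 1) := pow_nonneg hr0p.le _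
        nlinarith
      have h7 := mul_le_mul_of_nonneg_left h1 hj0
      have h8 := (abs_le.1 hmg).1
      linarith
    have hin' : ((j + 1 : ℕ) : ℝ) * ∫ s in r..r0, s ^ j * radEnergy f ε (U s) (g s)
        ≤ 8 * E + 11 * supBound C E * (|m 1| + 2 * N) := by
      refine le_of_forall_pos_le_add fun θ hθ => ?_
      have hpos : 0 < min r (θ / (B + 1)) := lt_min hr.1 (by positivity)
      have h1 := hin _ hpos (min_le_left _ _)
      have h2 : B * min r (θ / (B + 1)) ≤ θ := by
        calc B * min r (θ / (B + 1)) ≤ (B + 1) * (θ / (B + 1)) := by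
              gcongr
              · linarith
              · exact min_le_right _ _
          _ = θ := by field_simp
      linarith
    rw [← intervalIntegral.integral_add_adjacent_intervals
      (hP.ii_energy hw j hr.1 hrr0 hr0.2) (hP.ii_energy hw j hr0p hr0.2 le_rfl)]
    have := hout r0 hr0.1 hr0.2
    linarith

/-- With `∫ s^j e` under control, the same identity read from the origin to `r` bounds the boundary
term itself: one copy of the density bound for that integral, one for `∫ m g`. -/
theorem disc_le (hP : Profile j f ε E N U g m q) (hw : DoubleWell f k C) {r : ℝ}
    (hr : r ∈ Ioc (0 : ℝ) 1) :
    r ^ (j + 1) * |radDisc f ε (U r) (g r)| ≤ 2 * densityBound C E N (m 1) := by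
  obtain ⟨B, hB0, hB⟩ := hP.exists_energy_le_mul hw
  have hE := hP.E_nonneg
  have hN := hP.N_ge
  have hen : ∀ s, 0 ≤ radEnergy f ε (U s) (g s) := fun s =>
    radEnergy_nonneg hw.nonneg hP.eps_pos _ _
  have hM : 0 ≤ 11 * supBound C E * (|m 1| + 2 * N) :=
    mul_nonneg (mul_nonneg (by norm_num) (supBound_nonneg _ _)) (by positivity)
  refine le_of_forall_pos_le_add fun θ hθ => ?_
  have ha : 0 < min r (θ / (B + 1)) := lt_min hr.1 (by positivity)
  have har : min r (θ / (B + 1)) ≤ r := min_le_left _ _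
  have h2 : B * min r (θ / (B + 1)) ≤ θ := by
    calc B * min r (θ / (B + 1)) ≤ (B + 1) * (θ / (B + 1)) := by
          gcongr
          · linarith
          · exact min_le_right _ _
      _ = θ := by field_simp
  set a := min r (θ / (B + 1))
  have hid := hP.disc_identity hw ha har hr.2
  have hmg := hP.integral_m_g_le hw ha har hr.2
  have hd := hP.density_le hw ⟨ha, har.trans hr.2⟩
  have h0 : 0 ≤ ((j + 1 : ℕ) : ℝ) * ∫ s in a..r, s ^ j * radEnergy f ε (U s) (g s) :=
    mul_nonneg (by positivity) (intervalIntegral.integral_nonneg har fun s hs =>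
      mul_nonneg (pow_nonneg (ha.le.trans hs.1) _) (hen s))
  have h1 : ((j + 1 : ℕ) : ℝ) * ∫ s in a..r, s ^ j * radEnergy f ε (U s) (g s)
      ≤ ((j + 1 : ℕ) : ℝ) * ∫ s in a..1, s ^ j * radEnergy f ε (U s) (g s) :=
    mul_le_mul_of_nonneg_left (intervalIntegral_mono_right har
      (hP.ii_energy hw j ha (har.trans hr.2) le_rfl) hr.2
      fun s hs => mul_nonneg (pow_nonneg (by linarith [hs.1, hr.1]) _) (hen s)) (by positivity)
  have h3 : |a ^ (j + 1) * radDisc f ε (U a) (g a)| ≤ B * a := by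
    refine le_trans ?_ (hB a ⟨ha, har.trans hr.2⟩)
    rw [abs_mul, abs_of_nonneg (pow_nonneg ha.le _)]
    exact mul_le_mul_of_nonneg_left (radDisc_abs_le hw.nonneg hP.eps_pos _ _)
      (pow_nonneg ha.le _)
  have hp : 0 ≤ r ^ (j + 1) := pow_nonneg hr.1.le _
  rw [← abs_of_nonneg hp, ← abs_mul]
  unfold densityBound at *
  rw [abs_le] at *
  constructor <;> linarith [h3.1, h3.2, hmg.1, hmg.2]

end Profile

/-! ### The mean value condition and the boundary value of `m` -/

theorem intervalIntegrable_of_bounded {F : ℝ → ℝ} (h : ContinuousOn F (Ioc 0 1)) {B : ℝ}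
    (hB : ∀ s ∈ Ioc (0 : ℝ) 1, |F s| ≤ B) : IntervalIntegrable F volume 0 1 := by
  rw [intervalIntegrable_iff_integrableOn_Ioc_of_le zero_le_one]
  refine Integrable.of_bound (h.aestronglyMeasurable measurableSet_Ioc) B ?_
  filter_upwards [ae_restrict_mem measurableSet_Ioc] with s hs
  exact hB s hs

theorem abs_integral_sub_le {F : ℝ → ℝ} (h : ContinuousOn F (Ioc 0 1)) {B : ℝ}
    (hB : ∀ s ∈ Ioc (0 : ℝ) 1, |F s| ≤ B) {a : ℝ} (ha : a ∈ Ioc (0 : ℝ) 1) :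
    |(∫ s in (0 : ℝ)..1, F s) - ∫ s in a..1, F s| ≤ B * a := by
  have hi := intervalIntegrable_of_bounded h hB
  have h1 : IntervalIntegrable F volume 0 a := hi.mono_set (by
    rw [uIcc_of_le ha.1.le, uIcc_of_le zero_le_one]; exact Icc_subset_Icc_right ha.2)
  have h2 : IntervalIntegrable F volume a 1 := hi.mono_set (by
    rw [uIcc_of_le ha.2, uIcc_of_le zero_le_one]; exact Icc_subset_Icc_left ha.1.le)
  rw [← intervalIntegral.integral_add_adjacent_intervals h1 h2, add_sub_cancel_right]
  refine (abs_intervalIntegral_le ha.1.le (G := fun _ => B) (by simp)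
    fun s hs => hB s ⟨hs.1, hs.2.trans ha.2⟩).trans ?_
  simp [mul_comm]

theorem le_of_forall_small {x y K : ℝ} (hK : 0 ≤ K)
    (h : ∀ a ∈ Ioc (0 : ℝ) 1, x ≤ K * a + y) : x ≤ y := by
  refine le_of_forall_pos_le_add fun θ hθ => ?_
  have hpos : 0 < min 1 (θ / (K + 1)) := lt_min one_pos (by positivity)
  have h1 := h _ ⟨hpos, min_le_left _ _⟩
  have h2 : K * min 1 (θ / (K + 1)) ≤ θ := by
    calc K * min 1 (θ / (K + 1)) ≤ (K + 1) * (θ / (K + 1)) := by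
          gcongr
          · linarith
          · exact min_le_right _ _
      _ = θ := by field_simp
  linarith

/-- Truncation to `[-1, 1]`. -/
noncomputable def clamp (u : ℝ) : ℝ := max (-1) (min 1 u)

theorem continuous_clamp : Continuous clamp := by unfold clamp; fun_prop

theorem abs_clamp_le (u : ℝ) : |clamp u| ≤ 1 := by
  unfold clamp
  rw [abs_le]
  exact ⟨le_max_left _ _, max_le (by norm_num) (min_le_left _ _)⟩

/-- Young's inequality bounds `2 |1 - |u||` by `θ + (|u| - 1)²/θ`, and the square is controlled by
`f`. The truncation gives a bounded substitute for `U` whose product with `U` is almost at least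
`1`. -/
theorem DoubleWell.clamp_estimates {f : ℝ → ℝ} {k C : ℝ} (hw : DoubleWell f k C) {θ : ℝ}
    (hθ : 0 < θ) (u : ℝ) :
    1 - θ - C / θ * f u ≤ u * clamp u ∧ |u - clamp u| ≤ θ + C / θ * f u := by
  have h := hw.dist_sq_le u
  have h1 : (|u| - 1) ^ 2 / θ ≤ C / θ * f u := by
    rw [div_mul_eq_mul_div]; exact div_le_div_of_nonneg_right h hθ.le
  have e1 : θ + (|u| - 1) ^ 2 / θ - 2 * (1 - |u|) = (θ - (1 - |u|)) ^ 2 / θ := by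
    field_simp; ring
  have e2 : θ + (|u| - 1) ^ 2 / θ - 2 * (|u| - 1) = (θ - (|u| - 1)) ^ 2 / θ := by
    field_simp; ring
  have p1 : 0 ≤ (θ - (1 - |u|)) ^ 2 / θ := by positivity
  have p2 : 0 ≤ (θ - (|u| - 1)) ^ 2 / θ := by positivity
  have p3 : 0 ≤ (|u| - 1) ^ 2 / θ := by positivity
  rcases le_total 0 u with hu | hu
  · rw [abs_of_nonneg hu] at *
    unfold clamp
    rw [max_eq_right (by rw [le_min_iff]; constructor <;> linarith : (-1 : ℝ) ≤ min 1 u)]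
    rcases le_total u 1 with h' | h'
    · rw [min_eq_right h']
      constructor
      · nlinarith
      · rw [sub_self, abs_zero]; linarith
    · rw [min_eq_left h', abs_of_nonneg (by linarith)]
      constructor <;> linarith
  · rw [abs_of_nonpos hu] at *
    unfold clamp
    rw [min_eq_right (by linarith)]
    rcases le_total (-1) u with h' | h'
    · rw [max_eq_right h']
      constructor
      · nlinarith
      · rw [sub_self, abs_zero]; linarith
    · rw [max_eq_left h', abs_of_nonpos (by linarith)]
      constructor <;> linarith

namespace Profile

variable {j : ℕ} {f : ℝ → ℝ} {k C ε E N : ℝ} {U g m q : ℝ → ℝ}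

theorem integral_potential_le (hP : Profile j f ε E N U g m q) (hw : DoubleWell f k C) :
    ∫ s in (0 : ℝ)..1, s ^ (j + 1) * f (U s) ≤ ε * E := by
  have hfc : Continuous f := continuous_iff_continuousAt.2 fun s => (hw.diff s).continuousAt
  have hε := hP.eps_pos
  obtain ⟨B, hB0, hB⟩ := hP.exists_energy_le_mul hw
  have hcont : ContinuousOn (fun s => s ^ (j + 1) * f (U s)) (Ioc 0 1) :=
    (continuous_pow _).continuousOn.mul (hfc.comp_continuousOn hP.U_cont)
  have hfe : ∀ s, f (U s) ≤ ε * radEnergy f ε (U s) (g s) := fun s => by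
    unfold radEnergy
    have : 0 ≤ ε * (ε * g s ^ 2 / 2) := by positivity
    have e : ε * (f (U s) / ε) = f (U s) := by field_simp
    nlinarith
  have hbd : ∀ s ∈ Ioc (0 : ℝ) 1, |s ^ (j + 1) * f (U s)| ≤ ε * B := fun s hs => by
    have hp := pow_nonneg hs.1.le (j + 1)
    rw [abs_of_nonneg (mul_nonneg hp (hw.nonneg _))]
    have h1 := mul_le_mul_of_nonneg_left (hfe s) hp
    have h2 := mul_le_mul_of_nonneg_left (hB s hs) hε.le
    have h3 : ε * (B * s) ≤ ε * B := by
      have := hs.2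
      gcongr
      nlinarith
    nlinarith
  refine le_of_forall_small (K := ε * B) (by positivity) fun a ha => ?_
  have h1 := abs_integral_sub_le hcont hbd ha
  have h2 : ∫ s in a..1, s ^ (j + 1) * f (U s) ≤ ε * E := by
    refine le_trans ?_ (mul_le_mul_of_nonneg_left (hP.energy_le a ha) hε.le)
    rw [← intervalIntegral.integral_const_mul]
    refine intervalIntegral.integral_mono_on ha.2
      (intervalIntegrable_of_continuousOn_Ioc hcont ha.1 ha.2 le_rfl)
      ((hP.ii_energy hw _ ha.1 ha.2 le_rfl).const_mul _) fun s hs => ?_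
    have := mul_le_mul_of_nonneg_left (hfe s) (pow_nonneg (ha.1.le.trans hs.1) (j + 1))
    linarith
  linarith [(abs_le.1 h1).2]

/-- The mean of the truncated profile. -/
noncomputable def clampMean (j : ℕ) (U : ℝ → ℝ) : ℝ :=
  ((j : ℝ) + 2) * ∫ s in (0 : ℝ)..1, s ^ (j + 1) * clamp (U s)

theorem cont_clamp (hP : Profile j f ε E N U g m q) :
    ContinuousOn (fun s => s ^ (j + 1) * clamp (U s)) (Ioc 0 1) :=
  (continuous_pow _).continuousOn.mul (continuous_clamp.comp_continuousOn hP.U_cont)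

theorem pow_mul_le {s B x : ℝ} (hs : s ∈ Ioc (0 : ℝ) 1) (hx : |x| ≤ B) (i : ℕ) :
    |s ^ i * x| ≤ B := by
  rw [abs_mul, abs_of_nonneg (pow_nonneg hs.1.le _)]
  exact (mul_le_of_le_one_left (abs_nonneg _) (pow_le_one₀ hs.1.le hs.2)).trans hx

theorem integral_pow_weight : ∫ s in (0 : ℝ)..1, s ^ (j + 1) = 1 / ((j : ℝ) + 2) := by
  rw [integral_pow]
  push_cast
  simp
  ring

/-- Up to the error `θ`, the mean of `U · clamp U` is at least `1` and the mean of `clamp U` is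
`c̄`, so their covariance is about `1 - c̄²`. The choice `θ = (1 - c̄²)/8` loses half of it, and
division by `j + 2 ≤ 3` gives the factor `1/6`. -/
theorem variance_ge (hP : Profile j f ε E N U g m q) (hw : DoubleWell f k C) {cbar : ℝ}
    (hc : |cbar| < 1)
    (hmass : ∫ s in (0 : ℝ)..1, s ^ (j + 1) * U s = cbar / ((j : ℝ) + 2))
    (hsmall : 3 * C * E * ε ≤ ((1 - cbar ^ 2) / 8) ^ 2) :
    (1 - cbar ^ 2) / 6 ≤ ∫ s in (0 : ℝ)..1, U s * (s ^ (j + 1) * (clamp (U s) - clampMean j U)) ∧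
      |clampMean j U| ≤ 1 := by
  have hc2 : 0 < 1 - cbar ^ 2 := by
    have := (sq_lt_one_iff_abs_lt_one cbar).2 hc
    linarith
  set θ := (1 - cbar ^ 2) / 8 with hθ
  have hθ0 : 0 < θ := by positivity
  set J : ℝ := (j : ℝ) + 2 with hJ
  have hJ0 : 0 < J := by positivity
  have hJ3 : J ≤ 3 := by
    have : (j : ℝ) ≤ 1 := by exact_mod_cast hP.j_le
    linarith
  obtain ⟨BU, hBU⟩ := hP.exists_abs_U_le
  have hfc : Continuous f := continuous_iff_continuousAt.2 fun s => (hw.diff s).continuousAt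
  obtain ⟨D, hD⟩ := (isCompact_Icc (a := -BU) (b := BU)).exists_bound_of_continuousOn
    hfc.continuousOn
  have hif : IntervalIntegrable (fun s => s ^ (j + 1) * f (U s)) volume 0 1 :=
    intervalIntegrable_of_bounded ((continuous_pow _).continuousOn.mul
      (hfc.comp_continuousOn hP.U_cont)) (B := D)
      fun s hs => pow_mul_le hs (hD _ (abs_le.1 (hBU s hs))) _
  have hiT := intervalIntegrable_of_bounded hP.cont_clamp (B := 1)
    fun s hs => pow_mul_le hs (abs_clamp_le _) _
  have hiU : IntervalIntegrable (fun s => s ^ (j + 1) * U s) volume 0 1 :=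
    intervalIntegrable_of_bounded ((continuous_pow _).continuousOn.mul hP.U_cont) (B := BU)
    fun s hs => pow_mul_le hs (hBU s hs) _
  have hiUT : IntervalIntegrable (fun s => s ^ (j + 1) * (U s * clamp (U s))) volume 0 1 :=
    intervalIntegrable_of_bounded ((continuous_pow _).continuousOn.mul
      (hP.U_cont.mul (continuous_clamp.comp_continuousOn hP.U_cont))) (B := BU)
    fun s hs => pow_mul_le hs (by
      rw [abs_mul]
      exact (mul_le_of_le_one_right (abs_nonneg _) (abs_clamp_le _)).trans (hBU s hs)) _
  have hi1 : IntervalIntegrable (fun s : ℝ => s ^ (j + 1)) volume 0 1 :=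
    (continuous_pow _).intervalIntegrable _ _
  have hpot := hP.integral_potential_le hw
  set V := ∫ s in (0 : ℝ)..1, s ^ (j + 1) * f (U s)
  have hV : J * (C / θ * V) ≤ θ := by
    have hCθ : 0 ≤ C / θ := div_nonneg (by linarith [hw.one_le]) hθ0.le
    have hV0 : 0 ≤ V := intervalIntegral.integral_nonneg zero_le_one fun s hs =>
      mul_nonneg (pow_nonneg hs.1 _) (hw.nonneg _)
    calc J * (C / θ * V) ≤ 3 * (C / θ * (ε * E)) := by gcongr
      _ = 3 * C * E * ε / θ := by ring
      _ ≤ θ ^ 2 / θ := by gcongr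
      _ = θ := by field_simp
  have hUT : (1 - θ) / J - C / θ * V ≤ ∫ s in (0 : ℝ)..1, s ^ (j + 1) * (U s * clamp (U s)) := by
    have h1 : ∫ s in (0 : ℝ)..1, ((1 - θ) * s ^ (j + 1) - C / θ * (s ^ (j + 1) * f (U s)))
        = (1 - θ) / J - C / θ * V := by
      rw [intervalIntegral.integral_sub (hi1.const_mul _) (hif.const_mul _),
        intervalIntegral.integral_const_mul, intervalIntegral.integral_const_mul,
        integral_pow_weight]
      ring
    rw [← h1]
    refine intervalIntegral.integral_mono_on zero_le_one
      ((hi1.const_mul _).sub (hif.const_mul _)) hiUT fun s hs => ?_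
    have := mul_le_mul_of_nonneg_left (hw.clamp_estimates hθ0 (U s)).1 (pow_nonneg hs.1 (j + 1))
    linarith
  have hτ : |cbar / J - ∫ s in (0 : ℝ)..1, s ^ (j + 1) * clamp (U s)| ≤ θ / J + C / θ * V := by
    have h1 : ∫ s in (0 : ℝ)..1, (θ * s ^ (j + 1) + C / θ * (s ^ (j + 1) * f (U s)))
        = θ / J + C / θ * V := by
      rw [intervalIntegral.integral_add (hi1.const_mul _) (hif.const_mul _),
        intervalIntegral.integral_const_mul, intervalIntegral.integral_const_mul,
        integral_pow_weight]
      ring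
    rw [← h1, ← hmass, ← intervalIntegral.integral_sub hiU hiT]
    refine abs_intervalIntegral_le zero_le_one ((hi1.const_mul _).add (hif.const_mul _))
      fun s hs => ?_
    have hp := pow_nonneg hs.1.le (j + 1)
    rw [← mul_sub, abs_mul, abs_of_nonneg hp]
    have := mul_le_mul_of_nonneg_left (hw.clamp_estimates hθ0 (U s)).2 hp
    linarith
  have hτ1 : |clampMean j U| ≤ 1 := by
    unfold clampMean
    have h1 : |∫ s in (0 : ℝ)..1, s ^ (j + 1) * clamp (U s)| ≤ ∫ s in (0 : ℝ)..1, s ^ (j + 1) :=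
      abs_intervalIntegral_le zero_le_one hi1 fun s hs => by
        have hp := pow_nonneg hs.1.le (j + 1)
        rw [abs_mul, abs_of_nonneg hp]
        exact mul_le_of_le_one_right hp (abs_clamp_le _)
    rw [integral_pow_weight, ← hJ] at h1
    rw [abs_mul, ← hJ, abs_of_pos hJ0]
    calc _ ≤ J * (1 / J) := by gcongr
      _ = 1 := by field_simp
  refine ⟨?_, hτ1⟩
  have hsplit : ∫ s in (0 : ℝ)..1, U s * (s ^ (j + 1) * (clamp (U s) - clampMean j U))
      = (∫ s in (0 : ℝ)..1, s ^ (j + 1) * (U s * clamp (U s))) - clampMean j U * (cbar / J) := by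
    rw [← hmass, ← intervalIntegral.integral_const_mul,
      ← intervalIntegral.integral_sub hiUT (hiU.const_mul _)]
    congr 1; ext s; ring
  rw [hsplit]
  have h3 : |cbar - clampMean j U| ≤ 2 * θ := by
    have e : cbar - clampMean j U
        = J * (cbar / J - ∫ s in (0 : ℝ)..1, s ^ (j + 1) * clamp (U s)) := by
      unfold clampMean; rw [← hJ]; field_simp
    rw [e, abs_mul, abs_of_pos hJ0]
    calc _ ≤ J * (θ / J + C / θ * V) := by gcongr
      _ = θ + J * (C / θ * V) := by field_simp
      _ ≤ _ := by linarith
  have h4 : clampMean j U * cbar ≤ cbar ^ 2 + 2 * θ := by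
    have h5 : |(cbar - clampMean j U) * cbar| ≤ 2 * θ := by
      rw [abs_mul]
      exact (mul_le_of_le_one_right (abs_nonneg _) hc.le).trans h3
    have := neg_le_of_abs_le h5
    nlinarith
  have h6 : (1 - θ - θ - (cbar ^ 2 + 2 * θ)) / J
      ≤ (1 - θ) / J - C / θ * V - clampMean j U * (cbar / J) := by
    have e : (1 - θ) / J - C / θ * V - clampMean j U * (cbar / J)
        = (1 - θ - J * (C / θ * V) - clampMean j U * cbar) / J := by field_simp
    rw [e]
    gcongr
  have h7 : (1 - cbar ^ 2) / 6 ≤ (1 - θ - θ - (cbar ^ 2 + 2 * θ)) / J := by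
    rw [le_div_iff₀ hJ0]
    have : 1 - θ - θ - (cbar ^ 2 + 2 * θ) = (1 - cbar ^ 2) / 2 := by rw [hθ]; ring
    rw [this]
    nlinarith
  linarith

/-- The boundary value of the chemical potential is controlled by the norm of its gradient. -/
theorem m_one_le (hP : Profile j f ε E N U g m q) (hw : DoubleWell f k C) {cbar : ℝ}
    (hc : |cbar| < 1)
    (hmass : ∫ s in (0 : ℝ)..1, s ^ (j + 1) * U s = cbar / ((j : ℝ) + 2))
    (hsmall : 3 * C * E * ε ≤ ((1 - cbar ^ 2) / 8) ^ 2) :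
    |m 1| ≤ 6 * (5 * supBound C E + 6 * E) / (1 - cbar ^ 2) * N := by
  obtain ⟨hvar, hτ1⟩ := hP.variance_ge hw hc hmass hsmall
  have hc2 : 0 < 1 - cbar ^ 2 := by
    have := (sq_lt_one_iff_abs_lt_one cbar).2 hc
    linarith
  obtain ⟨BU, hBU⟩ := hP.exists_abs_U_le
  have hBU0 : 0 ≤ BU := (abs_nonneg _).trans (hBU 1 (by simp))
  obtain ⟨B, hB0, hB⟩ := hP.exists_energy_le_mul hw
  have hE := hP.E_nonneg
  have hN := hP.N_ge
  have hε := hP.eps_pos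
  have hcU := supBound_nonneg C E
  set τ := clampMean j U with hτ
  set h : ℝ → ℝ := fun s => s ^ (j + 1) * (clamp (U s) - τ) with hh
  -- `Z(r)` is the radial flux of a field with divergence `clamp U - τ`. Writing `∫ m g Z` in two
  -- ways, by parts and through the discrepancy, isolates `∫ m U h`.
  set Z : ℝ → ℝ := fun r => ∫ s in (0 : ℝ)..r, h s with hZ
  have hcT : ContinuousOn (fun s => clamp (U s)) (Ioc 0 1) :=
    continuous_clamp.comp_continuousOn hP.U_cont
  have hhc : ContinuousOn h (Ioc 0 1) :=
    (continuous_pow _).continuousOn.mul (hcT.sub continuousOn_const)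
  have hhb : ∀ s ∈ Ioc (0 : ℝ) 1, |h s| ≤ 2 * s ^ (j + 1) := fun s hs => by
    have hp := pow_nonneg hs.1.le (j + 1)
    simp only [hh]
    rw [abs_mul, abs_of_nonneg hp, mul_comm]
    gcongr
    calc |clamp (U s) - τ| ≤ |clamp (U s)| + |τ| := abs_sub _ _
      _ ≤ 2 := by linarith [abs_clamp_le (U s)]
  have hhb2 : ∀ s ∈ Ioc (0 : ℝ) 1, |h s| ≤ 2 := fun s hs =>
    (hhb s hs).trans (by linarith [pow_le_one₀ hs.1.le hs.2 (n := j + 1)])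
  have hhi : IntervalIntegrable h volume 0 1 := intervalIntegrable_of_bounded hhc hhb2
  have hhi' : ∀ r ∈ Ioc (0 : ℝ) 1, IntervalIntegrable h volume 0 r := fun r hr =>
    hhi.mono_set (by
      rw [uIcc_of_le hr.1.le, uIcc_of_le zero_le_one]; exact Icc_subset_Icc_right hr.2)
  have hZc : ContinuousOn Z (Ioc 0 1) := by
    have := intervalIntegral.continuousOn_primitive_interval (f := h) (μ := volume)
      (a := 0) (b := 1) (by
        rw [intervalIntegrable_iff_integrableOn_Icc_of_le zero_le_one] at hhi
        rwa [uIcc_of_le zero_le_one])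
    rw [uIcc_of_le zero_le_one] at this
    exact this.mono Ioc_subset_Icc_self
  have hZd : ∀ r ∈ Ioo (0 : ℝ) 1, HasDerivAt Z (h r) r := fun r hr => by
    have hco : ContinuousOn h (Ioo 0 1) := hhc.mono Ioo_subset_Ioc_self
    exact intervalIntegral.integral_hasDerivAt_right (hhi' r ⟨hr.1, hr.2.le⟩)
      (hco.stronglyMeasurableAtFilter isOpen_Ioo r hr) (hco.continuousAt (Ioo_mem_nhds hr.1 hr.2))
  -- The extra factor `r` compensates the `1/r` in the derivative of the discrepancy.
  have hZb : ∀ r ∈ Ioc (0 : ℝ) 1, |Z r| ≤ r ^ (j + 1) * r := fun r hr => by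
    have h1 := abs_intervalIntegral_le (F := h) (G := fun s => 2 * s ^ (j + 1)) hr.1.le
      (by apply Continuous.intervalIntegrable; fun_prop)
      fun s hs => hhb s ⟨hs.1, hs.2.trans hr.2⟩
    refine h1.trans ?_
    rw [intervalIntegral.integral_const_mul, integral_pow]
    push_cast
    have hp : 0 ≤ r ^ (j + 1) * r := mul_nonneg (pow_nonneg hr.1.le _) hr.1.le
    have e : 2 * ((r ^ (j + 1 + 1) - 0 ^ (j + 1 + 1)) / ((j : ℝ) + 1 + 1))
        = r ^ (j + 1) * r * (2 / ((j : ℝ) + 1 + 1)) := by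
      rw [zero_pow (by omega), pow_succ]; ring
    rw [e]
    refine mul_le_of_le_one_right hp ?_
    rw [div_le_one (by positivity)]
    linarith [(Nat.cast_nonneg j : (0 : ℝ) ≤ j)]
  -- Subtracting the mean removes the boundary terms at `r = 1`, which contain the unknown `m 1`.
  have hZ1 : Z 1 = 0 := by
    simp only [hZ, hh]
    have hiT := intervalIntegrable_of_bounded hP.cont_clamp (B := 1)
      fun s hs => pow_mul_le hs (abs_clamp_le _) _
    have : ∫ s in (0 : ℝ)..1, s ^ (j + 1) * (clamp (U s) - τ)
        = (∫ s in (0 : ℝ)..1, s ^ (j + 1) * clamp (U s)) - τ * ∫ s in (0 : ℝ)..1, s ^ (j + 1) := by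
      rw [← intervalIntegral.integral_const_mul, ← intervalIntegral.integral_sub hiT
        (((continuous_pow _).intervalIntegrable _ _).const_mul _)]
      congr 1; ext s; ring
    rw [this, integral_pow_weight, hτ, clampMean]
    have : (j : ℝ) + 2 ≠ 0 := by positivity
    field_simp
    ring
  have hUh : ∀ s ∈ Ioc (0 : ℝ) 1, |U s * h s| ≤ BU * 2 := fun s hs => by
    rw [abs_mul]
    exact mul_le_mul (hBU s hs) (hhb2 s hs) (abs_nonneg _) hBU0
  set W := ∫ s in (0 : ℝ)..1, U s * h s
  -- The coefficient of `a` may depend on the profile through `BU` and `B`; only the part that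
  -- survives `a → 0` must be uniform. It is `1 + 4` copies of `supBound C E * N`, from `∫ q U Z`
  -- and `∫ (m - m 1) U h`, and `4 E + 2 E` from the discrepancy.
  have key : ∀ a ∈ Ioc (0 : ℝ) 1, |m 1| * W ≤
      (|m 1| * (BU * 2) + supBound C E * (|m 1| + 2 * N) + B) * a
        + (5 * supBound C E * N + 6 * E) := by
    intro a ha
    have hsub := fun x (hx : x ∈ Ioc a 1) => (⟨ha.1.trans hx.1, hx.2⟩ : x ∈ Ioc (0 : ℝ) 1)
    have ii := fun {F : ℝ → ℝ} (hF : ContinuousOn F (Ioc 0 1)) =>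
      intervalIntegrable_of_continuousOn_Ioc hF ha.1 ha.2 le_rfl
    -- first identity
    have hid1 := hP.integral_m_g_mul ha.1 ha.2 le_rfl hZc hZd hhc
    rw [hZ1, mul_zero, zero_sub] at hid1
    -- second identity
    have hc1 : ContinuousOn (fun s => m s * g s * Z s) (Ioc 0 1) :=
      (hP.m_cont.mul hP.g_cont).mul hZc
    have hc2' : ContinuousOn (fun s => ((j + 1 : ℕ) : ℝ) * (ε * g s ^ 2) / s * Z s) (Ioc 0 1) :=
      ((continuousOn_const.mul (continuousOn_const.mul (hP.g_cont.pow 2))).div continuousOn_id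
        fun x hx => hx.1.ne').mul hZc
    have hc3 : ContinuousOn (fun s => radDisc f ε (U s) (g s) * h s) (Ioc 0 1) :=
      (hP.cont_disc hw).mul hhc
    have hid2 := intervalIntegral.integral_eq_sub_of_hasDerivAt_of_le ha.2
      (f := fun s => radDisc f ε (U s) (g s) * Z s)
      (f' := fun s => -(m s * g s * Z s) - ((j + 1 : ℕ) : ℝ) * (ε * g s ^ 2) / s * Z s
        + radDisc f ε (U s) (g s) * h s)
      (((hP.cont_disc hw).mul hZc).mono fun x hx => ⟨ha.1.trans_le hx.1, hx.2⟩)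
      (fun r hr => by
        have hr' : r ∈ Ioo (0 : ℝ) 1 := ⟨ha.1.trans hr.1, hr.2⟩
        refine ((hP.hasDerivAt_disc hw hr').mul (hZd r hr')).congr_deriv ?_
        ring) (((ii hc1).neg.sub (ii hc2')).add (ii hc3))
    rw [intervalIntegral.integral_add (f := fun s => -(m s * g s * Z s)
        - ((j + 1 : ℕ) : ℝ) * (ε * g s ^ 2) / s * Z s) ((ii hc1).neg.sub (ii hc2')) (ii hc3),
      intervalIntegral.integral_sub (f := fun s => -(m s * g s * Z s)) (ii hc1).neg (ii hc2'),
      intervalIntegral.integral_neg, hZ1, mul_zero, zero_sub] at hid2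
    have hcmu : ContinuousOn (fun s => m s * U s * h s) (Ioc 0 1) :=
      (hP.m_cont.mul hP.U_cont).mul hhc
    have hcU' : ContinuousOn (fun s => U s * h s) (Ioc 0 1) := hP.U_cont.mul hhc
    have hcm1 : ContinuousOn (fun s => (m s - m 1) * U s * h s) (Ioc 0 1) :=
      ((hP.m_cont.sub continuousOn_const).mul hP.U_cont).mul hhc
    have hsplit : ∫ s in a..1, m s * U s * h s
        = m 1 * (∫ s in a..1, U s * h s) + ∫ s in a..1, (m s - m 1) * U s * h s := by
      rw [← intervalIntegral.integral_const_mul,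
        ← intervalIntegral.integral_add ((ii hcU').const_mul _) (ii hcm1)]
      congr 1; ext s; ring
    -- estimates
    have b1 : |m a * U a * Z a| ≤ supBound C E * (|m 1| + 2 * N) * a := by
      have h1 := hP.abs_mul_U_mul_m_le hw ha
      have h2 : supBound C E * (|m 1| + 2 * N) * √(√a) ≤ supBound C E * (|m 1| + 2 * N) :=
        mul_le_of_le_one_right (mul_nonneg hcU (by positivity)) (fourth_root_le_one ha.2)
      rw [abs_mul]
      calc |m a * U a| * |Z a| ≤ |m a * U a| * (a ^ (j + 1) * a) := by gcongr; exact hZb a ha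
        _ = (|m a * U a| * a ^ (j + 1)) * a := by ring
        _ ≤ _ := mul_le_mul_of_nonneg_right (h1.trans h2) ha.1.le
    have b2 := hP.integral_q_U_le hw ha.1 ha.2 le_rfl (Z := Z) fun s hs =>
      (hZb s hs).trans (mul_le_of_le_one_right (pow_nonneg hs.1.le _) hs.2)
    have b3 : |radDisc f ε (U a) (g a) * Z a| ≤ B * a := by
      rw [abs_mul]
      have h1 := hB a ha
      have h2 := radDisc_abs_le hw.nonneg hε (U a) (g a)
      calc _ ≤ radEnergy f ε (U a) (g a) * (a ^ (j + 1) * a) :=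
            mul_le_mul h2 (hZb a ha) (abs_nonneg _) (radEnergy_nonneg hw.nonneg hε _ _)
        _ = (a ^ (j + 1) * radEnergy f ε (U a) (g a)) * a := by ring
        _ ≤ B * a * a := mul_le_mul_of_nonneg_right h1 ha.1.le
        _ ≤ B * a := mul_le_of_le_one_right (mul_nonneg hB0 ha.1.le) ha.2
    have b4 : |∫ s in a..1, ((j + 1 : ℕ) : ℝ) * (ε * g s ^ 2) / s * Z s| ≤ 4 * E := by
      refine (abs_intervalIntegral_le ha.2
        ((hP.ii_energy hw (j + 1) ha.1 ha.2 le_rfl).const_mul 4) fun s hs => ?_).trans ?_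
      · have hs' := hsub s hs
        have hj : ((j + 1 : ℕ) : ℝ) ≤ 2 := by exact_mod_cast Nat.succ_le_succ hP.j_le
        have h1 : ε * g s ^ 2 ≤ 2 * radEnergy f ε (U s) (g s) := by
          unfold radEnergy
          have := div_nonneg (hw.nonneg (U s)) hε.le
          linarith
        have h2 : 0 ≤ ε * g s ^ 2 := by positivity
        have hp := pow_nonneg hs'.1.le (j + 1)
        rw [abs_mul, abs_div, abs_of_pos hs'.1, abs_of_nonneg
          (mul_nonneg (Nat.cast_nonneg _) h2), div_mul_eq_mul_div, div_le_iff₀ hs'.1]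
        calc ((j + 1 : ℕ) : ℝ) * (ε * g s ^ 2) * |Z s|
            ≤ 2 * (2 * radEnergy f ε (U s) (g s)) * (s ^ (j + 1) * s) := by
              have := hZb s hs'
              have := radEnergy_nonneg hw.nonneg hε (U s) (g s)
              gcongr
          _ = _ := by ring
      · rw [intervalIntegral.integral_const_mul]
        linarith [hP.energy_le a ha]
    have b5 : |∫ s in a..1, radDisc f ε (U s) (g s) * h s| ≤ 2 * E := by
      refine (abs_intervalIntegral_le ha.2
        ((hP.ii_energy hw (j + 1) ha.1 ha.2 le_rfl).const_mul 2) fun s hs => ?_).trans ?_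
      · have hs' := hsub s hs
        rw [abs_mul]
        calc _ ≤ radEnergy f ε (U s) (g s) * (2 * s ^ (j + 1)) :=
              mul_le_mul (radDisc_abs_le hw.nonneg hε _ _) (hhb s hs') (abs_nonneg _)
                (radEnergy_nonneg hw.nonneg hε _ _)
          _ = _ := by ring
      · rw [intervalIntegral.integral_const_mul]
        linarith [hP.energy_le a ha]
    have b6 : |∫ s in a..1, (m s - m 1) * U s * h s| ≤ 4 * N * supBound C E := by
      refine (abs_intervalIntegral_le ha.2 (G := fun _ => 4 * N * supBound C E) (by simp)
        fun s hs => ?_).trans ?_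
      · have hs' := hsub s hs
        have hp := pow_nonneg hs'.1.le (j + 1)
        have h1 := hP.m_sub_le hs'
        have h2 := hP.U_le hw hs'
        have h3 := fourth_root_le_one hs'.2
        have h4 : |m s - m 1| * √(s ^ (j + 1)) ≤ 2 * N :=
          h1.trans (mul_le_of_le_one_right (by linarith) h3)
        rw [abs_mul, abs_mul]
        calc |m s - m 1| * |U s| * |h s| ≤ |m s - m 1| * |U s| * (2 * s ^ (j + 1)) := by
              gcongr; exact hhb s hs'
          _ = 2 * ((|m s - m 1| * √(s ^ (j + 1))) * (|U s| * √(s ^ (j + 1)))) := by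
              nth_rewrite 1 [← Real.mul_self_sqrt hp]; ring
          _ ≤ 2 * (2 * N * supBound C E) := by
              gcongr
          _ = _ := by ring
      · rw [intervalIntegral.integral_const, smul_eq_mul]
        refine mul_le_of_le_one_left (by positivity) ?_
        linarith [ha.1]
    have b7 := abs_integral_sub_le hcU' hUh ha
    have hW : m 1 * W = m 1 * (∫ s in a..1, U s * h s)
        + m 1 * (W - ∫ s in a..1, U s * h s) := by ring
    have b8 : |m 1 * (W - ∫ s in a..1, U s * h s)| ≤ |m 1| * (BU * 2 * a) := by
      rw [abs_mul]; gcongr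
    have hW0 : 0 ≤ W := le_trans (by positivity) hvar
    rw [← abs_of_nonneg hW0, ← abs_mul, hW]
    rw [abs_le] at *
    constructor <;> linarith [b1.1, b1.2, b2.1, b2.2, b3.1, b3.2, b4.1, b4.2, b5.1, b5.2,
      b6.1, b6.2, b8.1, b8.2]
  have hfin : |m 1| * W ≤ 5 * supBound C E * N + 6 * E :=
    le_of_forall_small (by positivity) key
  have h1 : |m 1| * ((1 - cbar ^ 2) / 6) ≤ 5 * supBound C E * N + 6 * E :=
    (mul_le_mul_of_nonneg_left hvar (abs_nonneg _)).trans hfin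
  rw [div_mul_eq_mul_div, le_div_iff₀ hc2]
  nlinarith

/-! ### Smallness of the discrepancy on one slice -/

theorem cont_comp (hP : Profile j f ε E N U g m q) {h : ℝ → ℝ} (hh : Continuous h) :
    ContinuousOn (fun s => h (U s)) (Ioc 0 1) := hh.comp_continuousOn hP.U_cont

/-- The equation tested with a function of the profile. -/
theorem tested_identity (hP : Profile j f ε E N U g m q) (hw : DoubleWell f k C)
    {γ γ' : ℝ → ℝ} (hγ : ∀ s, HasDerivAt γ (γ' s) s) (hγ' : Continuous γ') {a : ℝ}
    (ha : a ∈ Ioc (0 : ℝ) 1) :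
    ∫ s in a..1, s ^ (j + 1) * (γ' (U s) * (ε * g s ^ 2) + deriv f (U s) * γ (U s) / ε)
      = (∫ s in a..1, s ^ (j + 1) * (m s * γ (U s))) - ε * (a ^ (j + 1) * g a * γ (U a)) := by
  have hε := hP.eps_pos.ne'
  have hγc : Continuous γ := continuous_iff_continuousAt.2 fun s => (hγ s).continuousAt
  have ii := fun {F : ℝ → ℝ} (hF : ContinuousOn F (Ioc 0 1)) =>
    intervalIntegrable_of_continuousOn_Ioc hF ha.1 ha.2 le_rfl
  have hpc : ContinuousOn (fun s : ℝ => s ^ (j + 1)) (Ioc 0 1) := (continuous_pow _).continuousOn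
  have hc1 : ContinuousOn (fun s => s ^ (j + 1) * (γ' (U s) * (ε * g s ^ 2)
      + deriv f (U s) * γ (U s) / ε)) (Ioc 0 1) :=
    hpc.mul (((hP.cont_comp hγ').mul (continuousOn_const.mul (hP.g_cont.pow 2))).add
      (((hP.cont_comp hw.cont_deriv).mul (hP.cont_comp hγc)).div_const ε))
  have hc2 : ContinuousOn (fun s => s ^ (j + 1) * (m s * γ (U s))) (Ioc 0 1) :=
    hpc.mul (hP.m_cont.mul (hP.cont_comp hγc))
  have h := intervalIntegral.integral_eq_sub_of_hasDerivAt_of_le ha.2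
    (f := fun s => ε * (s ^ (j + 1) * g s * γ (U s)))
    (f' := fun s => s ^ (j + 1) * (γ' (U s) * (ε * g s ^ 2) + deriv f (U s) * γ (U s) / ε)
      - s ^ (j + 1) * (m s * γ (U s)))
    ((continuousOn_const.mul ((hpc.mul hP.g_cont).mul (hP.cont_comp hγc))).mono
      fun x hx => ⟨ha.1.trans_le hx.1, hx.2⟩)
    (fun r hr => by
      have hr' : r ∈ Ioo (0 : ℝ) 1 := ⟨ha.1.trans hr.1, hr.2⟩
      refine (((hP.flux_deriv r hr').mul ((hγ (U r)).comp r (hP.U_deriv r hr'))).const_mul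
        ε).congr_deriv ?_
      simp only [Function.comp_apply]
      field_simp
      ring) ((ii hc1).sub (ii hc2))
  rw [intervalIntegral.integral_sub (ii hc1) (ii hc2), hP.g_one] at h
  linarith

/-- Near the wells `|ξ| ≤ e` and the tested energy dominates `e`; between the wells the bounded
quantity `r^(j+1) |ξ|` is charged to `f(U)`. The resulting gain is `δ`, not `ε`: one of the `j + 1`
factors `δ` in `ε` is kept, and the other `j` are traded for the weight `r^j`. -/
theorem integral_disc_le_aux (hP : Profile j f ε E N U g m q) (hw : DoubleWell f k C)
    {η δ : ℝ} (h0 : 0 < η) (h1 : η ≤ 1 / 3) (hk : η ≤ k) (hδ : 0 < δ) (hδε : δ ^ (j + 1) = ε)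
    {a : ℝ} (ha : a ∈ Ioc (0 : ℝ) 1) :
    ∫ s in a..1, s ^ (j + 1) * |radDisc f ε (U s) (g s)|
      ≤ η * ((9 / 2 * C + 6 + 3 * C ^ 2 / k ^ 2) * E)
        + δ * ((|m 1| + 2 * N) ^ 2 / (2 * η) + (1 + 2 * densityBound C E N (m 1) * (C / η ^ 2))
          * densityBound C E N (m 1)) := by
  obtain ⟨B, hB0, hB⟩ := hP.exists_energy_le_mul hw
  have hE := hP.E_nonneg
  have hN := hP.N_ge
  have hε := hP.eps_pos
  have hε1 := hP.eps_le
  have hC := hw.one_le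
  have hkp := hw.k_pos
  have hen : ∀ s, 0 ≤ radEnergy f ε (U s) (g s) := fun s =>
    radEnergy_nonneg hw.nonneg hε _ _
  set G := densityBound C E N (m 1) with hG
  have hG0 : 0 ≤ G := by
    have := hP.density_le hw (r := 1) (by simp)
    simpa using this
  have hδ1 : δ ≤ 1 := by
    by_contra hn
    push Not at hn
    have := one_lt_pow₀ hn (n := j + 1) (by omega)
    linarith
  have hεδ : ε ≤ δ := by
    rw [← hδε]
    calc δ ^ (j + 1) ≤ δ ^ 1 := pow_le_pow_of_le_one hδ.le hδ1 (by omega)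
      _ = δ := pow_one δ
  set C3 := 6 + 3 * C ^ 2 / k ^ 2 with hC3
  have hC30 : 0 ≤ C3 := by positivity
  -- The summand `1` covers radii below `δ`, the other one radii above `δ`.
  set R := δ * (1 + 2 * G * (C / η ^ 2)) with hR
  have hR0 : 0 ≤ R := by positivity
  have hRδ : δ ≤ R := by
    rw [hR]; refine le_mul_of_one_le_right hδ.le ?_
    have : 0 ≤ 2 * G * (C / η ^ 2) := by positivity
    linarith
  set γ := wellTest η
  set γ' := wellTest' η
  set T : ℝ → ℝ := fun s => γ' (U s) * (ε * g s ^ 2) + deriv f (U s) * γ (U s) / ε with hT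
  have hXe : ∀ s, ε * g s ^ 2 ≤ 2 * radEnergy f ε (U s) (g s) := fun s => by
    unfold radEnergy
    have := div_nonneg (hw.nonneg (U s)) hε.le
    linarith
  have hfe : ∀ s, f (U s) / ε ≤ radEnergy f ε (U s) (g s) := fun s => by
    unfold radEnergy
    have : 0 ≤ ε * g s ^ 2 := by positivity
    linarith
  have hX0 : ∀ s, 0 ≤ ε * g s ^ 2 := fun s => by positivity
  -- lower bound for the tested energy
  have hTlow : ∀ s, 0 ≤ T s + C3 * η * radEnergy f ε (U s) (g s) := fun s => by
    have e1 : -(3 * η) * (ε * g s ^ 2) ≤ γ' (U s) * (ε * g s ^ 2) :=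
      mul_le_mul_of_nonneg_right (wellTest'_ge h0 h1 _) (hX0 s)
    have e2 : -(3 * C ^ 2 / k ^ 2 * η * f (U s)) / ε ≤ deriv f (U s) * γ (U s) / ε :=
      div_le_div_of_nonneg_right (wellTest_mul_ge hw h0 h1 hk _) hε.le
    have e3 : -(3 * C ^ 2 / k ^ 2 * η * f (U s)) / ε = -(3 * C ^ 2 / k ^ 2 * η * (f (U s) / ε)) := by
      ring
    have e4 : 3 * C ^ 2 / k ^ 2 * η * (f (U s) / ε)
        ≤ 3 * C ^ 2 / k ^ 2 * η * radEnergy f ε (U s) (g s) :=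
      mul_le_mul_of_nonneg_left (hfe s) (by positivity)
    have e5 := mul_le_mul_of_nonneg_left (hXe s) (by positivity : 0 ≤ 3 * η)
    simp only [hT, hC3]
    nlinarith
  -- A pointwise bound valid in every region: adding `C3 * η * e` makes the tested integrand
  -- nonnegative, so it can be kept where the third term alone is needed.
  have hpt : ∀ s ∈ Ioc (0 : ℝ) 1, s ^ (j + 1) * |radDisc f ε (U s) (g s)|
      ≤ s ^ (j + 1) * T s + C3 * η * (s ^ (j + 1) * radEnergy f ε (U s) (g s))
        + R * (s ^ j * radEnergy f ε (U s) (g s)) := by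
    intro s hs
    have hp := pow_nonneg hs.1.le (j + 1)
    have hpj := pow_nonneg hs.1.le j
    have hRe : 0 ≤ R * (s ^ j * radEnergy f ε (U s) (g s)) :=
      mul_nonneg hR0 (mul_nonneg hpj (hen s))
    have hTl := mul_nonneg hp (hTlow s)
    have hd := radDisc_abs_le hw.nonneg hε (U s) (g s)
    by_cases hnear : 1 - η ≤ |U s|
    · obtain ⟨n1, n2⟩ := wellTest_near hw h0 h1 hk hnear
      have e1 : ε * g s ^ 2 ≤ γ' (U s) * (ε * g s ^ 2) := le_mul_of_one_le_left (hX0 s) n1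
      have e2 : f (U s) / ε ≤ deriv f (U s) * γ (U s) / ε := div_le_div_of_nonneg_right n2 hε.le
      have e3 : radEnergy f ε (U s) (g s) ≤ T s := by
        simp only [hT]
        unfold radEnergy
        linarith [hX0 s]
      have e4 := mul_le_mul_of_nonneg_left (hd.trans e3) hp
      have e5 : 0 ≤ C3 * η * (s ^ (j + 1) * radEnergy f ε (U s) (g s)) :=
        mul_nonneg (by positivity) (mul_nonneg hp (hen s))
      linarith
    · push Not at hnear
      suffices hs2 : s ^ (j + 1) * |radDisc f ε (U s) (g s)|
          ≤ R * (s ^ j * radEnergy f ε (U s) (g s)) by linarith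
      -- Below `δ` one factor of `s` is spent directly. Above `δ`, `1 ≤ C f(U)/η²` and `ε = δ · δ^j
      -- ≤ δ s^j` are used.
      rcases le_total s δ with hsδ | hsδ
      · calc _ ≤ s ^ (j + 1) * radEnergy f ε (U s) (g s) := by gcongr
          _ = s * (s ^ j * radEnergy f ε (U s) (g s)) := by ring
          _ ≤ _ := mul_le_mul_of_nonneg_right (hsδ.trans hRδ) (mul_nonneg hpj (hen s))
      · have e1 := hP.disc_le hw hs
        have e2 : 1 ≤ C / η ^ 2 * f (U s) := by
          have h3 := hw.dist_sq_le (U s)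
          rw [div_mul_eq_mul_div, le_div_iff₀ (by positivity)]
          nlinarith [abs_nonneg (U s)]
        have e3 : f (U s) ≤ ε * radEnergy f ε (U s) (g s) := by
          have := hfe s
          rw [div_le_iff₀ hε] at this
          linarith
        have e4 : δ ^ j ≤ s ^ j := pow_le_pow_left₀ hδ.le hsδ _
        calc _ ≤ 2 * G := e1
          _ ≤ 2 * G * (C / η ^ 2 * f (U s)) := le_mul_of_one_le_right (by positivity) e2
          _ ≤ 2 * G * (C / η ^ 2 * (ε * radEnergy f ε (U s) (g s))) := by gcongr
          _ = δ * (2 * G * (C / η ^ 2)) * (δ ^ j * radEnergy f ε (U s) (g s)) := by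
              rw [← hδε]; ring
          _ ≤ δ * (2 * G * (C / η ^ 2)) * (s ^ j * radEnergy f ε (U s) (g s)) := by
              have := hen s
              gcongr
          _ ≤ _ := by
              refine mul_le_mul_of_nonneg_right ?_ (mul_nonneg hpj (hen s))
              rw [hR]
              linarith
  have hsq : ∀ s, γ (U s) ^ 2 ≤ 9 * C * (ε * radEnergy f ε (U s) (g s)) := fun s => by
    refine (wellTest_sq_le hw h0 h1 (U s)).trans ?_
    have := hfe s
    rw [div_le_iff₀ hε] at this
    rw [mul_comm ε]
    gcongr
  have hmγ : ∀ b ∈ Ioc (0 : ℝ) 1, ∫ s in b..1, s ^ (j + 1) * (m s * γ (U s))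
      ≤ ε * ((|m 1| + 2 * N) ^ 2 / (2 * η)) + η * (9 / 2 * C * E) := by
    intro b hb
    have ii := fun {F : ℝ → ℝ} (hF : ContinuousOn F (Ioc 0 1)) =>
      intervalIntegrable_of_continuousOn_Ioc hF hb.1 hb.2 le_rfl
    have hc2 : ContinuousOn (fun s => s ^ (j + 1) * (m s * γ (U s))) (Ioc 0 1) :=
      (continuous_pow _).continuousOn.mul (hP.m_cont.mul (hP.cont_comp (continuous_wellTest η)))
    have hA : 0 ≤ ε * ((|m 1| + 2 * N) ^ 2 / (2 * η)) := by positivity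
    have hmono : ∫ s in b..1, s ^ (j + 1) * (m s * γ (U s)) ≤ ∫ s in b..1,
        (ε * ((|m 1| + 2 * N) ^ 2 / (2 * η))
          + η * (9 / 2 * C) * (s ^ (j + 1) * radEnergy f ε (U s) (g s))) := by
      refine intervalIntegral.integral_mono_on hb.2 (ii hc2)
        ((by simp : IntervalIntegrable (fun _ => ε * ((|m 1| + 2 * N) ^ 2 / (2 * η)))
          volume b 1).add ((hP.ii_energy hw _ hb.1 hb.2 le_rfl).const_mul _)) fun s hs => ?_
      have hs' : s ∈ Ioc (0 : ℝ) 1 := ⟨hb.1.trans_le hs.1, hs.2⟩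
      have hp := pow_nonneg hs'.1.le (j + 1)
      have e1 : s ^ (j + 1) * m s ^ 2 ≤ (|m 1| + 2 * N) ^ 2 := by
        have := (hP.m_le hs').trans
          (mul_le_of_le_one_right (by positivity) (fourth_root_le_one hs'.2))
        have h2 := pow_le_pow_left₀ (by positivity) this 2
        rw [mul_pow, sq_abs, Real.sq_sqrt hp] at h2
        linarith
      -- The first term is small by the weighted bound of `m`; the second is `O(η)` times the
      -- energy, since `γ²` is controlled by `f`.
      have e2 : m s * γ (U s) ≤ ε * m s ^ 2 / (2 * η) + η * γ (U s) ^ 2 / (2 * ε) := by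
        have e : ε * m s ^ 2 / (2 * η) + η * γ (U s) ^ 2 / (2 * ε) - m s * γ (U s)
            = (ε * m s - η * γ (U s)) ^ 2 / (2 * η * ε) := by
          field_simp; ring
        have : 0 ≤ (ε * m s - η * γ (U s)) ^ 2 / (2 * η * ε) := by positivity
        linarith
      have e3 : η * γ (U s) ^ 2 / (2 * ε) ≤ η * (9 / 2 * C) * radEnergy f ε (U s) (g s) := by
        rw [div_le_iff₀ (by positivity)]
        have := mul_le_mul_of_nonneg_left (hsq s) h0.le
        linarith
      have e4 : s ^ (j + 1) * (ε * m s ^ 2 / (2 * η)) ≤ ε * ((|m 1| + 2 * N) ^ 2 / (2 * η)) := by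
        calc _ = ε * ((s ^ (j + 1) * m s ^ 2) / (2 * η)) := by ring
          _ ≤ _ := by gcongr
      have e5 := mul_le_mul_of_nonneg_left (e2.trans (add_le_add_right e3 _)) hp
      linarith
    refine hmono.trans ?_
    rw [intervalIntegral.integral_add (by simp) ((hP.ii_energy hw _ hb.1 hb.2 le_rfl).const_mul _),
      intervalIntegral.integral_const, intervalIntegral.integral_const_mul, smul_eq_mul]
    have e1 := hP.energy_le b hb
    have e2 : (1 - b) * (ε * ((|m 1| + 2 * N) ^ 2 / (2 * η)))
        ≤ ε * ((|m 1| + 2 * N) ^ 2 / (2 * η)) := mul_le_of_le_one_left hA (by linarith [hb.1])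
    have e3 : η * (9 / 2 * C) * (∫ s in b..1, s ^ (j + 1) * radEnergy f ε (U s) (g s))
        ≤ η * (9 / 2 * C) * E := by gcongr
    linarith
  have hcD : ContinuousOn (fun s => s ^ (j + 1) * |radDisc f ε (U s) (g s)|) (Ioc 0 1) :=
    (continuous_pow _).continuousOn.mul (hP.cont_disc hw).abs
  have hcT : ContinuousOn (fun s => s ^ (j + 1) * T s) (Ioc 0 1) :=
    (continuous_pow _).continuousOn.mul
      (((hP.cont_comp (continuous_wellTest' η)).mul (continuousOn_const.mul (hP.g_cont.pow 2))).add
      (((hP.cont_comp hw.cont_deriv).mul (hP.cont_comp (continuous_wellTest η))).div_const ε))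
  refine le_of_forall_small (K := 10 * C * B) (by positivity) fun b0 hb0 => ?_
  -- move the left endpoint towards the origin
  have hb : min a b0 ∈ Ioc (0 : ℝ) 1 := ⟨lt_min ha.1 hb0.1, (min_le_left _ _).trans ha.2⟩
  have hba : min a b0 ≤ a := min_le_left _ _
  have hbb : min a b0 ≤ b0 := min_le_right _ _
  set b := min a b0
  have ii := fun {F : ℝ → ℝ} (hF : ContinuousOn F (Ioc 0 1)) =>
    intervalIntegrable_of_continuousOn_Ioc hF hb.1 hb.2 le_rfl
  have i1 := hP.ii_energy hw (j + 1) hb.1 hb.2 le_rfl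
  have i2 := hP.ii_energy hw j hb.1 hb.2 le_rfl
  have s1 : ∫ s in a..1, s ^ (j + 1) * |radDisc f ε (U s) (g s)|
      ≤ ∫ s in b..1, s ^ (j + 1) * |radDisc f ε (U s) (g s)| :=
    intervalIntegral_mono_left hba (ii hcD) ha.2 fun s hs =>
      mul_nonneg (pow_nonneg (hb.1.le.trans hs.1.le) _) (abs_nonneg _)
  have s2 : ∫ s in b..1, s ^ (j + 1) * |radDisc f ε (U s) (g s)|
      ≤ ∫ s in b..1, (s ^ (j + 1) * T s + C3 * η * (s ^ (j + 1) * radEnergy f ε (U s) (g s))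
        + R * (s ^ j * radEnergy f ε (U s) (g s))) :=
    intervalIntegral.integral_mono_on hb.2 (ii hcD)
      (((ii hcT).add (i1.const_mul _)).add (i2.const_mul _))
      fun s hs => hpt s ⟨hb.1.trans_le hs.1, hs.2⟩
  rw [intervalIntegral.integral_add ((ii hcT).add (i1.const_mul _)) (i2.const_mul _),
    intervalIntegral.integral_add (ii hcT) (i1.const_mul _), intervalIntegral.integral_const_mul,
    intervalIntegral.integral_const_mul,
    hP.tested_identity hw (hasDerivAt_wellTest η) (continuous_wellTest' η) hb] at s2
  have s3 := hmγ b hb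
  -- The boundary term at the inner radius is bounded by the weighted energy density there, which is
  -- `O(b)`.
  have s4 : -(ε * (b ^ (j + 1) * g b * γ (U b))) ≤ 10 * C * B * b0 := by
    have e0 := hB b hb
    have e1 := hsq b
    have e2 := hXe b
    have hp := pow_nonneg hb.1.le (j + 1)
    have e3 : -(ε * (g b * γ (U b))) ≤ 10 * C * radEnergy f ε (U b) (g b) := by
      have h3 := hen b
      have h4 : γ (U b) ^ 2 ≤ 9 * C * radEnergy f ε (U b) (g b) := by
        refine e1.trans ?_
        gcongr
        exact mul_le_of_le_one_left h3 hε1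
      have h5 : ε ^ 2 * g b ^ 2 ≤ 2 * radEnergy f ε (U b) (g b) := by
        refine le_trans ?_ e2
        have := hX0 b
        nlinarith
      have h6 : 0 ≤ ε ^ 2 * g b ^ 2 + 2 * (ε * (g b * γ (U b))) + γ (U b) ^ 2 :=
        (sq_nonneg (ε * g b + γ (U b))).trans_eq (by ring)
      have h7 : radEnergy f ε (U b) (g b) ≤ C * radEnergy f ε (U b) (g b) :=
        le_mul_of_one_le_left h3 hC
      linarith
    calc -(ε * (b ^ (j + 1) * g b * γ (U b))) = b ^ (j + 1) * -(ε * (g b * γ (U b))) := by ring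
      _ ≤ b ^ (j + 1) * (10 * C * radEnergy f ε (U b) (g b)) := by gcongr
      _ = 10 * C * (b ^ (j + 1) * radEnergy f ε (U b) (g b)) := by ring
      _ ≤ 10 * C * (B * b0) := by
          have : B * b ≤ B * b0 := by gcongr
          have := e0.trans this
          gcongr
      _ = _ := by ring
  have s5 : C3 * η * (∫ s in b..1, s ^ (j + 1) * radEnergy f ε (U s) (g s)) ≤ C3 * η * E := by
    have := hP.energy_le b hb
    gcongr
  have s6 : R * (∫ s in b..1, s ^ j * radEnergy f ε (U s) (g s)) ≤ R * G := by
    refine mul_le_mul_of_nonneg_left ?_ hR0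
    refine le_trans ?_ (hP.density_le hw hb)
    refine le_mul_of_one_le_left (intervalIntegral.integral_nonneg hb.2 fun s hs =>
      mul_nonneg (pow_nonneg (hb.1.le.trans hs.1) _) (hen s)) ?_
    push_cast
    linarith [(Nat.cast_nonneg j : (0 : ℝ) ≤ j)]
  have s7 : ε * ((|m 1| + 2 * N) ^ 2 / (2 * η)) ≤ δ * ((|m 1| + 2 * N) ^ 2 / (2 * η)) := by
    gcongr
  have e8 : η * ((9 / 2 * C + 6 + 3 * C ^ 2 / k ^ 2) * E) = η * (9 / 2 * C * E) + C3 * η * E := by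
    rw [hC3]; ring
  have e9 : δ * ((|m 1| + 2 * N) ^ 2 / (2 * η) + (1 + 2 * G * (C / η ^ 2)) * G)
      = δ * ((|m 1| + 2 * N) ^ 2 / (2 * η)) + R * G := by
    rw [hR]; ring
  rw [e8, e9]
  linarith

end Profile

/-- The discrepancy of a radial profile is small, with constants that depend only on the potential,
the energy bound and the mean value. -/
theorem exists_disc_bound {f : ℝ → ℝ} {k C : ℝ} (hw : DoubleWell f k C) {E cbar : ℝ}
    (hE : 0 ≤ E) (hc : |cbar| < 1) {θ : ℝ} (hθ : 0 < θ) :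
    ∃ K, 0 ≤ K ∧ ∃ ε₀, 0 < ε₀ ∧ ∀ (j : ℕ) (ε δ N : ℝ) (U g m q : ℝ → ℝ), ε ≤ ε₀ → 0 < δ →
      δ ^ (j + 1) = ε → Profile j f ε E N U g m q →
      ∫ s in (0 : ℝ)..1, s ^ (j + 1) * U s = cbar / ((j : ℝ) + 2) →
      ∀ a ∈ Ioc (0 : ℝ) 1, ∫ s in a..1, s ^ (j + 1) * |radDisc f ε (U s) (g s)|
        ≤ θ + K * δ * N ^ 2 := by
  have hC := hw.one_le
  have hc2 : 0 < 1 - cbar ^ 2 := by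
    have := (sq_lt_one_iff_abs_lt_one cbar).2 hc
    linarith
  have hkp := hw.k_pos
  set A := (9 / 2 * C + 6 + 3 * C ^ 2 / k ^ 2) * E with hA
  have hA0 : 0 ≤ A := by positivity
  -- `η` depends on `θ`, the potential and the energy bound only; after this choice negative powers
  -- of `η` are part of `K`.
  set η := min (min (1 / 3) k) (θ / (A + 1)) with hη
  have h0 : 0 < η := lt_min (lt_min (by norm_num) hkp) (by positivity)
  have h1 : η ≤ 1 / 3 := (min_le_left _ _).trans (min_le_left _ _)
  have hk : η ≤ k := (min_le_left _ _).trans (min_le_right _ _)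
  have hηA : η * A ≤ θ := by
    calc η * A ≤ θ / (A + 1) * (A + 1) := by
          gcongr
          · exact min_le_right _ _
          · linarith
      _ = θ := by field_simp
  have hcU := supBound_nonneg C E
  set Λ := 6 * (5 * supBound C E + 6 * E) / (1 - cbar ^ 2) with hΛ
  have hΛ0 : 0 ≤ Λ := by positivity
  set G0 := 12 * E + 11 * supBound C E * (Λ + 2) with hG0
  have hG00 : 0 ≤ G0 := by positivity
  refine ⟨(Λ + 2) ^ 2 / (2 * η) + (1 + 2 * G0 * (C / η ^ 2)) * G0, by positivity,
    ((1 - cbar ^ 2) / 8) ^ 2 / (3 * C * E + 1), by positivity, ?_⟩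
  intro j ε δ N U g m q hε₀ hδ hδε hP hmass a ha
  have hN := hP.N_ge
  have hsmall : 3 * C * E * ε ≤ ((1 - cbar ^ 2) / 8) ^ 2 := by
    rw [le_div_iff₀ (by positivity)] at hε₀
    have := hP.eps_pos
    linarith
  have hm := hP.m_one_le hw hc hmass hsmall
  refine (hP.integral_disc_le_aux hw h0 h1 hk hδ hδε ha).trans ?_
  -- From here every bound is linear in `N`, so the final one, containing the square of the density
  -- bound, is quadratic, as the dissipation permits.
  have hM : |m 1| + 2 * N ≤ (Λ + 2) * N := by rw [hΛ] at *; linarith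
  have hM0 : 0 ≤ |m 1| + 2 * N := by positivity
  have hG : Profile.densityBound C E N (m 1) ≤ G0 * N := by
    unfold Profile.densityBound
    have e1 : 12 * E ≤ 12 * E * N := le_mul_of_one_le_right (by positivity) hN
    have e2 : 11 * supBound C E * (|m 1| + 2 * N) ≤ 11 * supBound C E * ((Λ + 2) * N) := by gcongr
    rw [hG0]
    linarith
  have hGn : 0 ≤ Profile.densityBound C E N (m 1) := by
    unfold Profile.densityBound
    positivity
  set G := Profile.densityBound C E N (m 1)
  have e1 : (|m 1| + 2 * N) ^ 2 / (2 * η) ≤ (Λ + 2) ^ 2 / (2 * η) * N ^ 2 := by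
    rw [div_mul_eq_mul_div, ← mul_pow]
    gcongr
  have hN2 : N ≤ N ^ 2 := by nlinarith
  have e2 : (1 + 2 * G * (C / η ^ 2)) * G ≤ (1 + 2 * G0 * (C / η ^ 2)) * G0 * N ^ 2 := by
    have h3 : G ^ 2 ≤ G0 ^ 2 * N ^ 2 := by
      rw [← mul_pow]; gcongr
    have h4 : G ≤ G0 * N ^ 2 := hG.trans (by gcongr)
    have h5 : 0 ≤ 2 * (C / η ^ 2) := by positivity
    have h6 := mul_le_mul_of_nonneg_left h3 h5
    calc (1 + 2 * G * (C / η ^ 2)) * G = G + 2 * (C / η ^ 2) * G ^ 2 := by ring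
      _ ≤ G0 * N ^ 2 + 2 * (C / η ^ 2) * (G0 ^ 2 * N ^ 2) := add_le_add h4 h6
      _ = _ := by ring
  have e3 := mul_le_mul_of_nonneg_left (add_le_add e1 e2) hδ.le
  calc _ ≤ θ + δ * ((Λ + 2) ^ 2 / (2 * η) * N ^ 2
        + (1 + 2 * G0 * (C / η ^ 2)) * G0 * N ^ 2) := add_le_add hηA e3
    _ = _ := by ring

/-! ### Polar coordinates -/

instance isFiniteMeasure_restrict_ball (d : ℕ) (r : ℝ) :
    IsFiniteMeasure (volume.restrict (Metric.ball (0 : E d) r)) :=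
  ⟨by rw [Measure.restrict_apply_univ]; exact measure_ball_lt_top⟩

/-- The surface measure of the unit sphere. -/
noncomputable def sphMeas (d : ℕ) : Measure (Metric.sphere (0 : E d) 1) :=
  (volume : Measure (E d)).toSphere

instance isFiniteMeasure_sphMeas (d : ℕ) : IsFiniteMeasure (sphMeas d) :=
  Measure.instIsFiniteMeasureElemSphereOfNatRealToSphere _

instance sFinite_sphMeas (d : ℕ) : SFinite (sphMeas d) := inferInstance

/-- The radial measure `r ^ (j + 1) dr` on `(0, 1)`. -/
noncomputable def radMeas (j : ℕ) : Measure ℝ :=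
  (volume.restrict (Ioo (0 : ℝ) 1)).withDensity fun r => ENNReal.ofReal (r ^ (j + 1))

/-- The polar coordinate map. -/
def polarMap (d : ℕ) (p : Metric.sphere (0 : E d) 1 × ℝ) : E d := p.2 • p.1.1

theorem continuous_polarMap (d : ℕ) : Continuous (polarMap d) := by
  unfold polarMap; fun_prop

theorem map_volumeIoiPow (n : ℕ) :
    (Measure.volumeIoiPow n).map ((↑) : Ioi (0 : ℝ) → ℝ)
      = (volume.restrict (Ioi (0 : ℝ))).withDensity fun r => ENNReal.ofReal (r ^ n) := by
  ext s hs
  rw [Measure.map_apply measurable_subtype_coe hs, withDensity_apply _ hs, Measure.volumeIoiPow,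
    withDensity_apply _ (measurable_subtype_coe hs),
    setLIntegral_subtype measurableSet_Ioi _ fun a : ℝ => ENNReal.ofReal (a ^ n),
    Measure.restrict_restrict hs]
  congr 2
  ext x
  simp [and_comm]

/-- The homeomorphism of the punctured space with sphere times half-line preserves measure; the
half-line is replaced by a weighted measure on `ℝ`, and the origin is a null set. -/
theorem measurePreserving_polarMap_univ (j : ℕ) :
    MeasurePreserving (polarMap (j + 2)) ((sphMeas (j + 2)).prod
      ((volume.restrict (Ioi (0 : ℝ))).withDensity fun r => ENNReal.ofReal (r ^ (j + 1))))
      volume := by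
  refine ⟨(continuous_polarMap _).measurable, ?_⟩
  have h := (volume : Measure (E (j + 2))).measurePreserving_homeomorphUnitSphereProd
  have hdim : Module.finrank ℝ (E (j + 2)) - 1 = j + 1 := by simp
  rw [hdim] at h
  have h2 : MeasurePreserving (homeomorphUnitSphereProd (E (j + 2))).symm
      ((sphMeas (j + 2)).prod (Measure.volumeIoiPow (j + 1)))
      ((volume : Measure (E (j + 2))).comap (↑)) :=
    MeasurePreserving.symm (homeomorphUnitSphereProd (E (j + 2))).toMeasurableEquiv h
  rw [← map_volumeIoiPow]
  have h3 : ((sphMeas (j + 2)).prod ((Measure.volumeIoiPow (j + 1)).map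
      ((↑) : Ioi (0 : ℝ) → ℝ)))
      = ((sphMeas (j + 2)).prod (Measure.volumeIoiPow (j + 1))).map
        (Prod.map id ((↑) : Ioi (0 : ℝ) → ℝ)) := by
    rw [← Measure.map_prod_map _ _ measurable_id measurable_subtype_coe, Measure.map_id]
  rw [h3, Measure.map_map (continuous_polarMap _).measurable
    (measurable_id.prodMap measurable_subtype_coe)]
  have h4 : polarMap (j + 2) ∘ Prod.map id ((↑) : Ioi (0 : ℝ) → ℝ)
      = ((↑) : ({0}ᶜ : Set (E (j + 2))) → E (j + 2)) ∘
        (homeomorphUnitSphereProd (E (j + 2))).symm := by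
    ext p
    simp [polarMap]
  rw [h4, ← Measure.map_map measurable_subtype_coe (Homeomorph.measurable _), h2.map_eq,
    map_comap_subtype_coe (measurableSet_singleton _).compl, restrict_compl_singleton]

theorem measurePreserving_polarMap (j : ℕ) :
    MeasurePreserving (polarMap (j + 2)) ((sphMeas (j + 2)).prod (radMeas j))
      (volume.restrict (Metric.ball 0 1)) := by
  have h := (measurePreserving_polarMap_univ j).restrict_preimage
    (s := Metric.ball (0 : E (j + 2)) 1) measurableSet_ball
  have e : polarMap (j + 2) ⁻¹' Metric.ball 0 1 = univ ×ˢ Ioo (-1) 1 := by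
    ext ⟨y, r⟩
    simp [polarMap, norm_smul, abs_lt]
  rw [e, ← Measure.prod_restrict, Measure.restrict_univ, restrict_withDensity measurableSet_Ioo,
    Measure.restrict_restrict measurableSet_Ioo] at h
  have e2 : Ioo (-1 : ℝ) 1 ∩ Ioi 0 = Ioo 0 1 := by
    ext x; simp only [mem_inter_iff, mem_Ioo, mem_Ioi]; constructor
    · rintro ⟨⟨_, h1⟩, h2⟩; exact ⟨h2, h1⟩
    · rintro ⟨h1, h2⟩; exact ⟨⟨by linarith, h2⟩, h1⟩
  rw [e2] at h
  exact h

instance (j : ℕ) : SigmaFinite (radMeas j) := by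
  unfold radMeas
  exact SigmaFinite.withDensity_ofReal _

theorem radMeas_ae_iff {j : ℕ} {p : ℝ → Prop} :
    (∀ᵐ r ∂radMeas j, p r) ↔ ∀ᵐ r ∂volume.restrict (Ioo (0 : ℝ) 1), p r := by
  unfold radMeas
  rw [ae_withDensity_iff (by fun_prop)]
  refine ⟨fun h => ?_, fun h => h.mono fun r hr _ => hr⟩
  filter_upwards [h, ae_restrict_mem measurableSet_Ioo] with r hr hr0
  exact hr (ENNReal.ofReal_pos.2 (pow_pos hr0.1 _)).ne'

theorem integral_radMeas (j : ℕ) (h : ℝ → ℝ) :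
    ∫ r, h r ∂radMeas j = ∫ r in Ioo (0 : ℝ) 1, r ^ (j + 1) * h r := by
  unfold radMeas
  rw [integral_withDensity_eq_integral_toReal_smul (by fun_prop) (by simp)]
  refine setIntegral_congr_fun measurableSet_Ioo fun r hr => ?_
  simp only [smul_eq_mul]
  rw [ENNReal.toReal_ofReal (pow_nonneg hr.1.le _)]

theorem integrable_radMeas_iff (j : ℕ) (h : ℝ → ℝ) :
    Integrable h (radMeas j) ↔ IntegrableOn (fun r => r ^ (j + 1) * h r) (Ioo 0 1) := by
  unfold radMeas
  rw [integrable_withDensity_iff_integrable_smul' (by fun_prop) (by simp)]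
  refine integrableOn_congr_fun (fun r hr => ?_) measurableSet_Ioo
  simp only [smul_eq_mul]
  rw [ENNReal.toReal_ofReal (pow_nonneg hr.1.le _)]

/-- The area of the unit sphere. -/
noncomputable def sphArea (d : ℕ) : ℝ := (sphMeas d).real univ

theorem sphArea_pos (j : ℕ) : 0 < sphArea (j + 2) := by
  unfold sphArea
  refine ENNReal.toReal_pos ?_ (measure_ne_top _ _)
  rw [Ne, Measure.measure_univ_eq_zero]
  exact Measure.toSphere_ne_zero _

theorem norm_polarMap {d : ℕ} (y : Metric.sphere (0 : E d) 1) {r : ℝ} (hr : 0 ≤ r) :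
    ‖polarMap d (y, r)‖ = r := by
  simp [polarMap, norm_smul, abs_of_nonneg hr]

/-- The spherical average of a function. -/
noncomputable def sphAvg {d : ℕ} (F : E d → ℝ) (r : ℝ) : ℝ :=
  (∫ y, F (polarMap d (y, r)) ∂sphMeas d) / sphArea d

theorem ae_polar {j : ℕ} {p : E (j + 2) → Prop}
    (h : ∀ᵐ x ∂volume.restrict (Metric.ball 0 1), p x) :
    ∀ᵐ r ∂volume.restrict (Ioo (0 : ℝ) 1), ∀ᵐ y ∂sphMeas (j + 2), p (polarMap _ (y, r)) := by
  have h1 := (measurePreserving_polarMap j).quasiMeasurePreserving.ae h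
  have h2 := (Measure.measurePreserving_swap (μ := radMeas j)
    (ν := sphMeas (j + 2))).quasiMeasurePreserving.ae h1
  exact radMeas_ae_iff.1 (Measure.ae_ae_of_ae_prod h2)

/-- The preimage under the norm of a null set of radii is, in polar coordinates, contained in sphere
times that set up to a null set. -/
theorem ae_norm {j : ℕ} {p : ℝ → Prop} (h : ∀ᵐ r ∂volume.restrict (Ioo (0 : ℝ) 1), p r) :
    ∀ᵐ x : E (j + 2) ∂volume.restrict (Metric.ball 0 1), p ‖x‖ := by
  have hq : Measure.QuasiMeasurePreserving (fun x : E (j + 2) => ‖x‖)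
      (volume.restrict (Metric.ball 0 1)) (radMeas j) := by
    refine ⟨measurable_norm, ?_⟩
    refine Measure.AbsolutelyContinuous.mk fun s hs h0 => ?_
    rw [Measure.map_apply measurable_norm hs,
      ← (measurePreserving_polarMap j).measure_preimage (measurable_norm hs).nullMeasurableSet]
    have h1 : ((sphMeas (j + 2)).prod (radMeas j)) (univ ×ˢ s) = 0 := by
      rw [Measure.prod_prod, h0, mul_zero]
    have h3 : ∀ᵐ p ∂((sphMeas (j + 2)).prod (radMeas j)), p.2 ∈ Ioo (0 : ℝ) 1 := by
      have : ∀ᵐ r ∂radMeas j, r ∈ Ioo (0 : ℝ) 1 :=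
        radMeas_ae_iff.2 (ae_restrict_mem measurableSet_Ioo)
      exact Measure.quasiMeasurePreserving_snd.ae this
    refine measure_mono_null_ae ?_ h1
    filter_upwards [h3] with p hp hps
    refine ⟨mem_univ _, ?_⟩
    have : ‖polarMap (j + 2) (p.1, p.2)‖ ∈ s := hps
    rwa [norm_polarMap _ hp.1.le] at this
  exact hq.ae (radMeas_ae_iff.2 h)

theorem integrable_polar {j : ℕ} {F : E (j + 2) → ℝ} (hF : IntegrableOn F (Metric.ball 0 1)) :
    Integrable (fun p => F (polarMap (j + 2) p)) ((sphMeas (j + 2)).prod (radMeas j)) :=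
  (measurePreserving_polarMap j).integrable_comp_of_integrable hF

theorem integrable_sphAvg {j : ℕ} {F : E (j + 2) → ℝ} (hF : IntegrableOn F (Metric.ball 0 1)) :
    IntegrableOn (fun r => r ^ (j + 1) * sphAvg F r) (Ioo 0 1) := by
  rw [← integrable_radMeas_iff]
  exact (integrable_polar hF).integral_prod_right.div_const _

theorem integral_ball_eq {j : ℕ} {F : E (j + 2) → ℝ} (hF : IntegrableOn F (Metric.ball 0 1)) :
    ∫ x in Metric.ball 0 1, F x
      = sphArea (j + 2) * ∫ r in Ioo (0 : ℝ) 1, r ^ (j + 1) * sphAvg F r := by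
  have h := (measurePreserving_polarMap j)
  have h1 : ∫ x in Metric.ball 0 1, F x
      = ∫ p, F (polarMap (j + 2) p) ∂((sphMeas (j + 2)).prod (radMeas j)) := by
    rw [← h.map_eq, integral_map h.measurable.aemeasurable]
    rw [h.map_eq]
    exact hF.aestronglyMeasurable
  rw [h1, integral_prod_symm _ (integrable_polar hF), ← integral_radMeas, ← integral_const_mul]
  refine integral_congr_ae (Eventually.of_forall fun r => ?_)
  simp only [sphAvg]
  have := (sphArea_pos j).ne'
  field_simp

theorem sphAvg_mul_norm {j : ℕ} (F : E (j + 2) → ℝ) (h : ℝ → ℝ) {r : ℝ} (hr : 0 ≤ r) :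
    sphAvg (fun x => F x * h ‖x‖) r = sphAvg F r * h r := by
  unfold sphAvg
  simp only [norm_polarMap _ hr]
  rw [integral_mul_const]
  ring

theorem sphAvg_of_ae_radial {j : ℕ} {F : E (j + 2) → ℝ} {h : ℝ → ℝ}
    (hF : ∀ᵐ x ∂volume.restrict (Metric.ball 0 1), F x = h ‖x‖) :
    ∀ᵐ r ∂volume.restrict (Ioo (0 : ℝ) 1), sphAvg F r = h r := by
  filter_upwards [ae_polar hF, ae_restrict_mem measurableSet_Ioo] with r hr hr0
  unfold sphAvg
  rw [integral_congr_ae (g := fun _ => h r) (hr.mono fun y hy => by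
    simp only [hy, norm_polarMap y hr0.1.le])]
  rw [integral_const, smul_eq_mul]
  have := (sphArea_pos j).ne'
  change sphArea _ * _ / _ = _
  field_simp

theorem integral_ball_radial {j : ℕ} {F : E (j + 2) → ℝ} {h : ℝ → ℝ}
    (hF : IntegrableOn F (Metric.ball 0 1))
    (hr : ∀ᵐ x ∂volume.restrict (Metric.ball 0 1), F x = h ‖x‖) :
    IntegrableOn (fun r => r ^ (j + 1) * h r) (Ioo 0 1) ∧
      ∫ x in Metric.ball 0 1, F x
        = sphArea (j + 2) * ∫ r in Ioo (0 : ℝ) 1, r ^ (j + 1) * h r := by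
  have hae : (fun r => r ^ (j + 1) * sphAvg F r) =ᵐ[volume.restrict (Ioo (0 : ℝ) 1)]
      fun r => r ^ (j + 1) * h r := by
    filter_upwards [sphAvg_of_ae_radial hr] with r hr
    rw [hr]
  refine ⟨(integrable_sphAvg hF).congr hae, ?_⟩
  rw [integral_ball_eq hF, integral_congr_ae hae]

/-- On each sphere the variance is nonnegative, so the square of the average is at most the average
of the square. -/
theorem sphAvg_sq_le {j : ℕ} {F : E (j + 2) → ℝ} (hF : MemLp F 2 (volume.restrict (Metric.ball 0 1))) :
    IntegrableOn (fun r => r ^ (j + 1) * sphAvg F r ^ 2) (Ioo 0 1) ∧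
      sphArea (j + 2) * ∫ r in Ioo (0 : ℝ) 1, r ^ (j + 1) * sphAvg F r ^ 2
        ≤ ∫ x in Metric.ball 0 1, F x ^ 2 := by
  have hF1 : IntegrableOn F (Metric.ball 0 1) := hF.integrable (by norm_num)
  have hF2 : IntegrableOn (fun x => F x ^ 2) (Metric.ball 0 1) := hF.integrable_sq
  have hle : ∀ᵐ r ∂volume.restrict (Ioo (0 : ℝ) 1),
      r ^ (j + 1) * sphAvg F r ^ 2 ≤ r ^ (j + 1) * sphAvg (fun x => F x ^ 2) r := by
    have h1 : ∀ᵐ r ∂radMeas j, Integrable (fun y => F (polarMap (j + 2) (y, r))) (sphMeas (j + 2)) :=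
      (integrable_polar hF1).prod_left_ae
    have h2 : ∀ᵐ r ∂radMeas j, Integrable (fun y => F (polarMap (j + 2) (y, r)) ^ 2)
      (sphMeas (j + 2)) := (integrable_polar hF2).prod_left_ae
    filter_upwards [radMeas_ae_iff.1 h1, radMeas_ae_iff.1 h2, ae_restrict_mem measurableSet_Ioo]
      with r hr1 hr2 hr
    refine mul_le_mul_of_nonneg_left ?_ (pow_nonneg hr.1.le _)
    have hσ := sphArea_pos j
    set A := sphAvg F r with hA
    have hA' : ∫ y, F (polarMap (j + 2) (y, r)) ∂sphMeas (j + 2) = sphArea (j + 2) * A := by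
      rw [hA]; unfold sphAvg; field_simp
    have h0 : 0 ≤ ∫ y, (F (polarMap (j + 2) (y, r)) - A) ^ 2 ∂sphMeas (j + 2) :=
      integral_nonneg fun y => sq_nonneg _
    have e : ∫ y, (F (polarMap (j + 2) (y, r)) - A) ^ 2 ∂sphMeas (j + 2)
        = (∫ y, F (polarMap (j + 2) (y, r)) ^ 2 ∂sphMeas (j + 2)) - sphArea (j + 2) * A ^ 2 := by
      have e1 : ∀ y, (F (polarMap (j + 2) (y, r)) - A) ^ 2
          = F (polarMap (j + 2) (y, r)) ^ 2 - 2 * A * F (polarMap (j + 2) (y, r)) + A ^ 2 :=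
        fun y => by ring
      simp only [e1]
      rw [integral_add (f := fun y => F (polarMap (j + 2) (y, r)) ^ 2
          - 2 * A * F (polarMap (j + 2) (y, r))) (hr2.sub (hr1.const_mul _)) (integrable_const _),
        integral_sub hr2 (hr1.const_mul _), integral_const_mul, hA', integral_const, smul_eq_mul]
      change _ - _ + sphArea _ * _ = _
      ring
    rw [e] at h0
    unfold sphAvg
    rw [le_div_iff₀ hσ]
    linarith
  have hmeas : AEStronglyMeasurable (sphAvg F) (volume.restrict (Ioo (0 : ℝ) 1)) := by
    have h1 := integrable_sphAvg hF1
    have h2 : AEStronglyMeasurable (fun r : ℝ => (r ^ (j + 1))⁻¹ * (r ^ (j + 1) * sphAvg F r))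
        (volume.restrict (Ioo (0 : ℝ) 1)) :=
      (by fun_prop : Measurable fun r : ℝ => (r ^ (j + 1))⁻¹).aestronglyMeasurable.mul
        h1.aestronglyMeasurable
    refine h2.congr ?_
    filter_upwards [ae_restrict_mem measurableSet_Ioo] with r hr
    have : r ^ (j + 1) ≠ 0 := (pow_pos hr.1 _).ne'
    field_simp
  have hint : IntegrableOn (fun r => r ^ (j + 1) * sphAvg F r ^ 2) (Ioo 0 1) := by
    refine Integrable.mono' (integrable_sphAvg hF2)
      (((continuous_pow (j + 1)).measurable.aestronglyMeasurable).mul (hmeas.pow 2)) ?_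
    filter_upwards [hle, ae_restrict_mem measurableSet_Ioo] with r hr hr0
    rw [Real.norm_eq_abs, abs_of_nonneg (mul_nonneg (pow_nonneg hr0.1.le _) (sq_nonneg _))]
    exact hr
  refine ⟨hint, ?_⟩
  rw [integral_ball_eq hF2]
  exact mul_le_mul_of_nonneg_left (integral_mono_ae hint (integrable_sphAvg hF2) hle)
    (sphArea_pos j).le

/-! ### Weak derivatives in one variable -/

theorem exists_Ioo_of_isCompact {K : Set ℝ} (hK : IsCompact K) (h : K ⊆ Ioo 0 1) :
    ∃ a b : ℝ, 0 < a ∧ a < b ∧ b < 1 ∧ K ⊆ Ioo a b := by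
  rcases K.eq_empty_or_nonempty with rfl | hne
  · exact ⟨1 / 4, 3 / 4, by norm_num, by norm_num, by norm_num, empty_subset _⟩
  · have ha := h (hK.sInf_mem hne)
    have hb := h (hK.sSup_mem hne)
    have hab : sInf K ≤ sSup K := csInf_le_csSup hne hK.bddBelow hK.bddAbove
    refine ⟨sInf K / 2, (sSup K + 1) / 2, by linarith [ha.1], by linarith [ha.1, hb.2],
      by linarith [hb.2], fun x hx => ⟨?_, ?_⟩⟩
    · linarith [csInf_le hK.bddBelow hx, ha.1]
    · linarith [le_csSup hK.bddAbove hx, hb.2]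

theorem tsupport_subset_of_forall {k : ℝ → ℝ} {a b : ℝ} (h : ∀ r, r ∉ Icc a b → k r = 0) :
    tsupport k ⊆ Icc a b :=
  closure_minimal (fun r hr => by
    by_contra hc
    exact hr (h r hc)) isClosed_Icc

theorem hasCompactSupport_of_forall {k : ℝ → ℝ} {a b : ℝ} (h : ∀ r, r ∉ Icc a b → k r = 0) :
    HasCompactSupport k :=
  HasCompactSupport.intro isCompact_Icc h

theorem hasDerivAt_primitive {h : ℝ → ℝ} (hh : Continuous h) (r : ℝ) :
    HasDerivAt (fun r => ∫ s in (0 : ℝ)..r, h s) (h r) r :=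
  intervalIntegral.integral_hasDerivAt_right (hh.intervalIntegrable _ _)
    (hh.stronglyMeasurableAtFilter _ _) hh.continuousAt

theorem deriv_primitive {h : ℝ → ℝ} (hh : Continuous h) :
    deriv (fun r => ∫ s in (0 : ℝ)..r, h s) = h :=
  funext fun r => (hasDerivAt_primitive hh r).deriv

theorem contDiff_primitive {h : ℝ → ℝ} (hh : ContDiff ℝ ∞ h) :
    ContDiff ℝ ∞ fun r => ∫ s in (0 : ℝ)..r, h s := by
  rw [contDiff_infty_iff_deriv, deriv_primitive hh.continuous]
  exact ⟨fun r => (hasDerivAt_primitive hh.continuous r).differentiableAt, hh⟩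

theorem primitive_eq_zero {h : ℝ → ℝ} {a b r : ℝ} (ha : 0 < a)
    (h0 : ∀ r, r ∉ Icc a b → h r = 0) (hr : r ≤ a) : ∫ s in (0 : ℝ)..r, h s = 0 := by
  rw [intervalIntegral.integral_congr_ae (g := fun _ => 0), intervalIntegral.integral_zero]
  have : ∀ᵐ x : ℝ, x ≠ a := by simp [ae_iff]
  filter_upwards [this] with x hx hxr
  refine h0 x fun hc => hx ?_
  rcases mem_uIoc.1 hxr with h1 | h1
  · exact le_antisymm (h1.2.trans hr) hc.1
  · linarith [hc.1, h1.2]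

theorem primitive_eq_integral {h : ℝ → ℝ} {a b r : ℝ} (ha : 0 < a)
    (h0 : ∀ r, r ∉ Icc a b → h r = 0) (hr : b ≤ r) (hr0 : 0 ≤ r) :
    ∫ s in (0 : ℝ)..r, h s = ∫ s, h s := by
  rw [intervalIntegral.integral_of_le hr0]
  refine setIntegral_eq_integral_of_forall_compl_eq_zero fun x hx => h0 x fun hc => hx ?_
  exact ⟨ha.trans_le hc.1, hc.2.trans hr⟩

/-- A locally integrable function times a test function is integrable. -/
theorem integrable_mul_test {X : Type*} [TopologicalSpace X] [T2Space X] [MeasurableSpace X]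
    [BorelSpace X] {μ : Measure X} {Ω : Set X} {w k : X → ℝ} (hw : LocallyIntegrableOn w Ω μ)
    (hk : Continuous k) (hc : HasCompactSupport k) (hs : tsupport k ⊆ Ω) :
    Integrable (fun x => w x * k x) μ := by
  have h1 : IntegrableOn w (tsupport k) μ := hw.integrableOn_compact_subset hs hc
  have h2 := h1.mul_continuousOn hk.continuousOn hc
  refine (integrableOn_iff_integrable_of_support_subset fun x hx => ?_).1 h2
  refine subset_tsupport k fun h => hx ?_
  simp [h]

theorem setIntegral_mul_test {X : Type*} [TopologicalSpace X] [MeasurableSpace X]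
    {μ : Measure X} {Ω : Set X} {w k : X → ℝ} (hs : tsupport k ⊆ Ω) :
    ∫ x in Ω, w x * k x ∂μ = ∫ x, w x * k x ∂μ :=
  setIntegral_eq_integral_of_forall_compl_eq_zero fun x hx => by
    rw [image_eq_zero_of_notMem_tsupport fun h => hx (hs h), mul_zero]

theorem tsupport_deriv_subset' {k : ℝ → ℝ} : tsupport (deriv k) ⊆ tsupport k :=
  closure_minimal (support_deriv_subset (f := k)) (isClosed_tsupport k)

/-- A locally integrable function on `(0, 1)` with vanishing weak derivative is constant. -/
theorem ae_const_of_weak_deriv_zero {v : ℝ → ℝ} (hv : LocallyIntegrableOn v (Ioo 0 1))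
    (h : ∀ k : ℝ → ℝ, ContDiff ℝ ∞ k → HasCompactSupport k → tsupport k ⊆ Ioo 0 1 →
      ∫ r, v r * deriv k r = 0) :
    ∃ c0, ∀ᵐ r ∂volume.restrict (Ioo (0 : ℝ) 1), v r = c0 := by
  let B : ContDiffBump (1 / 2 : ℝ) := ⟨1 / 8, 1 / 4, by norm_num, by norm_num⟩
  set h0 : ℝ → ℝ := B.normed volume with hh0
  have hts : tsupport h0 ⊆ Ioo 0 1 := by
    rw [hh0, B.tsupport_normed_eq, Real.closedBall_eq_Icc]
    exact fun x hx => ⟨by linarith [hx.1], by linarith [hx.2]⟩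
  have hh0s : ContDiff ℝ ∞ h0 := B.contDiff_normed
  have hh0c : HasCompactSupport h0 := B.hasCompactSupport_normed
  have hh0i : ∫ r, h0 r = 1 := B.integral_normed
  refine ⟨∫ r, v r * h0 r, ?_⟩
  set c0 := ∫ r, v r * h0 r
  have key : ∀ᵐ r : ℝ, r ∈ Ioo (0 : ℝ) 1 → v r - c0 = 0 := by
    refine isOpen_Ioo.ae_eq_zero_of_integral_contDiff_smul_eq_zero
      (hv.sub (locallyIntegrableOn_const c0)) fun g hg hgc hgs => ?_
    set G := ∫ r, g r
    -- Subtracting a multiple of a fixed bump gives integral zero, so the primitive is compactly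
    -- supported and an admissible test function.
    set p : ℝ → ℝ := fun r => g r - G * h0 r with hp
    have hps : ContDiff ℝ ∞ p := hg.sub (contDiff_const.mul hh0s)
    have hgi : Integrable g := hg.continuous.integrable_of_hasCompactSupport hgc
    have hh0int : Integrable h0 := hh0s.continuous.integrable_of_hasCompactSupport hh0c
    obtain ⟨a, b, ha, hab, hb, hsub⟩ := exists_Ioo_of_isCompact (hgc.isCompact.union hh0c.isCompact)
      (union_subset hgs hts)
    have hp0 : ∀ r, r ∉ Icc a b → p r = 0 := fun r hr => by
      have h1 : g r = 0 := image_eq_zero_of_notMem_tsupport fun hc =>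
        hr (Ioo_subset_Icc_self (hsub (Or.inl hc)))
      have h2 : h0 r = 0 := image_eq_zero_of_notMem_tsupport fun hc =>
        hr (Ioo_subset_Icc_self (hsub (Or.inr hc)))
      simp [hp, h1, h2]
    have hpi : ∫ r, p r = 0 := by
      rw [hp, integral_sub hgi (hh0int.const_mul _), integral_const_mul, hh0i]
      simp [G]
    have hk0 : ∀ r, r ∉ Icc a b → ∫ s in (0 : ℝ)..r, p s = 0 := fun r hr => by
      rcases lt_or_ge r a with h1 | h1
      · exact primitive_eq_zero ha hp0 h1.le
      · have h2 : b ≤ r := by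
          by_contra hc
          exact hr ⟨h1, (not_le.1 hc).le⟩
        rw [primitive_eq_integral ha hp0 h2 (by linarith), hpi]
    have := h (fun r => ∫ s in (0 : ℝ)..r, p s) (contDiff_primitive hps)
      (hasCompactSupport_of_forall hk0) ((tsupport_subset_of_forall hk0).trans
        fun x hx => ⟨ha.trans_le hx.1, hx.2.trans_lt hb⟩)
    rw [deriv_primitive hps.continuous] at this
    have i1 := integrable_mul_test hv hg.continuous hgc hgs
    have i2 := integrable_mul_test hv hh0s.continuous hh0c hts
    have e1 : ∫ r, v r * p r = (∫ r, v r * g r) - G * c0 := by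
      rw [← integral_const_mul, ← integral_sub i1 (i2.const_mul G)]
      refine integral_congr_ae (Eventually.of_forall fun r => ?_)
      simp only [hp]; ring
    have e2 : ∫ r, g r • (v r - c0) = (∫ r, v r * g r) - c0 * G := by
      rw [← integral_const_mul, ← integral_sub i1 (hgi.const_mul c0)]
      refine integral_congr_ae (Eventually.of_forall fun r => ?_)
      simp only [smul_eq_mul]; ring
    rw [e2]
    linarith
  rw [ae_restrict_iff' measurableSet_Ioo]
  filter_upwards [key] with r hr hr0
  linarith [hr hr0]

theorem integral_right_add {q : ℝ → ℝ}
    (hq : ∀ a ∈ Ioc (0 : ℝ) 1, IntervalIntegrable q volume a 1) {a r : ℝ} (ha : 0 < a)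
    (hr : r ∈ Icc a 1) : (∫ s in a..r, q s) + ∫ s in r..1, q s = ∫ s in a..1, q s := by
  have h1 := hq a ⟨ha, hr.1.trans hr.2⟩
  have h2 := hq r ⟨ha.trans_le hr.1, hr.2⟩
  exact intervalIntegral.integral_add_adjacent_intervals (h1.trans h2.symm) h2

theorem continuousOn_integral_right {q : ℝ → ℝ}
    (hq : ∀ a ∈ Ioc (0 : ℝ) 1, IntervalIntegrable q volume a 1) :
    ContinuousOn (fun r => ∫ s in r..1, q s) (Ioc 0 1) := by
  intro r hr
  have h1 : ContinuousOn (fun x => ∫ s in x..1, q s) (Icc (r / 2) 1) := by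
    have hi := (hq (r / 2) ⟨by linarith [hr.1], by linarith [hr.1, hr.2]⟩)
    have h2 := (hi.absolutelyContinuousOnInterval_intervalIntegral (c := 1) (by simp)).continuousOn
    rw [uIcc_of_le (by linarith [hr.1, hr.2])] at h2
    refine h2.neg.congr fun x _ => ?_
    simp [intervalIntegral.integral_symm x 1]
  refine (h1 r ⟨by linarith [hr.1], hr.2⟩).mono_of_mem_nhdsWithin ?_
  have : Ioc (0 : ℝ) 1 ∩ Ioi (r / 2) ⊆ Icc (r / 2) 1 := fun x hx => ⟨le_of_lt hx.2, hx.1.2⟩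
  exact mem_of_superset (inter_mem_nhdsWithin _ (Ioi_mem_nhds (by linarith [hr.1]))) this

/-- A weakly differentiable function on `(0, 1)` is a primitive of its weak derivative. -/
theorem ae_eq_primitive_of_weak_deriv {w q : ℝ → ℝ} (hw : LocallyIntegrableOn w (Ioo 0 1))
    (hq : ∀ a ∈ Ioc (0 : ℝ) 1, IntervalIntegrable q volume a 1)
    (h : ∀ k : ℝ → ℝ, ContDiff ℝ ∞ k → HasCompactSupport k → tsupport k ⊆ Ioo 0 1 →
      ∫ r in Ioo (0 : ℝ) 1, w r * deriv k r = - ∫ r in Ioo (0 : ℝ) 1, q r * k r) :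
    ∃ c0, ∀ᵐ r ∂volume.restrict (Ioo (0 : ℝ) 1), w r = c0 - ∫ s in r..1, q s := by
  have hQc := (continuousOn_integral_right hq).mono Ioo_subset_Ioc_self
  have hQl : LocallyIntegrableOn (fun r => ∫ s in r..1, q s) (Ioo (0 : ℝ) 1) :=
    hQc.locallyIntegrableOn measurableSet_Ioo
  -- `w` plus the integral of `q` from `r` to `1` has zero weak derivative. Integrating from the
  -- right endpoint allows `q` to be non-integrable at `0`.
  obtain ⟨c0, hc0⟩ := ae_const_of_weak_deriv_zero (hw.add hQl) fun k hk hkc hks => by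
    have hks' := tsupport_deriv_subset'.trans hks
    have hk' : Continuous (deriv k) := (contDiff_infty_iff_deriv.1 hk).2.continuous
    have i1 := integrable_mul_test hw hk' hkc.deriv hks'
    have i2 := integrable_mul_test hQl hk' hkc.deriv hks'
    have e0 : ∫ r, (w + fun r => ∫ s in r..1, q s) r * deriv k r
        = (∫ r, w r * deriv k r) + ∫ r, (∫ s in r..1, q s) * deriv k r := by
      rw [← integral_add i1 i2]
      refine integral_congr_ae (Eventually.of_forall fun r => ?_)
      simp only [Pi.add_apply]; ring
    have e1 := h k hk hkc hks
    rw [setIntegral_mul_test hks', setIntegral_mul_test hks] at e1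
    obtain ⟨a, b, ha, hab, hb, hsub⟩ := exists_Ioo_of_isCompact hkc.isCompact hks
    have hka : k a = 0 := image_eq_zero_of_notMem_tsupport fun hc => lt_irrefl _ (hsub hc).1
    have hkb : k 1 = 0 := image_eq_zero_of_notMem_tsupport fun hc => by linarith [(hsub hc).2]
    have hkd : ∀ r, HasDerivAt k (deriv k r) r := fun r =>
      ((contDiff_infty_iff_deriv.1 hk).1 r).hasDerivAt
    have hparts := integral_mul_deriv_of_primitive (a := a) (b := 1)
      (m := fun r => - ∫ s in r..1, q s) (q := q) (K := k) (K' := deriv k) (by linarith)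
      (hq a ⟨ha, by linarith⟩) (fun r hr => by linarith [integral_right_add hq ha hr])
      hk.continuous.continuousOn (fun r _ => hkd r) (hk'.intervalIntegrable _ _)
    have hI : Ioo a b ⊆ Ioc a 1 := fun x hx => ⟨hx.1, hx.2.le.trans hb.le⟩
    have j1 : ∫ s in a..1, q s * k s = ∫ s, q s * k s := by
      rw [intervalIntegral.integral_of_le (by linarith), setIntegral_mul_test (hsub.trans hI)]
    have j2 : ∫ s in a..1, (-∫ t in s..1, q t) * deriv k s
        = ∫ s, (-∫ t in s..1, q t) * deriv k s := by
      rw [intervalIntegral.integral_of_le (by linarith),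
        setIntegral_mul_test ((tsupport_deriv_subset').trans (hsub.trans hI))]
    rw [hka, hkb, j1, j2] at hparts
    simp only [neg_mul, integral_neg] at hparts
    rw [e0]
    linarith
  refine ⟨c0, hc0.mono fun r hr => ?_⟩
  simp only [Pi.add_apply] at hr
  linarith

/-! ### Weak gradients -/

variable {d : ℕ}

theorem HasWeakPartial.mono {Ω Ω' : Set (E d)} {i : Fin d} {u g : E d → ℝ}
    (h : HasWeakPartial Ω i u g) (hΩ : Ω' ⊆ Ω) : HasWeakPartial Ω' i u g := by
  refine ⟨h.1.mono_set hΩ, h.2.1.mono_set hΩ, fun φ hφ hc hs => ?_⟩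
  have h1 := h.2.2 φ hφ hc (hs.trans hΩ)
  have hs' : tsupport (fun x => fderiv ℝ φ x (EuclideanSpace.single i 1)) ⊆ tsupport φ :=
    tsupport_fderiv_apply_subset ℝ _
  rw [setIntegral_mul_test (hs'.trans hs), setIntegral_mul_test hs]
  rwa [setIntegral_mul_test (hs'.trans (hs.trans hΩ)), setIntegral_mul_test (hs.trans hΩ)] at h1

theorem HasWeakPartial.ae_unique {Ω : Set (E d)} (hΩ : IsOpen Ω) {i : Fin d} {u u' g g' : E d → ℝ}
    (h : HasWeakPartial Ω i u g) (h' : HasWeakPartial Ω i u' g')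
    (hu : ∀ᵐ x ∂volume.restrict Ω, u x = u' x) : ∀ᵐ x ∂volume.restrict Ω, g x = g' x := by
  rw [ae_restrict_iff' hΩ.measurableSet]
  have : ∀ᵐ x, x ∈ Ω → (g x - g' x) = 0 := by
    refine hΩ.ae_eq_zero_of_integral_contDiff_smul_eq_zero (h.2.1.sub h'.2.1) fun φ hφ hc hs => ?_
    have h1 := h.2.2 φ hφ hc hs
    have h2 := h'.2.2 φ hφ hc hs
    have e : ∫ x in Ω, u x * fderiv ℝ φ x (EuclideanSpace.single i 1)
        = ∫ x in Ω, u' x * fderiv ℝ φ x (EuclideanSpace.single i 1) :=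
      integral_congr_ae (hu.mono fun x hx => by simp only [hx])
    rw [setIntegral_mul_test hs] at h1 h2
    have i1 := integrable_mul_test h.2.1 hφ.continuous hc hs
    have i2 := integrable_mul_test h'.2.1 hφ.continuous hc hs
    have e2 : ∫ x, φ x • (g x - g' x) = (∫ x, g x * φ x) - ∫ x, g' x * φ x := by
      rw [← integral_sub i1 i2]
      refine integral_congr_ae (Eventually.of_forall fun x => ?_)
      simp only [smul_eq_mul]; ring
    rw [e2]; linarith
  filter_upwards [this] with x hx hxΩ
  linarith [hx hxΩ]

theorem HasWeakGrad.ae_unique {Ω : Set (E d)} (hΩ : IsOpen Ω) {u u' : E d → ℝ} {G G' : E d → E d}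
    (h : HasWeakGrad Ω u G) (h' : HasWeakGrad Ω u' G')
    (hu : ∀ᵐ x ∂volume.restrict Ω, u x = u' x) : ∀ᵐ x ∂volume.restrict Ω, G x = G' x := by
  have : ∀ᵐ x ∂volume.restrict Ω, ∀ i, G x i = G' x i :=
    ae_all_iff.2 fun i => (h i).ae_unique hΩ (h' i) hu
  filter_upwards [this] with x hx
  ext i
  exact hx i

/-- A classical gradient is a weak gradient. -/
theorem hasWeakGrad_of_hasFDerivAt {Ω : Set (E d)} (hΩ : IsOpen Ω) {u : E d → ℝ} {G : E d → E d}
    (hG : ContinuousOn G Ω) (hu : ∀ x ∈ Ω, HasFDerivAt u (innerSL ℝ (G x)) x) :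
    HasWeakGrad Ω u G := by
  intro i
  have hGi : ContinuousOn (fun x => G x i) Ω :=
    (EuclideanSpace.proj (𝕜 := ℝ) i).continuous.comp_continuousOn hG
  have huc : ContinuousOn u Ω := fun x hx => (hu x hx).continuousAt.continuousWithinAt
  have hlu := huc.locallyIntegrableOn (μ := volume) hΩ.measurableSet
  have hlg := hGi.locallyIntegrableOn (μ := volume) hΩ.measurableSet
  refine ⟨hlu, hlg, fun φ hφ hc hs => ?_⟩
  have hφ1 : ContDiff ℝ 1 φ := hφ.of_le (by norm_cast)
  have hs' : tsupport (fun x => fderiv ℝ φ x (EuclideanSpace.single i 1)) ⊆ tsupport φ :=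
    tsupport_fderiv_apply_subset ℝ _
  rw [setIntegral_mul_test (hs'.trans hs), setIntegral_mul_test hs]
  have hcont : Continuous fun x => fderiv ℝ φ x (EuclideanSpace.single i 1) :=
    (hφ1.continuous_fderiv (by norm_num)).clm_apply continuous_const
  have hd : ∀ x ∈ Ω, fderiv ℝ u x (EuclideanSpace.single i 1) = G x i := fun x hx => by
    rw [(hu x hx).fderiv]
    simp [EuclideanSpace.inner_single_right]
  have hae : (fun x => fderiv ℝ u x (EuclideanSpace.single i 1) * φ x) = fun x => G x i * φ x := by
    funext x
    by_cases hx : x ∈ Ω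
    · rw [hd x hx]
    · rw [image_eq_zero_of_notMem_tsupport fun h => hx (hs h)]; simp
  have := integral_mul_fderiv_eq_neg_fderiv_mul_of_integrable (μ := volume)
    (f := u) (g := φ) (v := EuclideanSpace.single i (1 : ℝ))
    (by rw [hae]; exact integrable_mul_test hlg hφ.continuous hc hs)
    (integrable_mul_test hlu hcont (hc.mono' (subset_closure.trans hs')) (hs'.trans hs))
    (integrable_mul_test hlu hφ.continuous hc hs)
    (fun x hx => (hu x (hs hx)).differentiableAt)
    (fun x _ => hφ1.differentiable (by norm_num) x)
  rw [this, hae]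

/-! ### Radial test functions -/

theorem hasFDerivAt_norm {x : E d} (hx : x ≠ 0) :
    HasFDerivAt (fun y : E d => ‖y‖) (innerSL ℝ (‖x‖⁻¹ • x)) x := by
  have h := (hasStrictFDerivAt_norm_sq x).hasFDerivAt.sqrt (pow_ne_zero 2 (norm_ne_zero_iff.2 hx))
  simp only [Real.sqrt_sq (norm_nonneg _)] at h
  refine h.congr_fderiv ?_
  have := norm_ne_zero_iff.2 hx
  ext v
  simp
  field_simp

theorem hasFDerivAt_comp_norm {κ : ℝ → ℝ} {κ' : ℝ} {x : E d} (hx : x ≠ 0)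
    (h : HasDerivAt κ κ' ‖x‖) :
    HasFDerivAt (fun y : E d => κ ‖y‖) (innerSL ℝ ((κ' * ‖x‖⁻¹) • x)) x := by
  refine (h.comp_hasFDerivAt x (hasFDerivAt_norm hx)).congr_fderiv ?_
  ext v
  simp [mul_assoc]

/-- Constancy near `0` hides the singularity of the norm. -/
theorem contDiff_comp_norm {κ : ℝ → ℝ} {a κ0 : ℝ} (hκ : ContDiff ℝ ∞ κ) (ha : 0 < a)
    (h : ∀ r ≤ a, κ r = κ0) : ContDiff ℝ ∞ fun x : E d => κ ‖x‖ := by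
  rw [contDiff_iff_contDiffAt]
  intro x
  by_cases hx : x = 0
  · have : (fun x : E d => κ ‖x‖) =ᶠ[𝓝 x] fun _ => κ0 := by
      have hb : Metric.ball x a ∈ 𝓝 x := Metric.ball_mem_nhds x ha
      filter_upwards [hb] with y hy
      refine h _ ?_
      rw [hx, mem_ball_zero_iff] at hy
      exact hy.le
    exact contDiffAt_const.congr_of_eventuallyEq this
  · exact hκ.contDiffAt.comp x (contDiffAt_norm ℝ hx)

theorem fderiv_comp_norm {κ : ℝ → ℝ} {a κ0 : ℝ} (hκ : ContDiff ℝ ∞ κ) (ha : 0 < a)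
    (h : ∀ r ≤ a, κ r = κ0) (x v : E d) :
    fderiv ℝ (fun x : E d => κ ‖x‖) x v = deriv κ ‖x‖ * (inner ℝ x v / ‖x‖) := by
  by_cases hx : x = 0
  · have : (fun x : E d => κ ‖x‖) =ᶠ[𝓝 x] fun _ => κ0 := by
      have hb : Metric.ball x a ∈ 𝓝 x := Metric.ball_mem_nhds x ha
      filter_upwards [hb] with y hy
      refine h _ ?_
      rw [hx, mem_ball_zero_iff] at hy
      exact hy.le
    rw [this.fderiv_eq]
    simp [hx]
  · have hd := ((contDiff_infty_iff_deriv.1 hκ).1 ‖x‖).hasDerivAt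
    rw [(hasFDerivAt_comp_norm hx hd).fderiv]
    simp
    ring

/-- `k / r ^ n` is smooth for `k` vanishing near the origin. -/
theorem contDiff_div_pow {k : ℝ → ℝ} {a : ℝ} (hk : ContDiff ℝ ∞ k) (ha : 0 < a)
    (h : ∀ r ≤ a, k r = 0) (n : ℕ) : ContDiff ℝ ∞ fun r => k r / r ^ n := by
  rw [contDiff_iff_contDiffAt]
  intro r
  rcases lt_or_ge r a with hr | hr
  · have : (fun r => k r / r ^ n) =ᶠ[𝓝 r] fun _ => 0 := by
      filter_upwards [Iio_mem_nhds hr] with y hy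
      rw [h y (le_of_lt hy), zero_div]
    exact contDiffAt_const.congr_of_eventuallyEq this
  · exact hk.contDiffAt.div (contDiffAt_id.pow n) (pow_pos (ha.trans_le hr) n).ne'

/-- The spherical average of the radial component of a vector field. -/
noncomputable def radPart (G : E d → E d) : ℝ → ℝ :=
  sphAvg fun x => inner ℝ x (G x) / ‖x‖

theorem abs_radial_le (x y : E d) : |inner ℝ x y / ‖x‖| ≤ ‖y‖ := by
  rcases eq_or_ne x 0 with rfl | hx
  · simp
  · rw [abs_div, abs_norm, div_le_iff₀ (norm_pos_iff.2 hx), mul_comm]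
    exact abs_real_inner_le_norm x y

theorem memLp_radial {μ : Measure (E d)} {G : E d → E d} (hG : MemLp G 2 μ) :
    MemLp (fun x => inner ℝ x (G x) / ‖x‖) 2 μ := by
  have hm : AEStronglyMeasurable (fun x => inner ℝ x (G x) / ‖x‖) μ := by
    have h1 : AEStronglyMeasurable (fun x : E d => inner ℝ x (G x)) μ :=
      AEStronglyMeasurable.inner aestronglyMeasurable_id hG.aestronglyMeasurable
    exact (h1.aemeasurable.div measurable_norm.aemeasurable).aestronglyMeasurable
  exact hG.mono hm (Eventually.of_forall fun x => by
    rw [Real.norm_eq_abs]; exact abs_radial_le x (G x))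

theorem intervalIntegrable_of_weight {j : ℕ} {q : ℝ → ℝ}
    (h : IntegrableOn (fun r => r ^ (j + 1) * q r) (Ioo 0 1)) {a : ℝ} (ha : a ∈ Ioc (0 : ℝ) 1) :
    IntervalIntegrable q volume a 1 := by
  have h1 : IntervalIntegrable (fun r => r ^ (j + 1) * q r) volume a 1 := by
    rw [intervalIntegrable_iff_integrableOn_Ioo_of_le ha.2]
    exact h.mono_set (Ioo_subset_Ioo_left ha.1.le)
  have hc : ContinuousOn (fun r : ℝ => (r ^ (j + 1))⁻¹) (uIcc a 1) := by
    rw [uIcc_of_le ha.2]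
    exact (continuous_pow _).continuousOn.inv₀ fun r hr => (pow_pos (ha.1.trans_le hr.1) _).ne'
  refine (h1.continuousOn_mul hc).congr_uIoo fun r hr => ?_
  rw [uIoo_of_le ha.2] at hr
  have : r ^ (j + 1) ≠ 0 := (pow_pos (ha.1.trans hr.1) _).ne'
  simp only
  field_simp

theorem locallyIntegrableOn_of_weight {j : ℕ} {q : ℝ → ℝ}
    (h : IntegrableOn (fun r => r ^ (j + 1) * q r) (Ioo 0 1)) :
    LocallyIntegrableOn q (Ioo 0 1) := by
  rw [locallyIntegrableOn_iff isOpen_Ioo.isLocallyClosed]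
  intro K hK hKc
  obtain ⟨a, b, ha, hab, hb, hsub⟩ := exists_Ioo_of_isCompact hKc hK
  have := intervalIntegrable_of_weight h (a := a) ⟨ha, by linarith⟩
  rw [intervalIntegrable_iff_integrableOn_Ioo_of_le (by linarith)] at this
  exact this.mono_set (hsub.trans (Ioo_subset_Ioo_right hb.le))

/-- The weak gradient is tested with the components of the vector field `κ(|x|) x`, whose divergence
is `κ'(r) r + d κ(r)`. -/
theorem hasWeakGrad_test_radial {j : ℕ} {u : E (j + 2) → ℝ} {G : E (j + 2) → E (j + 2)}
    (huG : HasWeakGrad (Metric.ball 0 1) u G) (hu : IntegrableOn u (Metric.ball 0 1))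
    (hG : IntegrableOn G (Metric.ball 0 1))
    {κ : ℝ → ℝ} {a b : ℝ} (hκ : ContDiff ℝ ∞ κ) (ha : 0 < a) (hb : b < 1)
    (h0 : ∀ r, r ∉ Icc a b → κ r = 0) :
    ∫ x in Metric.ball (0 : E (j + 2)) 1, u x * (deriv κ ‖x‖ * ‖x‖ + (j + 2) * κ ‖x‖)
      = - ∫ x in Metric.ball (0 : E (j + 2)) 1, (inner ℝ x (G x) * κ ‖x‖) := by
  have ha2 : 0 < a / 2 := by linarith
  have h00 : ∀ r ≤ a / 2, κ r = 0 := fun r hr => h0 r fun hc => by linarith [hc.1]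
  have hκs : ContDiff ℝ ∞ fun x : E (j + 2) => κ ‖x‖ := contDiff_comp_norm hκ ha2 h00
  set φ : Fin (j + 2) → E (j + 2) → ℝ := fun i x => κ ‖x‖ * x i with hφ
  have hpr : ∀ i, ContDiff ℝ ∞ fun x : E (j + 2) => x i := fun i =>
    (EuclideanSpace.proj (𝕜 := ℝ) i).contDiff
  have hφs : ∀ i, ContDiff ℝ ∞ (φ i) := fun i => hκs.mul (hpr i)
  have hz : ∀ i x, x ∉ Metric.closedBall (0 : E (j + 2)) b → φ i x = 0 := fun i x hx => by
    rw [mem_closedBall_zero_iff] at hx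
    simp [hφ, h0 ‖x‖ fun hc => hx hc.2]
  have hφc : ∀ i, HasCompactSupport (φ i) := fun i =>
    HasCompactSupport.intro (isCompact_closedBall _ _) (hz i)
  have hφt : ∀ i, tsupport (φ i) ⊆ Metric.ball 0 1 := fun i =>
    (closure_minimal (fun x hx => by by_contra hc; exact hx (hz i x hc))
      Metric.isClosed_closedBall).trans (Metric.closedBall_subset_ball hb)
  have hφd : ∀ i x, fderiv ℝ (φ i) x (EuclideanSpace.single i 1)
      = deriv κ ‖x‖ * (x i / ‖x‖) * x i + κ ‖x‖ := fun i x => by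
    have h1 : fderiv ℝ (φ i) x = κ ‖x‖ • fderiv ℝ (fun x : E (j + 2) => x i) x
        + x i • fderiv ℝ (fun x : E (j + 2) => κ ‖x‖) x :=
      fderiv_mul (hκs.differentiable (by simp) x) ((hpr i).differentiable (by simp) x)
    have h2 : fderiv ℝ (fun x : E (j + 2) => x i) x = EuclideanSpace.proj (𝕜 := ℝ) i :=
      (EuclideanSpace.proj (𝕜 := ℝ) i).fderiv
    rw [h1, h2]
    simp only [add_apply, smul_apply,
      fderiv_comp_norm hκ ha2 h00, smul_eq_mul]
    simp [EuclideanSpace.inner_single_right]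
    ring
  have hsum : ∀ x : E (j + 2), ∑ i, u x * fderiv ℝ (φ i) x (EuclideanSpace.single i 1)
      = u x * (deriv κ ‖x‖ * ‖x‖ + (j + 2) * κ ‖x‖) := fun x => by
    rw [← Finset.mul_sum]
    congr 1
    simp only [hφd, Finset.sum_add_distrib, Finset.sum_const, Finset.card_univ, Fintype.card_fin,
      nsmul_eq_mul]
    push_cast
    congr 1
    rcases eq_or_ne x 0 with rfl | hx
    · simp
    · have hn := norm_ne_zero_iff.2 hx
      have : ∑ i, x i * x i = ‖x‖ * ‖x‖ := by
        rw [← real_inner_self_eq_norm_mul_norm, PiLp.inner_apply]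
        simp [sq]
      have e : ∀ i, deriv κ ‖x‖ * (x i / ‖x‖) * x i = deriv κ ‖x‖ / ‖x‖ * (x i * x i) :=
        fun i => by ring
      simp only [e]
      rw [← Finset.mul_sum, this]
      field_simp
  have hsum2 : ∀ x : E (j + 2), ∑ i, G x i * φ i x = inner ℝ x (G x) * κ ‖x‖ := fun x => by
    rw [PiLp.inner_apply, Finset.sum_mul]
    refine Finset.sum_congr rfl fun i _ => ?_
    simp [hφ]
    ring
  have hbd : ∀ {w ψ : E (j + 2) → ℝ}, IntegrableOn w (Metric.ball 0 1) → Continuous ψ →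
      IntegrableOn (fun x => w x * ψ x) (Metric.ball 0 1) := fun {w ψ} hw hψ => by
    obtain ⟨C, hC⟩ := (isCompact_closedBall (0 : E (j + 2)) 1).exists_bound_of_continuousOn
      hψ.continuousOn
    refine hw.mul_bdd (c := C) hψ.aestronglyMeasurable ?_
    filter_upwards [ae_restrict_mem measurableSet_ball] with x hx
    exact hC x (Metric.ball_subset_closedBall hx)
  have hGi : ∀ i, IntegrableOn (fun x => G x i) (Metric.ball 0 1) := fun i =>
    (EuclideanSpace.proj (𝕜 := ℝ) i).integrable_comp hG
  have hcd : ∀ i, Continuous fun x => fderiv ℝ (φ i) x (EuclideanSpace.single i 1) := fun i =>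
    ((hφs i).continuous_fderiv (by simp)).clm_apply continuous_const
  calc ∫ x in Metric.ball (0 : E (j + 2)) 1, u x * (deriv κ ‖x‖ * ‖x‖ + (j + 2) * κ ‖x‖)
      = ∑ i, ∫ x in Metric.ball (0 : E (j + 2)) 1,
          u x * fderiv ℝ (φ i) x (EuclideanSpace.single i 1) := by
        rw [← integral_finsetSum _ fun i _ => hbd hu (hcd i)]
        simp only [hsum]
    _ = ∑ i, - ∫ x in Metric.ball (0 : E (j + 2)) 1, G x i * φ i x :=
        Finset.sum_congr rfl fun i _ => (huG i).2.2 (φ i) (hφs i) (hφc i) (hφt i)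
    _ = _ := by
        rw [Finset.sum_neg_distrib, ← integral_finsetSum _ fun i _ => hbd (hGi i) (hφs i).continuous]
        simp only [hsum2]

/-- A radial function is a primitive of the spherical average of its radial derivative. -/
theorem exists_radial_primitive {j : ℕ} {u : E (j + 2) → ℝ} {G : E (j + 2) → E (j + 2)} {u0 : ℝ → ℝ}
    (huG : HasWeakGrad (Metric.ball 0 1) u G) (hu : IntegrableOn u (Metric.ball 0 1))
    (hG : MemLp G 2 (volume.restrict (Metric.ball 0 1)))
    (hr : ∀ᵐ x ∂volume.restrict (Metric.ball 0 1), u x = u0 ‖x‖) :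
    (∀ a ∈ Ioc (0 : ℝ) 1, IntervalIntegrable (radPart G) volume a 1) ∧
      ∃ c0, ∀ᵐ x ∂volume.restrict (Metric.ball (0 : E (j + 2)) 1),
        u x = c0 - ∫ s in ‖x‖..1, radPart G s := by
  have hG1 : IntegrableOn G (Metric.ball 0 1) := hG.integrable (by norm_num)
  have hF := memLp_radial hG
  have hF1 : IntegrableOn (fun x => inner ℝ x (G x) / ‖x‖) (Metric.ball 0 1) :=
    hF.integrable (by norm_num)
  have hq : ∀ a ∈ Ioc (0 : ℝ) 1, IntervalIntegrable (radPart G) volume a 1 := fun a ha =>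
    intervalIntegrable_of_weight (integrable_sphAvg hF1) ha
  refine ⟨hq, ?_⟩
  have hu0 := (integral_ball_radial hu hr).1
  obtain ⟨c0, hc0⟩ := ae_eq_primitive_of_weak_deriv (locallyIntegrableOn_of_weight hu0) hq
    fun k hk hkc hks => by
    obtain ⟨a, b, ha, hab, hb, hsub⟩ := exists_Ioo_of_isCompact hkc.isCompact hks
    have hk0 : ∀ r, r ∉ Icc a b → k r = 0 := fun r hr => image_eq_zero_of_notMem_tsupport
      fun hc => hr (Ioo_subset_Icc_self (hsub hc))
    have hk' : ∀ r ≤ a, k r = 0 := fun r hr => image_eq_zero_of_notMem_tsupport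
      fun hc => not_lt.2 hr (hsub hc).1
    have hkd : ∀ r, HasDerivAt k (deriv k r) r := fun r =>
      ((contDiff_infty_iff_deriv.1 hk).1 r).hasDerivAt
    -- For `κ = k / r^d` the divergence becomes `k' / r^(d-1)`, which cancels the polar weight and
    -- leaves the one-dimensional weak derivative.
    have key := hasWeakGrad_test_radial huG hu hG1 (contDiff_div_pow hk ha hk' (j + 2)) ha hb
      fun r hr => by rw [hk0 r hr, zero_div]
    have e1 : ∀ x : E (j + 2), deriv (fun r => k r / r ^ (j + 2)) ‖x‖ * ‖x‖
        + (j + 2) * (k ‖x‖ / ‖x‖ ^ (j + 2)) = deriv k ‖x‖ / ‖x‖ ^ (j + 1) := fun x => by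
      rcases eq_or_ne x 0 with rfl | hx
      · simp
      · have hn := norm_ne_zero_iff.2 hx
        have hp : HasDerivAt (fun r : ℝ => r ^ (j + 2)) (((j + 2 : ℕ) : ℝ) * ‖x‖ ^ (j + 1)) ‖x‖ :=
          hasDerivAt_pow (j + 2) ‖x‖
        rw [((hkd ‖x‖).fun_div hp (pow_ne_zero _ hn)).deriv]
        push_cast
        field_simp
        ring
    have e2 : ∀ x : E (j + 2), inner ℝ x (G x) * (k ‖x‖ / ‖x‖ ^ (j + 2))
        = inner ℝ x (G x) / ‖x‖ * (k ‖x‖ / ‖x‖ ^ (j + 1)) := fun x => by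
      rw [div_mul_div_comm, pow_succ' ‖x‖ (j + 1), mul_div_assoc]
    simp only [e1, e2] at key
    have hbdd : ∀ {w : E (j + 2) → ℝ} {h : ℝ → ℝ}, IntegrableOn w (Metric.ball 0 1) → Continuous h →
        (∀ r ≤ a, h r = 0) →
        IntegrableOn (fun x => w x * (h ‖x‖ / ‖x‖ ^ (j + 1))) (Metric.ball 0 1) := by
      intro w h hw hh hh0
      obtain ⟨C, hC⟩ := (isCompact_Icc (a := (0 : ℝ)) (b := 1)).exists_bound_of_continuousOn
        hh.continuousOn
      have hm : AEStronglyMeasurable (fun x : E (j + 2) => h ‖x‖ / ‖x‖ ^ (j + 1))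
          (volume.restrict (Metric.ball 0 1)) :=
        ((hh.comp continuous_norm).measurable.div
          (measurable_norm.pow_const _)).aestronglyMeasurable
      refine hw.mul_bdd (c := C / a ^ (j + 1)) hm ?_
      filter_upwards [ae_restrict_mem measurableSet_ball] with x hx
      rw [mem_ball_zero_iff] at hx
      have h1 := hC ‖x‖ ⟨norm_nonneg _, hx.le⟩
      have hC0 : 0 ≤ C := (norm_nonneg _).trans h1
      have hap : 0 < a ^ (j + 1) := pow_pos ha _
      rcases le_or_gt ‖x‖ a with h2 | h2
      · rw [hh0 _ h2, zero_div, norm_zero]; positivity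
      · rw [norm_div, norm_pow, norm_norm]
        gcongr
    have i1 := hbdd hu (contDiff_infty_iff_deriv.1 hk).2.continuous fun r hr => by
      refine image_eq_zero_of_notMem_tsupport fun hc => ?_
      exact not_lt.2 hr (hsub (tsupport_deriv_subset' hc)).1
    have i2 := hbdd hF1 hk.continuous hk'
    rw [integral_ball_eq i1, integral_ball_eq i2] at key
    have hσ := (sphArea_pos j).ne'
    have key2 := mul_left_cancel₀ hσ (key.trans (mul_neg _ _).symm)
    have c1 : ∫ r in Ioo (0 : ℝ) 1, r ^ (j + 1) * sphAvg (d := j + 2)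
        (fun x => u x * (deriv k ‖x‖ / ‖x‖ ^ (j + 1))) r
        = ∫ r in Ioo (0 : ℝ) 1, u0 r * deriv k r := by
      refine integral_congr_ae ?_
      filter_upwards [sphAvg_of_ae_radial hr, ae_restrict_mem measurableSet_Ioo] with r h1 h2
      rw [sphAvg_mul_norm u (fun r => deriv k r / r ^ (j + 1)) h2.1.le, h1]
      have : r ^ (j + 1) ≠ 0 := (pow_pos h2.1 _).ne'
      field_simp
    have c2 : ∫ r in Ioo (0 : ℝ) 1, r ^ (j + 1) * sphAvg (d := j + 2)
        (fun x => inner ℝ x (G x) / ‖x‖ * (k ‖x‖ / ‖x‖ ^ (j + 1))) r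
        = ∫ r in Ioo (0 : ℝ) 1, radPart G r * k r := by
      refine integral_congr_ae ?_
      filter_upwards [ae_restrict_mem measurableSet_Ioo] with r h2
      rw [sphAvg_mul_norm (fun x => inner ℝ x (G x) / ‖x‖) (fun r => k r / r ^ (j + 1)) h2.1.le]
      have : r ^ (j + 1) ≠ 0 := (pow_pos h2.1 _).ne'
      unfold radPart
      field_simp
    rw [c1, c2] at key2
    exact key2
  refine ⟨c0, ?_⟩
  filter_upwards [hr, ae_norm hc0] with x h1 h2
  rw [h1, h2]

/-! ### The radial chemical potential equation -/

theorem integral_right_le {h : ℝ → ℝ} (hi : IntegrableOn h (Ioo 0 1))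
    (h0 : ∀ r ∈ Ioo (0 : ℝ) 1, 0 ≤ h r) {a : ℝ} (ha : a ∈ Ioc (0 : ℝ) 1) :
    ∫ s in a..1, h s ≤ ∫ s in Ioo (0 : ℝ) 1, h s := by
  rw [intervalIntegral.integral_of_le ha.2, integral_Ioc_eq_integral_Ioo]
  refine setIntegral_mono_set hi ?_ (Ioo_subset_Ioo_left ha.1.le).eventuallyLE
  filter_upwards [ae_restrict_mem measurableSet_Ioo] with r hr using h0 r hr

/-- Integrability makes the integral continuous in its left endpoint, so the profile estimates on
`(a, 1)` pass to `a → 0`. -/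
theorem integral_Ioo_le_of_right {h : ℝ → ℝ} {M : ℝ} (hi : IntegrableOn h (Ioo 0 1))
    (hM : ∀ a ∈ Ioc (0 : ℝ) 1, ∫ s in a..1, h s ≤ M) : ∫ s in Ioo (0 : ℝ) 1, h s ≤ M := by
  have hI : IntervalIntegrable h volume 0 1 := by
    rwa [intervalIntegrable_iff_integrableOn_Ioo_of_le zero_le_one]
  have hc : ContinuousOn (fun a => ∫ s in a..1, h s) (Icc 0 1) := by
    have h2 := (hI.absolutelyContinuousOnInterval_intervalIntegral (c := 1) (by simp)).continuousOn
    rw [uIcc_of_le zero_le_one] at h2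
    refine h2.neg.congr fun x _ => ?_
    simp [intervalIntegral.integral_symm x 1]
  have ht : Tendsto (fun a => ∫ s in a..1, h s) (𝓝[>] 0) (𝓝 (∫ s in (0 : ℝ)..1, h s)) := by
    have h1 := (hc 0 ⟨le_rfl, zero_le_one⟩).tendsto
    rw [← nhdsWithin_Ioc_eq_nhdsGT (zero_lt_one' ℝ)]
    exact h1.mono_left (nhdsWithin_mono _ Ioc_subset_Icc_self)
  rw [← integral_Ioc_eq_integral_Ioo, ← intervalIntegral.integral_of_le zero_le_one]
  refine le_of_tendsto ht ?_
  filter_upwards [Ioc_mem_nhdsGT (zero_lt_one' ℝ)] with a ha using hM a ha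

theorem restrict_ball_diff_zero (j : ℕ) :
    (volume : Measure (E (j + 2))).restrict (Metric.ball 0 1 \ {0})
      = volume.restrict (Metric.ball 0 1) :=
  Measure.restrict_congr_set (sdiff_null_ae_eq_self (by simp))

theorem aestronglyMeasurable_comp_norm {j : ℕ} {h : ℝ → ℝ} (hh : ContinuousOn h (Ioc 0 1)) :
    AEStronglyMeasurable (fun x : E (j + 2) => h ‖x‖) (volume.restrict (Metric.ball 0 1)) := by
  rw [← restrict_ball_diff_zero]
  refine ContinuousOn.aestronglyMeasurable ?_ (measurableSet_ball.diff (measurableSet_singleton 0))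
  refine hh.comp continuous_norm.continuousOn fun x hx => ?_
  have := hx.1
  rw [mem_ball_zero_iff] at this
  exact ⟨norm_pos_iff.2 hx.2, this.le⟩

/-- The divergence theorem on balls in weak form. Green's formula up to the boundary encodes the
Neumann condition: the test function `1` gives zero total flux, and radial test functions give the
flux through each sphere. -/
theorem radial_flux {j : ℕ} {G : E (j + 2) → E (j + 2)} {τ : E (j + 2) → ℝ} {F : ℝ → ℝ}
    (hG : MemLp G 2 (volume.restrict (Metric.ball 0 1))) (hτ : IntegrableOn τ (Metric.ball 0 1))
    (hr : ∀ᵐ x ∂volume.restrict (Metric.ball 0 1), τ x = F ‖x‖)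
    (hneu : ∀ ψ : E (j + 2) → ℝ, ContDiff ℝ ∞ ψ → HasCompactSupport ψ →
      ∫ x in Metric.ball 0 1, (fderiv ℝ ψ x (G x) + τ x * ψ x) = 0) :
    IntervalIntegrable (fun s => s ^ (j + 1) * F s) volume 0 1 ∧
      ∫ s in (0 : ℝ)..1, s ^ (j + 1) * F s = 0 ∧
      ∀ᵐ r ∂volume.restrict (Ioo (0 : ℝ) 1),
        r ^ (j + 1) * radPart G r = ∫ s in (0 : ℝ)..r, s ^ (j + 1) * F s := by
  have hσ := (sphArea_pos j).ne'
  obtain ⟨hFi, hFint⟩ := integral_ball_radial hτ hr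
  have hF1 : IntegrableOn (fun x => inner ℝ x (G x) / ‖x‖) (Metric.ball 0 1) :=
    (memLp_radial hG).integrable (by norm_num)
  have hqi : IntegrableOn (fun r => r ^ (j + 1) * radPart G r) (Ioo 0 1) := integrable_sphAvg hF1
  have hFI : IntervalIntegrable (fun s => s ^ (j + 1) * F s) volume 0 1 := by
    rwa [intervalIntegrable_iff_integrableOn_Ioo_of_le zero_le_one]
  have hP1 : ∫ s in (0 : ℝ)..1, s ^ (j + 1) * F s = 0 := by
    rw [intervalIntegral.integral_of_le zero_le_one, integral_Ioc_eq_integral_Ioo]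
    let B : ContDiffBump (0 : E (j + 2)) := ⟨2, 3, by norm_num, by norm_num⟩
    have h1 := hneu B B.contDiff B.hasCompactSupport
    have h2 : ∫ x in Metric.ball 0 1, (fderiv ℝ B x (G x) + τ x * B x)
        = ∫ x in Metric.ball 0 1, τ x := by
      refine setIntegral_congr_fun measurableSet_ball fun x hx => ?_
      have hx2 : x ∈ Metric.ball (0 : E (j + 2)) B.rIn :=
        Metric.ball_subset_ball (by norm_num [B]) hx
      have he := B.eventuallyEq_one_of_mem_ball hx2
      simp only [he.fderiv_eq, he.eq_of_nhds]
      simp [Pi.one_def]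
    rw [h2, hFint] at h1
    exact (mul_eq_zero.1 h1).resolve_left hσ
  refine ⟨hFI, hP1, ?_⟩
  set P : ℝ → ℝ := fun r => ∫ s in (0 : ℝ)..r, s ^ (j + 1) * F s with hP
  have hPc : ContinuousOn P (Icc 0 1) := by
    have := (hFI.absolutelyContinuousOnInterval_intervalIntegral (c := 0) (by simp)).continuousOn
    rwa [uIcc_of_le zero_le_one] at this
  have hPi : IntegrableOn P (Ioo 0 1) :=
    (hPc.integrableOn_compact isCompact_Icc).mono_set Ioo_subset_Icc_self
  have key : ∀ᵐ r : ℝ, r ∈ Ioo (0 : ℝ) 1 → r ^ (j + 1) * radPart G r - P r = 0 := by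
    refine isOpen_Ioo.ae_eq_zero_of_integral_contDiff_smul_eq_zero
      (hqi.locallyIntegrableOn.sub hPi.locallyIntegrableOn) fun η hη hηc hηs => ?_
    obtain ⟨a, b, ha, hab, hb, hsub⟩ := exists_Ioo_of_isCompact hηc.isCompact hηs
    have hη0 : ∀ r, r ∉ Icc a b → η r = 0 := fun r hr => image_eq_zero_of_notMem_tsupport
      fun hc => hr (Ioo_subset_Icc_self (hsub hc))
    -- This primitive of `η` is constant near the origin and vanishes beyond the support of `η`, so
    -- `H(|x|)` is smooth with compact support.
    set H : ℝ → ℝ := fun r => (∫ s in (0 : ℝ)..r, η s) - ∫ s, η s with hH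
    have hHs : ContDiff ℝ ∞ H := (contDiff_primitive hη).sub contDiff_const
    have hHd : ∀ r, HasDerivAt H (η r) r := fun r =>
      (hasDerivAt_primitive hη.continuous r).sub_const _
    have hHa : ∀ r ≤ a, H r = - ∫ s, η s := fun r hr => by
      simp [hH, primitive_eq_zero ha hη0 hr]
    have hHb : ∀ r, b ≤ r → H r = 0 := fun r hr => by
      simp [hH, primitive_eq_integral ha hη0 hr (by linarith)]
    have hψ : ContDiff ℝ ∞ fun x : E (j + 2) => H ‖x‖ := contDiff_comp_norm hHs ha hHa
    have hψc : HasCompactSupport fun x : E (j + 2) => H ‖x‖ :=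
      HasCompactSupport.intro (isCompact_closedBall 0 b) fun x hx => hHb _ (by
        rw [mem_closedBall_zero_iff] at hx
        exact (not_le.1 hx).le)
    have h1 := hneu _ hψ hψc
    have hbd : ∀ {w : E (j + 2) → ℝ} {ψ : ℝ → ℝ}, IntegrableOn w (Metric.ball 0 1) →
        Continuous ψ → IntegrableOn (fun x => w x * ψ ‖x‖) (Metric.ball 0 1) :=
      fun {w ψ} hw hψ => by
      obtain ⟨C, hC⟩ := (isCompact_Icc (a := (0 : ℝ)) (b := 1)).exists_bound_of_continuousOn
        hψ.continuousOn
      refine hw.mul_bdd (c := C) (hψ.comp continuous_norm).aestronglyMeasurable ?_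
      filter_upwards [ae_restrict_mem measurableSet_ball] with x hx
      rw [mem_ball_zero_iff] at hx
      exact hC _ ⟨norm_nonneg _, hx.le⟩
    have i1 := hbd hF1 hη.continuous
    have i2 := hbd hτ hHs.continuous
    have e1 : ∀ x : E (j + 2), fderiv ℝ (fun x : E (j + 2) => H ‖x‖) x (G x) + τ x * H ‖x‖
        = inner ℝ x (G x) / ‖x‖ * η ‖x‖ + τ x * H ‖x‖ := fun x => by
      rw [fderiv_comp_norm hHs ha hHa, (hHd _).deriv]
      ring
    simp only [e1] at h1
    rw [integral_add i1 i2, integral_ball_eq i1, integral_ball_eq i2, ← mul_add] at h1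
    have h2 := (mul_eq_zero.1 h1).resolve_left hσ
    have c1 : ∫ r in Ioo (0 : ℝ) 1, r ^ (j + 1) * sphAvg (d := j + 2)
        (fun x => inner ℝ x (G x) / ‖x‖ * η ‖x‖) r
        = ∫ r in Ioo (0 : ℝ) 1, r ^ (j + 1) * radPart G r * η r := by
      refine setIntegral_congr_fun measurableSet_Ioo fun r hr => ?_
      rw [sphAvg_mul_norm (fun x => inner ℝ x (G x) / ‖x‖) η hr.1.le]
      unfold radPart
      ring
    have c2 : ∫ r in Ioo (0 : ℝ) 1, r ^ (j + 1) * sphAvg (d := j + 2)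
        (fun x => τ x * H ‖x‖) r
        = ∫ r in (0 : ℝ)..1, r ^ (j + 1) * F r * H r := by
      rw [intervalIntegral.integral_of_le zero_le_one, integral_Ioc_eq_integral_Ioo]
      refine integral_congr_ae ?_
      filter_upwards [sphAvg_of_ae_radial hr, ae_restrict_mem measurableSet_Ioo] with r h1 h2
      rw [sphAvg_mul_norm τ H h2.1.le, h1]
      ring
    have hparts := integral_mul_deriv_of_primitive (m := P) (q := fun s => s ^ (j + 1) * F s)
      (K := H) (K' := η) zero_le_one hFI (fun r _ => by simp [hP]) hHs.continuous.continuousOn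
      (fun r _ => hHd r) (hη.continuous.intervalIntegrable _ _)
    have hP0 : P 0 = 0 := by simp [hP]
    have hP1' : P 1 = 0 := hP1
    rw [hP0, hP1', intervalIntegral.integral_of_le zero_le_one (f := fun s => P s * η s),
      integral_Ioc_eq_integral_Ioo, setIntegral_mul_test hηs] at hparts
    rw [c1, c2, setIntegral_mul_test hηs] at h2
    have j1 := integrable_mul_test hqi.locallyIntegrableOn hη.continuous hηc hηs
    have j2 := integrable_mul_test hPi.locallyIntegrableOn hη.continuous hηc hηs
    have e2 : ∫ r, η r • (r ^ (j + 1) * radPart G r - P r)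
        = (∫ r, r ^ (j + 1) * radPart G r * η r) - ∫ r, P r * η r := by
      rw [← integral_sub j1 j2]
      refine integral_congr_ae (Eventually.of_forall fun r => ?_)
      simp only [smul_eq_mul]; ring
    rw [e2]
    linarith
  rw [ae_restrict_iff' measurableSet_Ioo]
  filter_upwards [key] with r hr hr0
  linarith [hr hr0]

/-! ### Radial profiles of a time slice -/

/-- Cauchy–Schwarz with weight `s^(j+1)`, in Young form with `l = r^((j+2)/2)`. Divided by
`r^(j+1)`, it becomes the condition `g_small` on the radial derivative. -/
theorem sq_primitive_le {j : ℕ} {F : ℝ → ℝ}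
    (hF : IntervalIntegrable (fun s => s ^ (j + 1) * F s) volume 0 1)
    (hF2 : IntegrableOn (fun s => s ^ (j + 1) * F s ^ 2) (Ioo 0 1)) :
    ∃ B, ∀ r ∈ Ioc (0 : ℝ) 1, (∫ s in (0 : ℝ)..r, s ^ (j + 1) * F s) ^ 2 ≤ B * r ^ (j + 2) := by
  set B0 := ∫ s in Ioo (0 : ℝ) 1, s ^ (j + 1) * F s ^ 2 with hB0
  refine ⟨((B0 + 1) / 2) ^ 2, fun r hr => ?_⟩
  have hFr : IntervalIntegrable (fun s => s ^ (j + 1) * F s) volume 0 r :=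
    hF.mono_set (by
      rw [uIcc_of_le hr.1.le, uIcc_of_le zero_le_one]; exact Icc_subset_Icc_right hr.2)
  have hF2' : IntervalIntegrable (fun s => s ^ (j + 1) * F s ^ 2) volume 0 1 := by
    rwa [intervalIntegrable_iff_integrableOn_Ioo_of_le zero_le_one]
  have hF2r : IntervalIntegrable (fun s => s ^ (j + 1) * F s ^ 2) volume 0 r :=
    hF2'.mono_set (by
      rw [uIcc_of_le hr.1.le, uIcc_of_le zero_le_one]; exact Icc_subset_Icc_right hr.2)
  set l := Real.sqrt (r ^ (j + 2)) with hl
  have hrp : 0 < r ^ (j + 2) := pow_pos hr.1 _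
  have hl0 : 0 < l := Real.sqrt_pos.2 hrp
  have hl2 : l ^ 2 = r ^ (j + 2) := Real.sq_sqrt hrp.le
  have hB0r : ∫ s in (0 : ℝ)..r, s ^ (j + 1) * F s ^ 2 ≤ B0 := by
    rw [intervalIntegral.integral_of_le hr.1.le, integral_Ioc_eq_integral_Ioo]
    refine setIntegral_mono_set hF2 ?_ (Ioo_subset_Ioo_right hr.2).eventuallyLE
    filter_upwards [ae_restrict_mem measurableSet_Ioo] with s hs
    exact mul_nonneg (pow_nonneg hs.1.le _) (sq_nonneg _)
  have hpow : ∫ s in (0 : ℝ)..r, s ^ (j + 1) ≤ r ^ (j + 2) := by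
    rw [integral_pow]
    rw [zero_pow (by omega), sub_zero]
    refine div_le_self hrp.le ?_
    push_cast
    linarith [(Nat.cast_nonneg j : (0 : ℝ) ≤ j)]
  have hpi : IntervalIntegrable (fun s : ℝ => s ^ (j + 1)) volume 0 r :=
    (continuous_pow _).intervalIntegrable _ _
  have habs : |∫ s in (0 : ℝ)..r, s ^ (j + 1) * F s| ≤ l * ((B0 + 1) / 2) := by
    calc |∫ s in (0 : ℝ)..r, s ^ (j + 1) * F s|
        ≤ ∫ s in (0 : ℝ)..r, |s ^ (j + 1) * F s| :=
          intervalIntegral.abs_integral_le_integral_abs hr.1.le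
      _ ≤ ∫ s in (0 : ℝ)..r, (l / 2 * (s ^ (j + 1) * F s ^ 2) + 1 / (2 * l) * s ^ (j + 1)) := by
          refine intervalIntegral.integral_mono_on hr.1.le hFr.abs
            ((hF2r.const_mul _).add (hpi.const_mul _)) fun s hs => ?_
          have hsp : 0 ≤ s ^ (j + 1) := pow_nonneg hs.1 _
          rw [abs_mul, abs_of_nonneg hsp]
          have h1 : |F s| ≤ l / 2 * F s ^ 2 + 1 / (2 * l) := by
            rw [← sub_nonneg]
            have : l / 2 * F s ^ 2 + 1 / (2 * l) - |F s| = (l * |F s| - 1) ^ 2 / (2 * l) := by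
              rw [← sq_abs (F s)]
              field_simp
              ring
            rw [this]; positivity
          calc s ^ (j + 1) * |F s| ≤ s ^ (j + 1) * (l / 2 * F s ^ 2 + 1 / (2 * l)) :=
                mul_le_mul_of_nonneg_left h1 hsp
            _ = _ := by ring
      _ = l / 2 * (∫ s in (0 : ℝ)..r, s ^ (j + 1) * F s ^ 2)
          + 1 / (2 * l) * ∫ s in (0 : ℝ)..r, s ^ (j + 1) := by
          rw [intervalIntegral.integral_add (hF2r.const_mul _) (hpi.const_mul _),
            intervalIntegral.integral_const_mul, intervalIntegral.integral_const_mul]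
      _ ≤ l / 2 * B0 + 1 / (2 * l) * l ^ 2 := by
          rw [hl2]; gcongr
      _ = l * ((B0 + 1) / 2) := by field_simp
  calc (∫ s in (0 : ℝ)..r, s ^ (j + 1) * F s) ^ 2
      ≤ (l * ((B0 + 1) / 2)) ^ 2 := by
        rw [← sq_abs]
        exact pow_le_pow_left₀ (abs_nonneg _) habs 2
    _ = _ := by rw [mul_pow, hl2]; ring

/-- The properties of the time slices `c`, `∇c = G`, `Δc = τ`, `μ`, `∇μ = Gμ` of a radially symmetric
weak solution whose free energy is at most `E0`. -/
structure RadialSlice (j : ℕ) (f : ℝ → ℝ) (ε E0 : ℝ) (c μ τ : E (j + 2) → ℝ)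
    (G Gμ : E (j + 2) → E (j + 2)) : Prop where
  c_mem : MemLp c 2 (volume.restrict (Metric.ball 0 1))
  μ_mem : MemLp μ 2 (volume.restrict (Metric.ball 0 1))
  τ_mem : MemLp τ 2 (volume.restrict (Metric.ball 0 1))
  G_mem : MemLp G 2 (volume.restrict (Metric.ball 0 1))
  Gμ_mem : MemLp Gμ 2 (volume.restrict (Metric.ball 0 1))
  c_grad : HasWeakGrad (Metric.ball 0 1) c G
  μ_grad : HasWeakGrad (Metric.ball 0 1) μ Gμ
  c_radial : ∃ c1 : ℝ → ℝ, ∀ᵐ x ∂volume.restrict (Metric.ball 0 1), c x = c1 ‖x‖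
  μ_radial : ∃ μ1 : ℝ → ℝ, ∀ᵐ x ∂volume.restrict (Metric.ball 0 1), μ x = μ1 ‖x‖
  potential : ∀ᵐ x ∂volume.restrict (Metric.ball 0 1), μ x = deriv f (c x) / ε - ε * τ x
  neumann : ∀ ψ : E (j + 2) → ℝ, ContDiff ℝ ∞ ψ → HasCompactSupport ψ →
    ∫ x in Metric.ball 0 1, (fderiv ℝ ψ x (G x) + τ x * ψ x) = 0
  energy : ∫⁻ x in Metric.ball 0 1, ENNReal.ofReal (ε * (‖G x‖ ^ 2 / 2) + f (c x) / ε)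
    ≤ ENNReal.ofReal E0

/-- `c` and `μ` are replaced by primitives of their averaged radial derivatives, which are
continuous representatives. The flux identity then provides a continuous version of the radial
derivative of `c`, so the weak equation becomes a classical one. The `1` under the square root
ensures `N ≥ 1`. -/
theorem exists_profile {j : ℕ} (hj : j ≤ 1) {f : ℝ → ℝ} {ε E0 : ℝ} (hf : ContDiff ℝ 1 f)
    (hf0 : ∀ s, 0 ≤ f s) (hε : ε ∈ Ioc (0 : ℝ) 1) (hE0 : 0 ≤ E0)
    {c μ τ : E (j + 2) → ℝ} {G Gμ : E (j + 2) → E (j + 2)} (h : RadialSlice j f ε E0 c μ τ G Gμ) :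
    ∃ U g m q, Profile j f ε (E0 / sphArea (j + 2))
      (Real.sqrt (1 + (∫ x in Metric.ball 0 1, ‖Gμ x‖ ^ 2) / sphArea (j + 2))) U g m q ∧
      ∀ᵐ x ∂volume.restrict (Metric.ball 0 1), c x = U ‖x‖ ∧ ‖G x‖ ^ 2 = g ‖x‖ ^ 2 := by
  obtain ⟨hc2, hμ2, hτ, hG, hGμ, hcG, hμG, ⟨c1, hcr⟩, ⟨μ1, hμr⟩, hpot, hneu, hen⟩ := h
  have hc : IntegrableOn c (Metric.ball 0 1) := hc2.integrable (by norm_num)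
  have hμ : IntegrableOn μ (Metric.ball 0 1) := hμ2.integrable (by norm_num)
  have hσ := sphArea_pos j
  have hε0 := hε.1
  obtain ⟨hq, c0, hc0⟩ := exists_radial_primitive hcG hc hG hcr
  obtain ⟨hqμ, μ0, hμ0⟩ := exists_radial_primitive hμG hμ hGμ hμr
  have hf' : Continuous (deriv f) := hf.continuous_deriv (by norm_num)
  set U : ℝ → ℝ := fun r => c0 - ∫ s in r..1, radPart G s with hU
  set m : ℝ → ℝ := fun r => μ0 - ∫ s in r..1, radPart Gμ s with hm
  have hUc : ContinuousOn U (Ioc 0 1) := continuousOn_const.sub (continuousOn_integral_right hq)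
  have hmc : ContinuousOn m (Ioc 0 1) := continuousOn_const.sub (continuousOn_integral_right hqμ)
  set F : ℝ → ℝ := fun r => (deriv f (U r) / ε - m r) / ε with hF
  have hFc : ContinuousOn F (Ioc 0 1) :=
    (((hf'.comp_continuousOn hUc).div_const _).sub hmc).div_const _
  have hτr : ∀ᵐ x ∂volume.restrict (Metric.ball (0 : E (j + 2)) 1), τ x = F ‖x‖ := by
    filter_upwards [hpot, hc0, hμ0] with x h1 h2 h3
    have h2' : c x = U ‖x‖ := h2
    have h3' : μ x = m ‖x‖ := h3
    rw [h2', h3'] at h1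
    simp only [hF, h1]
    field_simp
    ring
  have hτ1 : IntegrableOn τ (Metric.ball 0 1) := hτ.integrable (by norm_num)
  obtain ⟨hFI, hP1, hflux⟩ := radial_flux hG hτ1 hτr hneu
  have hF2 : IntegrableOn (fun s => s ^ (j + 1) * F s ^ 2) (Ioo 0 1) :=
    (integral_ball_radial (h := fun r => F r ^ 2) hτ.integrable_sq
      (hτr.mono fun x hx => by simp only [hx])).1
  set P : ℝ → ℝ := fun r => ∫ s in (0 : ℝ)..r, s ^ (j + 1) * F s with hP
  have hPc : ContinuousOn P (Icc 0 1) := by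
    have := (hFI.absolutelyContinuousOnInterval_intervalIntegral (c := 0) (by simp)).continuousOn
    rwa [uIcc_of_le zero_le_one] at this
  -- Defining `g` through the flux makes it continuous up to `r = 1`, with `g 1 = 0` because the
  -- total flux vanishes.
  set g : ℝ → ℝ := fun r => P r / r ^ (j + 1) with hg
  have hgc : ContinuousOn g (Ioc 0 1) :=
    (hPc.mono Ioc_subset_Icc_self).div (continuous_pow _).continuousOn
      fun r hr => (pow_pos hr.1 _).ne'
  have hqg : ∀ᵐ r ∂volume.restrict (Ioo (0 : ℝ) 1), radPart G r = g r := by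
    filter_upwards [hflux, ae_restrict_mem measurableSet_Ioo] with r h1 h2
    have : r ^ (j + 1) ≠ 0 := (pow_pos h2.1 _).ne'
    simp only [hg, hP]
    rw [← h1]
    field_simp
  have hUg : ∀ r ∈ Ioc (0 : ℝ) 1, U r = c0 - ∫ s in r..1, g s := fun r hr => by
    simp only [hU]
    congr 1
    rw [intervalIntegral.integral_of_le hr.2, intervalIntegral.integral_of_le hr.2,
      integral_Ioc_eq_integral_Ioo, integral_Ioc_eq_integral_Ioo]
    exact integral_congr_ae (ae_restrict_of_ae_restrict_of_subset (Ioo_subset_Ioo_left hr.1.le) hqg)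
  have hUd : ∀ r ∈ Ioo (0 : ℝ) 1, HasDerivAt U (g r) r := fun r hr => by
    have h1 : HasDerivAt (fun u => ∫ s in u..1, g s) (-g r) r :=
      intervalIntegral.integral_hasDerivAt_left
        (intervalIntegrable_of_continuousOn_Ioc hgc hr.1 hr.2.le le_rfl)
        ((hgc.mono Ioo_subset_Ioc_self).stronglyMeasurableAtFilter isOpen_Ioo r hr)
        ((hgc.mono Ioo_subset_Ioc_self).continuousAt (isOpen_Ioo.mem_nhds hr))
    have h2 := h1.const_sub c0
    rw [neg_neg] at h2
    refine h2.congr_of_eventuallyEq ?_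
    filter_upwards [isOpen_Ioo.mem_nhds hr] with s hs using hUg s (Ioo_subset_Ioc_self hs)
  have hGg : ∀ᵐ x ∂volume.restrict (Metric.ball (0 : E (j + 2)) 1),
      G x = (g ‖x‖ * ‖x‖⁻¹) • x := by
    -- The classical gradient of `U(|x|)` is available only away from the origin; uniqueness of weak
    -- gradients on the punctured ball suffices and shows that `∇c` is purely radial.
    rw [← restrict_ball_diff_zero]
    have ho : IsOpen (Metric.ball (0 : E (j + 2)) 1 \ {0}) :=
      Metric.isOpen_ball.sdiff isClosed_singleton
    have hmem : ∀ x ∈ Metric.ball (0 : E (j + 2)) 1 \ {0}, ‖x‖ ∈ Ioo (0 : ℝ) 1 := fun x hx =>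
      ⟨norm_pos_iff.2 hx.2, mem_ball_zero_iff.1 hx.1⟩
    refine HasWeakGrad.ae_unique (u := c) (u' := fun x => U ‖x‖) ho
      (fun i => (hcG i).mono sdiff_subset)
      (hasWeakGrad_of_hasFDerivAt ho ?_ fun x hx => hasFDerivAt_comp_norm hx.2 (hUd _ (hmem x hx)))
      (by rw [restrict_ball_diff_zero]; exact hc0)
    refine ContinuousOn.fun_smul (ContinuousOn.fun_mul ?_ ?_) continuousOn_id
    · exact hgc.comp continuous_norm.continuousOn fun x hx => Ioo_subset_Ioc_self (hmem x hx)
    · exact ContinuousOn.fun_inv₀ continuous_norm.continuousOn fun x hx => (hmem x hx).1.ne'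
  have hne : ∀ᵐ x ∂volume.restrict (Metric.ball (0 : E (j + 2)) 1), x ≠ 0 := by
    rw [← restrict_ball_diff_zero]
    filter_upwards [ae_restrict_mem (measurableSet_ball.diff (measurableSet_singleton 0))] with x hx
    exact hx.2
  have hfin : ∀ᵐ x ∂volume.restrict (Metric.ball (0 : E (j + 2)) 1),
      c x = U ‖x‖ ∧ ‖G x‖ ^ 2 = g ‖x‖ ^ 2 := by
    filter_upwards [hc0, hGg, hne] with x h1 h2 h3
    refine ⟨h1, ?_⟩
    have := norm_ne_zero_iff.2 h3
    rw [h2, norm_smul, mul_pow, Real.norm_eq_abs, sq_abs]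
    field_simp
  have hEn0 : ∀ u p, 0 ≤ radEnergy f ε u p := fun u p => by
    have := hf0 u
    unfold radEnergy; positivity
  have hEc : ContinuousOn (fun r => radEnergy f ε (U r) (g r)) (Ioc 0 1) :=
    ((continuousOn_const.mul (hgc.pow 2)).div_const _).add
      ((hf.continuous.comp_continuousOn hUc).div_const _)
  have hEm := aestronglyMeasurable_comp_norm (j := j) hEc
  have hlint : ∫⁻ x in Metric.ball (0 : E (j + 2)) 1,
      ENNReal.ofReal (radEnergy f ε (U ‖x‖) (g ‖x‖)) ≤ ENNReal.ofReal E0 := by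
    refine le_trans (le_of_eq (lintegral_congr_ae ?_)) hen
    filter_upwards [hfin] with x hx
    rw [hx.1, hx.2, radEnergy]
    congr 1; ring
  have hEi : IntegrableOn (fun x : E (j + 2) => radEnergy f ε (U ‖x‖) (g ‖x‖))
      (Metric.ball 0 1) := by
    refine ⟨hEm, ?_⟩
    rw [hasFiniteIntegral_iff_ofReal (Eventually.of_forall fun x => hEn0 _ _)]
    exact hlint.trans_lt ENNReal.ofReal_lt_top
  obtain ⟨hEi1, hEe⟩ := integral_ball_radial (h := fun r => radEnergy f ε (U r) (g r)) hEi
    (Eventually.of_forall fun x => rfl)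
  have hE1 : ∫ x in Metric.ball (0 : E (j + 2)) 1, radEnergy f ε (U ‖x‖) (g ‖x‖) ≤ E0 := by
    rw [integral_eq_lintegral_of_nonneg_ae (Eventually.of_forall fun x => hEn0 _ _) hEm]
    exact ENNReal.toReal_le_of_le_ofReal hE0 hlint
  have hE2 : ∫ r in Ioo (0 : ℝ) 1, r ^ (j + 1) * radEnergy f ε (U r) (g r)
      ≤ E0 / sphArea (j + 2) := by
    rw [le_div_iff₀ hσ, mul_comm, ← hEe]; exact hE1
  obtain ⟨hqq, hqle⟩ := sphAvg_sq_le (memLp_radial hGμ)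
  have hqle2 : ∫ x in Metric.ball (0 : E (j + 2)) 1, (inner ℝ x (Gμ x) / ‖x‖) ^ 2
      ≤ ∫ x in Metric.ball (0 : E (j + 2)) 1, ‖Gμ x‖ ^ 2 := by
    refine integral_mono (memLp_radial hGμ).integrable_sq hGμ.norm.integrable_sq fun x => ?_
    simp only
    rw [← sq_abs]
    exact pow_le_pow_left₀ (abs_nonneg _) (abs_radial_le x (Gμ x)) 2
  set N2 := 1 + (∫ x in Metric.ball (0 : E (j + 2)) 1, ‖Gμ x‖ ^ 2) / sphArea (j + 2) with hN2
  have hN1 : 1 ≤ N2 := by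
    have : 0 ≤ ∫ x in Metric.ball (0 : E (j + 2)) 1, ‖Gμ x‖ ^ 2 :=
      integral_nonneg fun x => sq_nonneg _
    have := div_nonneg this hσ.le
    linarith
  have hq2 : ∫ r in Ioo (0 : ℝ) 1, r ^ (j + 1) * radPart Gμ r ^ 2 ≤ N2 := by
    have h1 : ∫ r in Ioo (0 : ℝ) 1, r ^ (j + 1) * radPart Gμ r ^ 2
        ≤ (∫ x in Metric.ball (0 : E (j + 2)) 1, ‖Gμ x‖ ^ 2) / sphArea (j + 2) := by
      rw [le_div_iff₀ hσ, mul_comm]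
      exact hqle.trans hqle2
    linarith
  refine ⟨U, g, m, radPart Gμ, ⟨hj, hε0, hε.2, ?_, hUc, hUd, hgc, ?_, ?_, hqμ, ?_, ?_, ?_, ?_, ?_⟩,
    hfin⟩
  · rw [← Real.sqrt_one]
    exact Real.sqrt_le_sqrt hN1
  · intro r hr
    have hFc' : ContinuousOn (fun s => s ^ (j + 1) * F s) (Ioo 0 1) :=
      (continuous_pow _).continuousOn.mul (hFc.mono Ioo_subset_Ioc_self)
    have h1 : HasDerivAt P (r ^ (j + 1) * F r) r :=
      intervalIntegral.integral_hasDerivAt_right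
        (hFI.mono_set (by
          rw [uIcc_of_le hr.1.le, uIcc_of_le zero_le_one]; exact Icc_subset_Icc_right hr.2.le))
        (hFc'.stronglyMeasurableAtFilter isOpen_Ioo r hr)
        (hFc'.continuousAt (isOpen_Ioo.mem_nhds hr))
    refine h1.congr_of_eventuallyEq ?_
    filter_upwards [isOpen_Ioo.mem_nhds hr] with s hs
    have : s ^ (j + 1) ≠ 0 := (pow_pos hs.1 _).ne'
    simp only [hg]
    field_simp
  · simp only [hg, hP, hP1, zero_div]
  · intro a _
    simp [hm]
  · obtain ⟨B, hB⟩ := sq_primitive_le hFI hF2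
    refine ⟨B, fun r hr => ?_⟩
    have hp : 0 < r ^ (j + 1) := pow_pos hr.1 _
    have h1 := hB r hr
    have h2 : r ^ (j + 1) * g r ^ 2 = P r ^ 2 / r ^ (j + 1) := by
      simp only [hg]; field_simp
    rw [h2, div_le_iff₀ hp]
    calc P r ^ 2 ≤ B * r ^ (j + 2) := h1
      _ = B * r * r ^ (j + 1) := by ring
  · intro a ha
    exact (integral_right_le hEi1 (fun r hr => mul_nonneg (pow_nonneg hr.1.le _) (hEn0 _ _)) ha).trans
      hE2
  · intro a ha
    rw [intervalIntegrable_iff_integrableOn_Ioo_of_le ha.2]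
    exact hqq.mono_set (Ioo_subset_Ioo_left ha.1.le)
  · intro a ha
    rw [Real.sq_sqrt (by linarith)]
    exact (integral_right_le hqq (fun r hr => mul_nonneg (pow_nonneg hr.1.le _) (sq_nonneg _)) ha).trans
      hq2

theorem volume_real_ball (j : ℕ) :
    (volume : Measure (E (j + 2))).real (Metric.ball 0 1) = sphArea (j + 2) / ((j : ℝ) + 2) := by
  have h1 := integral_ball_radial (j := j) (F := fun _ => 1) (h := fun _ => 1)
    (integrable_const 1) (Eventually.of_forall fun _ => rfl)
  have h2 := h1.2
  rw [setIntegral_const, smul_eq_mul, mul_one] at h2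
  rw [h2, ← integral_Ioc_eq_integral_Ioo, ← intervalIntegral.integral_of_le zero_le_one]
  simp only [mul_one, integral_pow, one_pow]
  rw [zero_pow (by omega)]
  push_cast
  rw [show (j : ℝ) + 1 + 1 = j + 2 by ring]
  ring

/-- The discrepancy of a radially symmetric time slice is controlled by its dissipation. -/
theorem exists_slice_bound {j : ℕ} (hj : j ≤ 1) {f : ℝ → ℝ} {k C : ℝ} (hw : DoubleWell f k C)
    (hf : ContDiff ℝ 1 f) {E0 cbar : ℝ} (hE0 : 0 ≤ E0) (hc : |cbar| < 1) {θ : ℝ} (hθ : 0 < θ) :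
    ∃ K, 0 ≤ K ∧ ∃ ε₀, 0 < ε₀ ∧ ∀ (ε δ : ℝ) (c μ τ : E (j + 2) → ℝ) (G Gμ : E (j + 2) → E (j + 2)),
      ε ∈ Ioc (0 : ℝ) 1 → ε ≤ ε₀ → 0 < δ → δ ^ (j + 1) = ε → RadialSlice j f ε E0 c μ τ G Gμ →
      ⨍ x in Metric.ball 0 1, c x = cbar →
      IntegrableOn (fun x => ε * (‖G x‖ ^ 2 / 2) - f (c x) / ε) (Metric.ball 0 1) →
      ∫ x in Metric.ball 0 1, |ε * (‖G x‖ ^ 2 / 2) - f (c x) / ε|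
        ≤ θ + K * δ * (1 + ∫ x in Metric.ball 0 1, ‖Gμ x‖ ^ 2) := by
  have hσ := sphArea_pos j
  obtain ⟨K, hK, ε₀, hε₀, h⟩ := exists_disc_bound hw (div_nonneg hE0 hσ.le) hc (div_pos hθ hσ)
  refine ⟨K * (1 + sphArea (j + 2)), mul_nonneg hK (by linarith), ε₀, hε₀,
    fun ε δ c μ τ G Gμ hε hεε hδ hδε hs hmass hint => ?_⟩
  obtain ⟨U, g, m, q, hp, hae⟩ := exists_profile hj hf hw.nonneg hε hE0 hs
  have hci : IntegrableOn c (Metric.ball 0 1) := hs.c_mem.integrable (by norm_num)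
  have hm1 : ∫ s in (0 : ℝ)..1, s ^ (j + 1) * U s = cbar / ((j : ℝ) + 2) := by
    rw [intervalIntegral.integral_of_le zero_le_one, integral_Ioc_eq_integral_Ioo]
    have h1 := (integral_ball_radial (h := U) hci (hae.mono fun x hx => hx.1)).2
    rw [setAverage_eq, volume_real_ball, h1, smul_eq_mul] at hmass
    rw [← hmass]
    field_simp
  have habs : ∀ᵐ x ∂volume.restrict (Metric.ball 0 1), |ε * (‖G x‖ ^ 2 / 2) - f (c x) / ε|
      = |radDisc f ε (U ‖x‖) (g ‖x‖)| := by
    filter_upwards [hae] with x hx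
    rw [hx.1, hx.2, radDisc, mul_div_assoc]
  obtain ⟨h1, h2⟩ := integral_ball_radial (h := fun r => |radDisc f ε (U r) (g r)|)
    hint.abs habs
  have h3 := integral_Ioo_le_of_right h1 (h j ε δ _ U g m q hεε hδ hδε hp hm1)
  set I := ∫ x in Metric.ball (0 : E (j + 2)) 1, ‖Gμ x‖ ^ 2 with hI
  have hI0 : 0 ≤ I := integral_nonneg fun x => sq_nonneg _
  rw [Real.sq_sqrt (by have := div_nonneg hI0 hσ.le; linarith)] at h3
  rw [h2]
  calc sphArea (j + 2) * ∫ r in Ioo (0 : ℝ) 1, r ^ (j + 1) * |radDisc f ε (U r) (g r)|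
      ≤ sphArea (j + 2) * (θ / sphArea (j + 2) + K * δ * (1 + I / sphArea (j + 2))) :=
        mul_le_mul_of_nonneg_left h3 hσ.le
    _ = θ + K * δ * (sphArea (j + 2) + I) := by field_simp
    _ ≤ θ + K * δ * ((1 + sphArea (j + 2)) * (1 + I)) := by
        gcongr
        nlinarith
    _ = _ := by ring

/-! ### Slices of the space-time cylinder -/

theorem restrict_cyl (I : Set ℝ) (Ω : Set (E d)) :
    (volume : Measure (ℝ × E d)).restrict (cyl I Ω)
      = (volume.restrict I).prod (volume.restrict Ω) := by
  rw [cyl, Measure.volume_eq_prod, Measure.prod_restrict]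

theorem ae_slice {I : Set ℝ} {Ω : Set (E d)} {p : ℝ × E d → Prop}
    (h : ∀ᵐ z ∂volume.restrict (cyl I Ω), p z) :
    ∀ᵐ t ∂volume.restrict I, ∀ᵐ x ∂volume.restrict Ω, p (t, x) := by
  rw [restrict_cyl] at h
  exact Measure.ae_ae_of_ae_prod h

theorem integrable_slice {I : Set ℝ} {Ω : Set (E d)} {F : ℝ × E d → ℝ}
    (h : IntegrableOn F (cyl I Ω)) :
    ∀ᵐ t ∂volume.restrict I, IntegrableOn (fun x => F (t, x)) Ω := by
  rw [IntegrableOn, restrict_cyl] at h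
  exact h.prod_right_ae

theorem memLp_slice {V : Type*} [NormedAddCommGroup V] {I : Set ℝ} {Ω : Set (E d)}
    {F : ℝ × E d → V} (h : MemLp F 2 (volume.restrict (cyl I Ω))) :
    ∀ᵐ t ∂volume.restrict I, MemLp (fun x => F (t, x)) 2 (volume.restrict Ω) := by
  rw [restrict_cyl] at h
  have h1 := h.aestronglyMeasurable.prodMk_left
  have h2 : ∀ᵐ t ∂volume.restrict I, Integrable (fun x => ‖F (t, x)‖ ^ 2) (volume.restrict Ω) :=
    ((memLp_two_iff_integrable_sq_norm h.aestronglyMeasurable).1 h).prod_right_ae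
  filter_upwards [h1, h2] with t ht1 ht2
  exact (memLp_two_iff_integrable_sq_norm ht1).2 ht2

theorem integral_cyl {I : Set ℝ} {Ω : Set (E d)} {F : ℝ × E d → ℝ}
    (h : IntegrableOn F (cyl I Ω)) :
    ∫ z in cyl I Ω, F z = ∫ t in I, ∫ x in Ω, F (t, x) := by
  rw [IntegrableOn, restrict_cyl] at h
  rw [restrict_cyl, integral_prod _ h]

theorem integrable_integral_slice {I : Set ℝ} {Ω : Set (E d)} {F : ℝ × E d → ℝ}
    (h : IntegrableOn F (cyl I Ω)) : IntegrableOn (fun t => ∫ x in Ω, F (t, x)) I := by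
  rw [IntegrableOn, restrict_cyl] at h
  exact h.integral_prod_left

/-! ### Solenoidal fields -/

theorem clm_apply_eq_sum (L : E d →L[ℝ] ℝ) (y : E d) :
    L y = ∑ i, y i * L (EuclideanSpace.single i 1) := by
  have h := (EuclideanSpace.basisFun (Fin d) ℝ).sum_repr y
  conv_lhs => rw [← h]
  simp [map_sum]

/-- Integration by parts in each coordinate; `φ` need not have compact support because `w` has. -/
theorem integral_fderiv_solenoidal {Ω : Set (E d)} {w : E d → E d} (hw : IsSolenoidalTest Ω w)
    {φ : E d → ℝ} (hφ : ContDiff ℝ ∞ φ) : ∫ x, fderiv ℝ φ x (w x) = 0 := by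
  obtain ⟨hws, hwc, -, hdiv⟩ := hw
  have hwi : ∀ i, ContDiff ℝ ∞ fun x => w x i := fun i =>
    (EuclideanSpace.proj (𝕜 := ℝ) i).contDiff.comp hws
  have hwic : ∀ i, HasCompactSupport fun x => w x i := fun i =>
    hwc.comp_left (g := fun y : E d => y i) (by simp)
  have hcd : ∀ {u : E d → ℝ}, ContDiff ℝ ∞ u → ∀ i,
      Continuous fun x => fderiv ℝ u x (EuclideanSpace.single i 1) := fun hu i =>
    (hu.continuous_fderiv (by simp)).clm_apply continuous_const
  have i1 : ∀ i, Integrable fun x => w x i * fderiv ℝ φ x (EuclideanSpace.single i 1) := fun i =>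
    ((hwi i).continuous.mul (hcd hφ i)).integrable_of_hasCompactSupport (hwic i).mul_right
  have hs : ∀ i, HasCompactSupport fun x => fderiv ℝ (fun x => w x i) x (EuclideanSpace.single i 1) :=
    fun i => (hwic i).fderiv_apply (𝕜 := ℝ) _
  have i2 : ∀ i, Integrable fun x =>
      fderiv ℝ (fun x => w x i) x (EuclideanSpace.single i 1) * φ x := fun i =>
    ((hcd (hwi i) i).mul hφ.continuous).integrable_of_hasCompactSupport (hs i).mul_right
  have i3 : ∀ i, Integrable fun x => w x i * φ x := fun i =>
    ((hwi i).continuous.mul hφ.continuous).integrable_of_hasCompactSupport (hwic i).mul_right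
  have hp : ∀ i, ∫ x, w x i * fderiv ℝ φ x (EuclideanSpace.single i 1)
      = - ∫ x, fderiv ℝ (fun x => w x i) x (EuclideanSpace.single i 1) * φ x := fun i =>
    integral_mul_fderiv_eq_neg_fderiv_mul_of_integrable (i2 i) (i1 i) (i3 i)
      (fun x _ => (hwi i).differentiable (by simp) x) fun x _ => hφ.differentiable (by simp) x
  have hj : ∀ i x, fderiv ℝ (fun x => w x i) x (EuclideanSpace.single i 1) = jac w x i i :=
    fun i x => by
    have h1 : HasFDerivAt (fun x => w x i)
        ((EuclideanSpace.proj (𝕜 := ℝ) i).comp (fderiv ℝ w x)) x :=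
      (EuclideanSpace.proj (𝕜 := ℝ) i).hasFDerivAt.comp x
        (hws.differentiable (by simp) x).hasFDerivAt
    rw [h1.fderiv]
    simp [jac]
  calc ∫ x, fderiv ℝ φ x (w x)
      = ∑ i, ∫ x, w x i * fderiv ℝ φ x (EuclideanSpace.single i 1) := by
        rw [← integral_finsetSum _ fun i _ => i1 i]
        exact integral_congr_ae (Eventually.of_forall fun x => clm_apply_eq_sum _ _)
    _ = - ∑ i, ∫ x, fderiv ℝ (fun x => w x i) x (EuclideanSpace.single i 1) * φ x := by
        simp only [hp, Finset.sum_neg_distrib]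
    _ = - ∫ x, ∑ i, fderiv ℝ (fun x => w x i) x (EuclideanSpace.single i 1) * φ x := by
        rw [← integral_finsetSum _ fun i _ => i2 i]
    _ = 0 := by
        have : ∀ x, ∑ i, fderiv ℝ (fun x => w x i) x (EuclideanSpace.single i 1) * φ x = 0 :=
          fun x => by
          rw [← Finset.sum_mul]
          simp only [hj]
          have := hdiv x
          rw [Matrix.trace] at this
          simp only [Matrix.diag] at this
          rw [this, zero_mul]
        simp [this]

/-- Smooth solenoidal fields are orthogonal to gradients, and this passes to `L²` limits since `∇φ`
is bounded and `Ω` has finite measure. -/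
theorem MemL2sigma.integral_fderiv_eq_zero {Ω : Set (E d)} (hΩ : volume Ω ≠ ⊤)
    {w : E d → E d} (hw : MemL2sigma Ω w) {φ : E d → ℝ} (hφ : ContDiff ℝ ∞ φ)
    (hc : HasCompactSupport φ) : ∫ x in Ω, fderiv ℝ φ x (w x) = 0 := by
  have : IsFiniteMeasure (volume.restrict Ω) :=
    ⟨by rw [Measure.restrict_apply_univ]; exact hΩ.lt_top⟩
  have hcont : Continuous (fderiv ℝ φ) := hφ.continuous_fderiv (by simp)
  obtain ⟨B, hB⟩ := (hc.fderiv (𝕜 := ℝ)).exists_bound_of_continuous hcont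
  have hB0 : 0 ≤ B := (norm_nonneg _).trans (hB 0)
  have hint : ∀ {y : E d → E d}, Integrable y (volume.restrict Ω) →
      Integrable (fun x => fderiv ℝ φ x (y x)) (volume.restrict Ω) := fun {y} hy => by
    refine (hy.norm.const_mul B).mono' ?_ (Eventually.of_forall fun x => ?_)
    · exact (ContinuousLinearMap.apply ℝ ℝ).flip.aestronglyMeasurable_comp₂
        hcont.aestronglyMeasurable hy.aestronglyMeasurable
    · exact ((fderiv ℝ φ x).le_opNorm _).trans (mul_le_mul_of_nonneg_right (hB x) (norm_nonneg _))
  have hw1 : Integrable w (volume.restrict Ω) := hw.1.integrable (by norm_num)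
  set V := (volume.restrict Ω).real univ with hV
  rw [← abs_nonpos_iff]
  refine le_of_forall_pos_le_add fun δ hδ => ?_
  set s := Real.sqrt V with hs
  set η := δ / (B * s + 1) with hη
  have hs0 : 0 ≤ s := Real.sqrt_nonneg _
  have hη0 : 0 < η := by positivity
  obtain ⟨y, hy, hyn⟩ := hw.2 η hη0
  have hy1 : Integrable y (volume.restrict Ω) :=
    (hy.1.continuous.integrable_of_hasCompactSupport hy.2.1).integrableOn
  have e0 : ∫ x in Ω, fderiv ℝ φ x (y x) = 0 := by
    rw [setIntegral_eq_integral_of_forall_compl_eq_zero, integral_fderiv_solenoidal hy hφ]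
    intro x hx
    rw [image_eq_zero_of_notMem_tsupport fun h => hx (hy.2.2.1 h), map_zero]
  have e1 : ∫ x in Ω, fderiv ℝ φ x (w x) = ∫ x in Ω, fderiv ℝ φ x (w x - y x) := by
    simp only [map_sub]
    rw [integral_sub (hint hw1) (hint hy1), e0, sub_zero]
  have hsub : Integrable (fun x => w x - y x) (volume.restrict Ω) := hw1.sub hy1
  have hL1 : ∫ x in Ω, ‖w x - y x‖ ≤ η * s := by
    have h1 := eLpNorm_le_eLpNorm_mul_rpow_measure_univ (μ := volume.restrict Ω) (p := 1) (q := 2)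
      (by norm_num) hsub.aestronglyMeasurable
    have h2 : ENNReal.ofReal (∫ x in Ω, ‖w x - y x‖) ≤ ENNReal.ofReal (η * s) := by
      rw [ofReal_integral_norm_eq_lintegral_enorm hsub, ← eLpNorm_one_eq_lintegral_enorm]
      refine h1.trans ?_
      rw [ENNReal.ofReal_mul hη0.le]
      refine mul_le_mul' hyn.le ?_
      rw [hs, Real.sqrt_eq_rpow, hV, Measure.real,
        ← ENNReal.ofReal_rpow_of_nonneg ENNReal.toReal_nonneg (by norm_num),
        ENNReal.ofReal_toReal (measure_ne_top _ _)]
      norm_num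
    exact (ENNReal.ofReal_le_ofReal_iff (by positivity)).1 h2
  rw [e1, zero_add]
  calc |∫ x in Ω, fderiv ℝ φ x (w x - y x)|
      ≤ ∫ x in Ω, ‖fderiv ℝ φ x (w x - y x)‖ := by
        rw [← Real.norm_eq_abs]
        exact norm_integral_le_integral_norm _
    _ ≤ ∫ x in Ω, B * ‖w x - y x‖ := integral_mono (hint hsub).norm (hsub.norm.const_mul B)
        fun x => ((fderiv ℝ φ x).le_opNorm _).trans
          (mul_le_mul_of_nonneg_right (hB x) (norm_nonneg _))
    _ = B * ∫ x in Ω, ‖w x - y x‖ := integral_const_mul _ _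
    _ ≤ B * (η * s) := mul_le_mul_of_nonneg_left hL1 hB0
    _ = η * (B * s) := by ring
    _ ≤ η * (B * s + 1) := by gcongr; linarith
    _ = δ := by rw [hη]; field_simp

/-- Fields in `L²_σ` are divergence free. -/
theorem MemL2sigma.trace_eq_zero {Ω : Set (E d)} (hΩ : IsOpen Ω) (hv : volume Ω ≠ ⊤)
    {w : E d → E d} (hw : MemL2sigma Ω w) {J : E d → Matrix (Fin d) (Fin d) ℝ}
    (hJ : HasWeakJac Ω w J) : ∀ᵐ x ∂volume.restrict Ω, (J x).trace = 0 := by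
  have : IsFiniteMeasure (volume.restrict Ω) :=
    ⟨by rw [Measure.restrict_apply_univ]; exact hv.lt_top⟩
  have hl : LocallyIntegrableOn (fun x => (J x).trace) Ω := by
    have : (fun x => (J x).trace) = fun x => ∑ i, J x i i := rfl
    rw [this]
    intro x hx
    have h1 : ∀ i, ∃ s ∈ 𝓝[Ω] x, IntegrableOn (fun x => J x i i) s := fun i => (hJ i i).2.1 x hx
    choose s hs hsi using h1
    refine ⟨⋂ i, s i, iInter_mem.2 hs, ?_⟩
    exact integrable_finsetSum _ fun i _ => (hsi i).mono_set (iInter_subset _ i)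
  have hw1 : Integrable w (volume.restrict Ω) := hw.1.integrable (by norm_num)
  rw [ae_restrict_iff' hΩ.measurableSet]
  refine hΩ.ae_eq_zero_of_integral_contDiff_smul_eq_zero hl fun φ hφ hc hs => ?_
  have h0 := hw.integral_fderiv_eq_zero hv hφ hc
  have hcd : ∀ i, Continuous fun x => fderiv ℝ φ x (EuclideanSpace.single i 1) := fun i =>
    (hφ.continuous_fderiv (by simp)).clm_apply continuous_const
  have hcs : ∀ i, HasCompactSupport fun x => fderiv ℝ φ x (EuclideanSpace.single i 1) :=
    fun i => hc.fderiv_apply (𝕜 := ℝ) _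
  have i1 : ∀ i, IntegrableOn (fun x => w x i * fderiv ℝ φ x (EuclideanSpace.single i 1)) Ω :=
    fun i => by
    obtain ⟨B, hB⟩ := (hcs i).exists_bound_of_continuous (hcd i)
    exact ((EuclideanSpace.proj (𝕜 := ℝ) i).integrable_comp hw1).mul_bdd (c := B)
      (hcd i).aestronglyMeasurable (Eventually.of_forall hB)
  have e1 : ∫ x in Ω, fderiv ℝ φ x (w x)
      = ∑ i, ∫ x in Ω, w x i * fderiv ℝ φ x (EuclideanSpace.single i 1) := by
    rw [← integral_finsetSum _ fun i _ => i1 i]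
    exact integral_congr_ae (Eventually.of_forall fun x => clm_apply_eq_sum _ _)
  have e2 : ∑ i, ∫ x in Ω, w x i * fderiv ℝ φ x (EuclideanSpace.single i 1)
      = - ∑ i, ∫ x, J x i i * φ x := by
    rw [← Finset.sum_neg_distrib]
    exact Finset.sum_congr rfl fun i _ => by
      rw [(hJ i i).2.2 φ hφ hc hs, setIntegral_mul_test hs]
  have e3 : ∑ i, ∫ x, J x i i * φ x = ∫ x, φ x • (J x).trace := by
    rw [← integral_finsetSum _ fun i _ =>
      integrable_mul_test (hJ i i).2.1 hφ.continuous hc hs]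
    refine integral_congr_ae (Eventually.of_forall fun x => ?_)
    simp only [Matrix.trace, Matrix.diag, smul_eq_mul]
    rw [Finset.mul_sum]
    exact Finset.sum_congr rfl fun i _ => mul_comm _ _
  linarith

/-! ### The case `A(s) = s` -/

/-- Differentiating `A(s) = s` gives `√a = 1`. -/
theorem eq_one_of_primA {a : ℝ → ℝ} (ha : Continuous a) (hA : ∀ s, primA a s = s) (s : ℝ) :
    a s = 1 := by
  have hc : Continuous fun s => Real.sqrt (a s) := ha.sqrt
  have h1 : HasDerivAt (primA a) (Real.sqrt (a s)) s := hasDerivAt_primitive hc s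
  have h2 : HasDerivAt (primA a) 1 s := by
    have : primA a = id := funext hA
    rw [this]; exact hasDerivAt_id s
  have h3 := h1.unique h2
  rwa [Real.sqrt_eq_one] at h3

theorem discrepancy_eq {d : ℕ} {ε : ℝ} {f a : ℝ → ℝ} (ha : ∀ s, a s = 1) (s : ℝ) (g : E d) :
    discrepancy ε f a s g = ε * (‖g‖ ^ 2 / 2) - f s / ε := by
  simp only [discrepancy, gradA, ha, Real.sqrt_one, one_smul]
  ring

theorem energyDensity_eq {d : ℕ} {ε : ℝ} {f a : ℝ → ℝ} (ha : ∀ s, a s = 1) (s : ℝ) (g : E d) :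
    energyDensity ε f a s g = ε * (‖g‖ ^ 2 / 2) + f s / ε := by
  simp only [energyDensity, gradA, ha, Real.sqrt_one, one_smul]

/-! ### Conservation of mass -/

/-- Rescaling time by `T = t + 1` reduces to the unit interval, where a vanishing weak derivative
means constant; continuity on `[0, ∞)` extends the equality to `0` and `t`. -/
theorem eqOn_of_weak_deriv_zero {M : ℝ → ℝ} (hM : ContinuousOn M (Ici 0))
    (h : ∀ χ : ℝ → ℝ, ContDiff ℝ ∞ χ → HasCompactSupport χ → tsupport χ ⊆ Ioi 0 →
      ∫ t in Ioi (0 : ℝ), deriv χ t * M t = 0) {t : ℝ} (ht : 0 ≤ t) : M t = M 0 := by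
  set T := t + 1 with hT
  have hT0 : 0 < T := by linarith
  set v : ℝ → ℝ := fun s => M (T * s) with hv
  have hvc : ContinuousOn v (Ici 0) := hM.comp (continuous_const_mul T).continuousOn
    fun s hs => mul_nonneg hT0.le hs
  have hvl : LocallyIntegrableOn v (Ioo 0 1) :=
    (hvc.mono fun s hs => hs.1.le).locallyIntegrableOn measurableSet_Ioo
  obtain ⟨c0, hc0⟩ := ae_const_of_weak_deriv_zero hvl fun k hk hkc hks => by
    obtain ⟨a, b, ha, hab, hb, hsub⟩ := exists_Ioo_of_isCompact hkc.isCompact hks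
    have hk0 : ∀ r, r ∉ Icc a b → k r = 0 := fun r hr => image_eq_zero_of_notMem_tsupport
      fun hc => hr (Ioo_subset_Icc_self (hsub hc))
    set χ : ℝ → ℝ := fun s => k (T⁻¹ * s) with hχ
    have hχs : ContDiff ℝ ∞ χ := hk.comp (contDiff_const.mul contDiff_id)
    have hχ0 : ∀ s, s ∉ Icc (T * a) (T * b) → χ s = 0 := fun s hs => hk0 _ fun hc => hs (by
      rw [inv_mul_eq_div] at hc
      exact ⟨by rw [mul_comm]; exact (le_div_iff₀ hT0).1 hc.1,
        by rw [mul_comm]; exact (div_le_iff₀ hT0).1 hc.2⟩)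
    have hχt : tsupport χ ⊆ Ioi 0 := (tsupport_subset_of_forall hχ0).trans fun s hs =>
      (mul_pos hT0 ha).trans_le hs.1
    have h1 := h χ hχs (hasCompactSupport_of_forall hχ0) hχt
    have hχd : ∀ s, deriv χ s = T⁻¹ * deriv k (T⁻¹ * s) := fun s => by
      have h2 : HasDerivAt (fun s => T⁻¹ * s) T⁻¹ s := by
        simpa using (hasDerivAt_id s).const_mul T⁻¹
      have h3 := ((contDiff_infty_iff_deriv.1 hk).1 (T⁻¹ * s)).hasDerivAt.comp s h2
      rw [mul_comm]
      exact h3.deriv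
    have h2 : ∫ s in Ioi (0 : ℝ), deriv χ s * M s = ∫ s, deriv χ s * M s :=
      setIntegral_eq_integral_of_forall_compl_eq_zero fun s hs => by
        rw [image_eq_zero_of_notMem_tsupport fun hc => hs (hχt (tsupport_deriv_subset' hc)), zero_mul]
    rw [h2] at h1
    have h3 := Measure.integral_comp_mul_left (fun s => deriv χ s * M s) T
    rw [h1, smul_zero] at h3
    have h4 : ∀ s, deriv χ (T * s) * M (T * s) = T⁻¹ * (v s * deriv k s) := fun s => by
      rw [hχd, inv_mul_cancel_left₀ hT0.ne']
      simp only [hv]; ring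
    simp only [h4] at h3
    rw [integral_const_mul] at h3
    exact (mul_eq_zero.1 h3).resolve_left (inv_ne_zero hT0.ne')
  have hE : EqOn v (fun _ => c0) (Icc 0 1) := by
    refine Measure.eqOn_Icc_of_ae_eq volume zero_ne_one ?_ (hvc.mono fun s hs => hs.1)
      continuousOn_const
    rw [← restrict_Ioo_eq_restrict_Icc]
    exact hc0
  have e1 := hE (x := t / T) ⟨by positivity, by rw [div_le_one hT0]; linarith⟩
  have e2 := hE (x := 0) ⟨le_rfl, zero_le_one⟩
  simp only [hv] at e1 e2
  rw [mul_div_cancel₀ _ hT0.ne'] at e1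
  rw [mul_zero] at e2
  rw [e1, e2]

variable {ε : ℝ} {f ρ a ν mε : ℝ → ℝ} {S : Fields d}

/-- The phase equation is tested with a function of time times a bump equal to `1` near the ball.
Gradient terms vanish there, and `div v = 0`, so only the time derivative of the mass remains. Weak
continuity in time supplies continuity of the mass. -/
theorem IsWeakSolution.mass_eq (h : IsWeakSolution (Metric.ball 0 1) ε f ρ a ν mε S) {t : ℝ}
    (ht : 0 ≤ t) : ∫ x in Metric.ball 0 1, S.c t x = ∫ x in Metric.ball 0 1, S.c0 x := by
  have hMc : ContinuousOn (fun t => ∫ x in Metric.ball (0 : E d) 1, S.c t x) (Ici 0) := by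
    have := h.c_bcw.2.2 (fun _ => 1) (memLp_const 1)
    simpa using this
  have h0 : ∫ x in Metric.ball (0 : E d) 1, S.c 0 x = ∫ x in Metric.ball (0 : E d) 1, S.c0 x :=
    integral_congr_ae h.c_init
  rw [← h0]
  refine eqOn_of_weak_deriv_zero (M := fun t => ∫ x in Metric.ball (0 : E d) 1, S.c t x) hMc
    (fun χ hχ hχc hχs => ?_) ht
  let B : ContDiffBump (0 : E d) := ⟨2, 3, by norm_num, by norm_num⟩
  have hB1 : ∀ x ∈ Metric.ball (0 : E d) 1, (B : E d → ℝ) =ᶠ[𝓝 x] 1 := fun x hx =>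
    B.eventuallyEq_one_of_mem_ball (Metric.ball_subset_ball (by norm_num [B]) hx)
  set ψ : ℝ → E d → ℝ := fun t x => χ t * B x with hψ
  have hψs : ContDiff ℝ ∞ (Function.uncurry ψ) :=
    (hχ.comp contDiff_fst).mul (B.contDiff.comp contDiff_snd)
  have hψc : HasCompactSupport (Function.uncurry ψ) := by
    refine HasCompactSupport.intro (hχc.isCompact.prod B.hasCompactSupport.isCompact)
      fun z hz => ?_
    simp only [Function.uncurry, hψ]
    by_cases h1 : z.1 ∈ tsupport χ
    · have h2 : z.2 ∉ tsupport B := fun h2 => hz ⟨h1, h2⟩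
      rw [image_eq_zero_of_notMem_tsupport h2, mul_zero]
    · rw [image_eq_zero_of_notMem_tsupport h1, zero_mul]
  obtain ⟨hi1, -, heq⟩ := h.phase ψ hψs hψc
  have hχ0 : χ 0 = 0 := image_eq_zero_of_notMem_tsupport fun hc => lt_irrefl (0 : ℝ) (hχs hc)
  have hd0 : ∀ t, ∀ x ∈ Metric.ball (0 : E d) 1, fderiv ℝ (ψ t) x = 0 := fun t x hx => by
    have : ψ t =ᶠ[𝓝 x] fun _ => χ t := (hB1 x hx).mono fun y hy => by
      simp [hψ, hy]
    rw [this.fderiv_eq, fderiv_const_apply]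
  have e1 : ∫ z in cyl (Ioi 0) (Metric.ball 0 1), S.diffusion mε ψ z.1 z.2 = 0 := by
    refine setIntegral_eq_zero_of_forall_eq_zero fun z hz => ?_
    simp [Fields.diffusion, hd0 z.1 z.2 hz.2]
  have e2 : ∫ x in Metric.ball 0 1, S.c0 x * ψ 0 x = 0 := by
    simp [hψ, hχ0]
  rw [e1, e2, add_zero, integral_cyl hi1] at heq
  refine Eq.trans (integral_congr_ae ?_) heq
  filter_upwards [h.gradv_weak, ae_restrict_mem measurableSet_Ioi] with t h1 h2
  have htr := (h.v_sigma t (le_of_lt h2)).trace_eq_zero Metric.isOpen_ball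
    measure_ball_lt_top.ne h1.1
  rw [← integral_const_mul]
  refine integral_congr_ae ?_
  filter_upwards [htr, ae_restrict_mem measurableSet_ball] with x h3 h4
  have h5 : B x = 1 := (hB1 x h4).eq_of_nhds
  simp only [Fields.transport, h3, hd0 t x h4]
  simp only [hψ, h5]
  simp
  ring

/-! ### Energy bounds -/

/-- The energy inequality starts from the slice at time `0`, whose gradient agrees with that of the
initial datum by uniqueness. The maxima with `1` and `0` yield a nonnegative constant that bounds
both energies at once. -/
theorem IsWeakSolution.initial_energy_le {K0 k0 R : ℝ}
    (h : IsWeakSolution (Metric.ball 0 1) ε f ρ a ν mε S)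
    (hρ : ∀ s, k0 ≤ ρ s ∧ ρ s ≤ K0)
    (hR : (∫⁻ x in Metric.ball 0 1, ENNReal.ofReal (‖S.v0 x‖ ^ 2 / 2))
        + freeEnergy (Metric.ball 0 1) ε f a S.c0 S.gradc0 ≤ ENNReal.ofReal R) :
    kineticEnergy (Metric.ball 0 1) ρ (S.c 0) (S.v 0)
      + freeEnergy (Metric.ball 0 1) ε f a (S.c 0) (S.gradc 0)
      ≤ ENNReal.ofReal (max K0 1 * max R 0) := by
  have hK : (0 : ℝ) ≤ max K0 1 := zero_le_one.trans (le_max_right _ _)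
  have hG : ∀ᵐ x ∂volume.restrict (Metric.ball (0 : E d) 1), S.gradc 0 x = S.gradc0 x :=
    (h.gradc_weak 0 le_rfl).ae_unique Metric.isOpen_ball h.c0_mem.2.2 h.c_init
  have h1 : freeEnergy (Metric.ball 0 1) ε f a (S.c 0) (S.gradc 0)
      = freeEnergy (Metric.ball 0 1) ε f a S.c0 S.gradc0 := by
    refine lintegral_congr_ae ?_
    filter_upwards [hG, h.c_init] with x hx1 hx2
    rw [hx1, hx2]
  have h2 : kineticEnergy (Metric.ball 0 1) ρ (S.c 0) (S.v 0)
      ≤ ENNReal.ofReal (max K0 1)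
        * ∫⁻ x in Metric.ball 0 1, ENNReal.ofReal (‖S.v0 x‖ ^ 2 / 2) := by
    rw [← lintegral_const_mul' _ _ ENNReal.ofReal_ne_top]
    refine lintegral_mono_ae ?_
    filter_upwards [h.v_init] with x hx
    rw [hx, ← ENNReal.ofReal_mul hK, mul_div_assoc]
    refine ENNReal.ofReal_le_ofReal (mul_le_mul_of_nonneg_right ?_ (by positivity))
    exact (hρ _).2.trans (le_max_left _ _)
  have hK1 : (1 : ℝ≥0∞) ≤ ENNReal.ofReal (max K0 1) := by
    rw [← ENNReal.ofReal_one]; exact ENNReal.ofReal_le_ofReal (le_max_right _ _)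
  calc _ ≤ ENNReal.ofReal (max K0 1)
          * (∫⁻ x in Metric.ball 0 1, ENNReal.ofReal (‖S.v0 x‖ ^ 2 / 2))
        + ENNReal.ofReal (max K0 1) * freeEnergy (Metric.ball 0 1) ε f a S.c0 S.gradc0 := by
        rw [h1]
        exact add_le_add h2 (le_mul_of_one_le_left' hK1)
    _ ≤ ENNReal.ofReal (max K0 1) * ENNReal.ofReal R := by
        rw [← mul_add]; exact mul_le_mul' le_rfl hR
    _ ≤ _ := by
        rw [← ENNReal.ofReal_mul hK]
        exact ENNReal.ofReal_le_ofReal (mul_le_mul_of_nonneg_left (le_max_left _ _) hK)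

theorem IsWeakSolution.freeEnergy_le (h : IsWeakSolution (Metric.ball 0 1) ε f ρ a ν mε S)
    {E0 : ℝ} (hE : kineticEnergy (Metric.ball 0 1) ρ (S.c 0) (S.v 0)
      + freeEnergy (Metric.ball 0 1) ε f a (S.c 0) (S.gradc 0) ≤ ENNReal.ofReal E0)
    {t : ℝ} (ht : 0 ≤ t) :
    freeEnergy (Metric.ball 0 1) ε f a (S.c t) (S.gradc t) ≤ ENNReal.ofReal E0 := by
  refine le_trans ?_ ((h.energy_zero t ht).trans hE)
  rw [add_assoc, add_assoc]
  exact le_add_left (le_add_right le_rfl)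

theorem IsWeakSolution.dissipation_le (h : IsWeakSolution (Metric.ball 0 1) ε f ρ a ν mε S)
    {E0 κ : ℝ} (hE0 : 0 ≤ E0) (hE : kineticEnergy (Metric.ball 0 1) ρ (S.c 0) (S.v 0)
      + freeEnergy (Metric.ball 0 1) ε f a (S.c 0) (S.gradc 0) ≤ ENNReal.ofReal E0)
    (hκ : 0 < κ) (hm : ∀ s, κ ≤ mε s) {T : ℝ} (hT : 0 ≤ T) :
    ∫ z in cyl (Ioo 0 T) (Metric.ball 0 1), ‖S.gradμ z.1 z.2‖ ^ 2 ≤ E0 / κ := by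
  have h1 : ∫⁻ z in cyl (Ioo 0 T) (Metric.ball 0 1),
      ENNReal.ofReal (mε (S.c z.1 z.2) * ‖S.gradμ z.1 z.2‖ ^ 2) ≤ ENNReal.ofReal E0 :=
    le_trans (le_add_left le_rfl) ((h.energy_zero T hT).trans hE)
  have h2 : ENNReal.ofReal κ * ∫⁻ z in cyl (Ioo 0 T) (Metric.ball 0 1),
      ENNReal.ofReal (‖S.gradμ z.1 z.2‖ ^ 2) ≤ ENNReal.ofReal E0 := by
    rw [← lintegral_const_mul' _ _ ENNReal.ofReal_ne_top]
    refine le_trans (lintegral_mono fun z => ?_) h1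
    rw [← ENNReal.ofReal_mul hκ.le]
    exact ENNReal.ofReal_le_ofReal (mul_le_mul_of_nonneg_right (hm _) (sq_nonneg _))
  have hsub : cyl (Ioo 0 T) (Metric.ball (0 : E d) 1) ⊆ cyl (Ioi 0) (Metric.ball 0 1) :=
    prod_mono_left Ioo_subset_Ioi_self
  have hmem := h.gradμ_L2.mono_measure (Measure.restrict_mono_set _ hsub)
  rw [integral_eq_lintegral_of_nonneg_ae (Eventually.of_forall fun z => sq_nonneg _)
    (hmem.aestronglyMeasurable.norm.pow 2), le_div_iff₀ hκ, mul_comm]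
  have h3 := ENNReal.toReal_le_of_le_ofReal hE0 h2
  rwa [ENNReal.toReal_mul, ENNReal.toReal_ofReal hκ.le] at h3

/-! ### Slices of radially symmetric solutions -/

/-- With `a = 1` the potential equation reads `μ = f'(c)/ε - ε Δc`. The space-time conditions hold
on almost every slice by Fubini. -/
theorem IsWeakSolution.ae_radialSlice {j : ℕ} {S : Fields (j + 2)}
    (h : IsWeakSolution (Metric.ball 0 1) ε f ρ a ν mε S) (hr : S.IsRadial (Metric.ball 0 1))
    (ha : ∀ s, a s = 1) {E0 : ℝ} (hE : kineticEnergy (Metric.ball 0 1) ρ (S.c 0) (S.v 0)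
      + freeEnergy (Metric.ball 0 1) ε f a (S.c 0) (S.gradc 0) ≤ ENNReal.ofReal E0)
    {T : ℝ} (hT : 0 < T) :
    ∀ᵐ t ∂volume.restrict (Ioo 0 T), RadialSlice j f ε E0 (S.c t) (S.μ t)
      (fun x => (S.hessc t x).trace) (S.gradc t) (S.gradμ t) := by
  have hI : Ioo 0 T ⊆ Ioi (0 : ℝ) := Ioo_subset_Ioi_self
  have hsub : cyl (Ioo 0 T) (Metric.ball (0 : E (j + 2)) 1) ⊆ cyl (Ioi 0) (Metric.ball 0 1) :=
    prod_mono_left hI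
  obtain ⟨-, ⟨Uc, hUc⟩, ⟨Uμ, hUμ⟩⟩ := hr
  have hda : deriv a = 0 := by
    have : a = fun _ => 1 := funext ha
    rw [this]; funext s; simp
  have s1 := memLp_slice (h.μ_L2 T hT)
  have s2 := ae_all_iff.2 fun i => memLp_slice (h.hessc_L2 T hT i i)
  have s3 := ae_restrict_of_ae_restrict_of_subset hI (memLp_slice h.gradμ_L2)
  have s4 := ae_restrict_of_ae_restrict_of_subset hI h.gradμ_weak
  have s5 := ae_restrict_of_ae_restrict_of_subset hI (ae_slice hUc)
  have s6 := ae_restrict_of_ae_restrict_of_subset hI (ae_slice hUμ)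
  have s7 := ae_restrict_of_ae_restrict_of_subset hI (ae_slice h.potential)
  have s8 := ae_restrict_of_ae_restrict_of_subset hI h.neumann
  filter_upwards [s1, s2, s3, s4, s5, s6, s7, s8, ae_restrict_mem measurableSet_Ioo] with
    t h1 h2 h3 h4 h5 h6 h7 h8 ht
  refine ⟨h.c_bcw.1 t ht.1.le, h1, ?_, h.gradc_bcw.1 t ht.1.le, h3, h.gradc_weak t ht.1.le, h4,
    ⟨Uc t, h5⟩, ⟨Uμ t, h6⟩, ?_, h8, ?_⟩
  · exact memLp_finsetSum _ fun i _ => h2 i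
  · filter_upwards [h7] with x hx
    rw [hx]
    simp [Fields.divAGrad, hda, ha]
  · have := h.freeEnergy_le hE ht.1.le
    simpa only [freeEnergy, energyDensity_eq ha] using this

/-! ### Integration in time -/

theorem IsWeakSolution.integrable_discrepancy {d : ℕ} {ε : ℝ} {f ρ a ν mε : ℝ → ℝ} {S : Fields d}
    (h : IsWeakSolution (Metric.ball 0 1) ε f ρ a ν mε S) (ha : ∀ s, a s = 1) {T : ℝ} (hT : 0 < T) :
    IntegrableOn (fun z : ℝ × E d => discrepancy ε f a (S.c z.1 z.2) (S.gradc z.1 z.2))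
      (cyl (Ioo 0 T) (Metric.ball 0 1)) := by
  have : IsFiniteMeasure ((volume : Measure (ℝ × E d)).restrict
      (cyl (Ioo 0 T) (Metric.ball 0 1))) := by
    rw [restrict_cyl]; infer_instance
  simp only [discrepancy_eq ha]
  exact (((h.gradc_L2 T hT).norm.integrable_sq.div_const 2).const_mul ε).sub
    (((h.fc_L2 T hT).integrable (by norm_num)).div_const ε)

/-- The time integral of the discrepancy is controlled by the dissipation. -/
theorem exists_disc_integral_bound {j : ℕ} (hj : j ≤ 1) {f ρ a ν : ℝ → ℝ} {k C : ℝ}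
    (hw : DoubleWell f k C) (hf : ContDiff ℝ 1 f) (ha : ∀ s, a s = 1) {E0 cbar : ℝ} (hE0 : 0 ≤ E0)
    (hc : |cbar| < 1) {θ : ℝ} (hθ : 0 < θ) {T : ℝ} (hT : 0 < T) :
    ∃ K, 0 ≤ K ∧ ∃ ε₀, 0 < ε₀ ∧ ∀ (ε δ κ : ℝ) (mε : ℝ → ℝ) (S : Fields (j + 2)),
      ε ∈ Ioc (0 : ℝ) 1 → ε ≤ ε₀ → 0 < δ → δ ^ (j + 1) = ε → 0 < κ → (∀ s, κ ≤ mε s) →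
      IsWeakSolution (Metric.ball 0 1) ε f ρ a ν mε S → S.IsRadial (Metric.ball 0 1) →
      ⨍ x in Metric.ball 0 1, S.c0 x = cbar →
      kineticEnergy (Metric.ball 0 1) ρ (S.c 0) (S.v 0)
        + freeEnergy (Metric.ball 0 1) ε f a (S.c 0) (S.gradc 0) ≤ ENNReal.ofReal E0 →
      ∫ z in cyl (Ioo 0 T) (Metric.ball (0 : E (j + 2)) 1),
        |discrepancy ε f a (S.c z.1 z.2) (S.gradc z.1 z.2)|
        ≤ θ * T + K * (δ * T + δ / κ * E0) := by
  obtain ⟨K, hK, ε₀, hε₀, hb⟩ := exists_slice_bound hj hw hf hE0 hc hθ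
  refine ⟨K, hK, ε₀, hε₀, fun ε δ κ mε S hε hεε hδ hδε hκ hm h hr hmean hE => ?_⟩
  have hi := h.integrable_discrepancy ha hT
  have hsub : cyl (Ioo 0 T) (Metric.ball (0 : E (j + 2)) 1) ⊆ cyl (Ioi 0) (Metric.ball 0 1) :=
    prod_mono_left Ioo_subset_Ioi_self
  have hgμ : IntegrableOn (fun z : ℝ × E (j + 2) => ‖S.gradμ z.1 z.2‖ ^ 2)
      (cyl (Ioo 0 T) (Metric.ball 0 1)) :=
    (h.gradμ_L2.mono_measure (Measure.restrict_mono_set _ hsub)).norm.integrable_sq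
  have hgi := integrable_integral_slice hgμ
  have hslice : ∀ᵐ t ∂volume.restrict (Ioo 0 T),
      ∫ x in Metric.ball (0 : E (j + 2)) 1, |discrepancy ε f a (S.c t x) (S.gradc t x)|
        ≤ θ + K * δ * (1 + ∫ x in Metric.ball (0 : E (j + 2)) 1, ‖S.gradμ t x‖ ^ 2) := by
    filter_upwards [h.ae_radialSlice hr ha hE hT, integrable_slice hi,
      ae_restrict_mem measurableSet_Ioo] with t h1 h2 ht
    simp only [discrepancy_eq ha] at h2 ⊢
    refine hb ε δ _ _ _ _ _ hε hεε hδ hδε h1 ?_ h2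
    -- Conservation of mass keeps the mean at `c̄`, so the slice estimate has constants independent
    -- of time.
    rw [← hmean, setAverage_eq, setAverage_eq, h.mass_eq ht.1.le]
  rw [integral_cyl hi.abs]
  have hc1 : ∀ y : ℝ, ∫ _ in Ioo 0 T, y = T * y := fun y => by
    rw [setIntegral_const, smul_eq_mul, Measure.real, Real.volume_Ioo, sub_zero,
      ENNReal.toReal_ofReal hT.le]
  calc ∫ t in Ioo 0 T, ∫ x in Metric.ball (0 : E (j + 2)) 1,
        |discrepancy ε f a (S.c t x) (S.gradc t x)|
      ≤ ∫ t in Ioo 0 T, (θ + K * δ * (1 + ∫ x in Metric.ball (0 : E (j + 2)) 1,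
          ‖S.gradμ t x‖ ^ 2)) :=
        integral_mono_ae (integrable_integral_slice hi.abs)
          ((integrable_const _).add (((integrable_const _).add hgi).const_mul _)) hslice
    _ = θ * T + K * δ * (T + ∫ t in Ioo 0 T, ∫ x in Metric.ball (0 : E (j + 2)) 1,
          ‖S.gradμ t x‖ ^ 2) := by
        have e : ∀ I : ℝ, θ + K * δ * (1 + I) = (θ + K * δ) + K * δ * I := fun I => by ring
        simp only [e]
        rw [integral_add (integrable_const _) (hgi.const_mul (K * δ)), integral_const_mul, hc1]
        ring
    _ ≤ θ * T + K * δ * (T + E0 / κ) := by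
        rw [← integral_cyl hgμ]
        have := h.dissipation_le hE0 hE hκ hm hT.le
        gcongr
    _ = _ := by ring

/-- A lower bound of the mobilities which is large compared with `ε ^ (1 / (d - 1))`. -/
theorem Assumptions.exists_mobility_bound {f ρ a ν : ℝ → ℝ} {m : ℝ → ℝ → ℝ} {m0 mbar : ℝ → ℝ}
    {k0 K0 p ρ₁ ρ₂ : ℝ} (h : Assumptions f ρ a ν m m0 mbar k0 K0 p ρ₁ ρ₂) {δ : ℝ → ℝ}
    (hδ : Tendsto δ (𝓝[>] 0) (𝓝 0))
    (hmbar : (∀ s, m0 s = 0) → Tendsto (fun ε => δ ε / mbar ε) (𝓝[>] 0) (𝓝 0)) :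
    ∃ κ : ℝ → ℝ, (∀ᶠ ε in 𝓝[>] 0, 0 < κ ε ∧ ∀ s, κ ε ≤ m ε s) ∧
      Tendsto (fun ε => δ ε / κ ε) (𝓝[>] 0) (𝓝 0) := by
  have hk := h.k0_pos
  rcases h.m0_cases with h1 | h1
  -- In the nondegenerate case uniform convergence keeps the mobilities above half of the lower
  -- bound of `m0`.
  · refine ⟨fun _ => k0 / 2, ?_, ?_⟩
    · filter_upwards [Metric.tendstoUniformly_iff.1 h.m_tendsto (k0 / 2) (half_pos hk)] with ε hε
      refine ⟨half_pos hk, fun s => ?_⟩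
      have h2 := hε s
      rw [Real.dist_eq] at h2
      linarith [h1 s, (abs_lt.1 h2).2]
    · simpa using hδ.div_const (k0 / 2)
  · refine ⟨mbar, ?_, hmbar h1⟩
    filter_upwards [Ioc_mem_nhdsGT (zero_lt_one' ℝ)] with ε hε using h.mbar_bounds h1 ε hε

end NSCH

theorem mainTheorem3 (d : ℕ) (hd : d = 2 ∨ d = 3)
    (f ρ a ν : ℝ → ℝ) (m : ℝ → ℝ → ℝ) (m0 mbar : ℝ → ℝ) (k0 K0 p ρ₁ ρ₂ : ℝ)
    (hass : NSCH.Assumptions f ρ a ν m m0 mbar k0 K0 p ρ₁ ρ₂)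
    (hA : ∀ s : ℝ, NSCH.primA a s = s)
    (hmbar : (∀ s, m0 s = 0) →
      Tendsto (fun ε : ℝ => ε ^ (1 / ((d : ℝ) - 1)) / mbar ε) (𝓝[>] 0) (𝓝 0))
    (S : ℝ → NSCH.Fields d) (cbar : ℝ) (hcbar : cbar ∈ Ioo (-1 : ℝ) 1) (R : ℝ)
    (hsol : ∀ ε ∈ Ioc (0 : ℝ) 1,
      NSCH.IsWeakSolution (Metric.ball 0 1) ε f ρ a ν (m ε) (S ε))
    (hrad : ∀ ε ∈ Ioc (0 : ℝ) 1, (S ε).IsRadial (Metric.ball 0 1))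
    (hmean : ∀ ε ∈ Ioc (0 : ℝ) 1, ⨍ x in Metric.ball 0 1, (S ε).c0 x = cbar)
    (hR : ∀ ε ∈ Ioc (0 : ℝ) 1,
      (∫⁻ x in Metric.ball 0 1, ENNReal.ofReal (‖(S ε).v0 x‖ ^ 2 / 2))
        + NSCH.freeEnergy (Metric.ball 0 1) ε f a (S ε).c0 (S ε).gradc0 ≤ ENNReal.ofReal R) :
    ∀ T : ℝ, 0 < T →
      (∀ ε ∈ Ioc (0 : ℝ) 1, IntegrableOn
        (fun z : ℝ × NSCH.E d => NSCH.discrepancy ε f a ((S ε).c z.1 z.2) ((S ε).gradc z.1 z.2))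
        (NSCH.cyl (Ioo 0 T) (Metric.ball 0 1))) ∧
      Tendsto (fun ε : ℝ => ∫ z in NSCH.cyl (Ioo 0 T) (Metric.ball (0 : NSCH.E d) 1),
        |NSCH.discrepancy ε f a ((S ε).c z.1 z.2) ((S ε).gradc z.1 z.2)|) (𝓝[>] 0) (𝓝 0) := by
  intro T hT
  have ha := NSCH.eq_one_of_primA hass.a_smooth.continuous hA
  refine ⟨fun ε hε => (hsol ε hε).integrable_discrepancy ha hT, ?_⟩
  obtain ⟨j, hj, rfl⟩ : ∃ j : ℕ, j ≤ 1 ∧ d = j + 2 := by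
    rcases hd with rfl | rfl
    · exact ⟨0, by norm_num, rfl⟩
    · exact ⟨1, le_rfl, rfl⟩
  have hf1 : ContDiff ℝ 1 f := hass.f_smooth.of_le (by norm_num)
  obtain ⟨k, C, hw⟩ := NSCH.exists_doubleWell hass.k0_pos hass.p_ge hass.f_smooth hass.f_nonneg
    hass.f_zero hass.f_convex
  -- The length scale `ε^(1/(d-1))`, normalised so that `δ^(j+1) = ε`.
  set δ : ℝ → ℝ := fun ε => ε ^ (1 / (((j + 2 : ℕ) : ℝ) - 1)) with hδ
  have hexp : 1 / (((j + 2 : ℕ) : ℝ) - 1) = ((j + 1 : ℕ) : ℝ)⁻¹ := by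
    push_cast
    rw [one_div]
    congr 1
    ring
  have hexp0 : 0 < 1 / (((j + 2 : ℕ) : ℝ) - 1) := by rw [hexp]; positivity
  have hδt : Tendsto δ (𝓝[>] 0) (𝓝 0) := by
    have h1 : ContinuousAt δ 0 := Real.continuousAt_rpow_const _ _ (Or.inr hexp0.le)
    have h2 : δ 0 = 0 := Real.zero_rpow hexp0.ne'
    have h3 := h1.tendsto
    rw [h2] at h3
    exact h3.mono_left nhdsWithin_le_nhds
  obtain ⟨κ, hκ, hκt⟩ := hass.exists_mobility_bound hδt hmbar
  set E0 := max K0 1 * max R 0 with hE0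
  have hE00 : 0 ≤ E0 := mul_nonneg (zero_le_one.trans (le_max_right _ _)) (le_max_right _ _)
  rw [Metric.tendsto_nhds]
  intro η hη
  -- `θ` is chosen so that `θ T = η/2`; `K` is then fixed before `ε → 0`, and the remaining term
  -- drops below `η/2`.
  obtain ⟨K, hK, ε₀, hε₀, hb⟩ := NSCH.exists_disc_integral_bound (ρ := ρ) (ν := ν) hj hw hf1 ha hE00
    (abs_lt.2 hcbar) (θ := η / (2 * T)) (by positivity) hT
  have hlim : Tendsto (fun ε => K * (δ ε * T + δ ε / κ ε * E0)) (𝓝[>] 0) (𝓝 0) := by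
    have := ((hδt.mul_const T).add (hκt.mul_const E0)).const_mul K
    simpa using this
  filter_upwards [hκ, Ioc_mem_nhdsGT (zero_lt_one' ℝ), Ioc_mem_nhdsGT hε₀,
    hlim.eventually_lt_const (half_pos hη)] with ε h1 h2 h3 h4
  have hδ0 : 0 < δ ε := Real.rpow_pos_of_pos h2.1 _
  have hδε : δ ε ^ (j + 1) = ε := by
    simp only [hδ]
    rw [hexp, Real.rpow_inv_natCast_pow h2.1.le (by omega)]
  have h5 := hb ε (δ ε) (κ ε) (m ε) (S ε) h2 h3.2 hδ0 hδε h1.1 h1.2 (hsol ε h2) (hrad ε h2)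
    (hmean ε h2) ((hsol ε h2).initial_energy_le hass.ρ_bounds (hR ε h2))
  rw [Real.dist_eq, sub_zero, abs_of_nonneg (integral_nonneg fun z => abs_nonneg _)]
  have h6 : η / (2 * T) * T = η / 2 := by field_simp
  rw [h6] at h5
  linarith
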